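/- \textbf{Setting.} Let $O$ be the origin of the Euclidean plane and let $k\ge 1$ be an integer. An instance of the $k$-tour cover problem ($k$-TC) is a finite multiset $P$ of points of the plane, all different from $O$. A tour is a closed polygonal cycle through $O$ and at most $k$ points of $P$, and its length is its Euclidean length. A $k$-tour cover of $P$ is a finite collection of tours such that every point of $P$ (counted with multiplicity) lies on at least one of them; its length is the sum of the lengths of its tours. Let $\mathrm{OPT}_k(P)$ be the minimum length of a $k$-tour cover of $P$. A $c$-approximate solution for $P$ is a $k$-tour cover of $P$ of length at most $c\cdot\mathrm{OPT}_k(P)$. Running time is measured on a real RAM, which performs in one step each: addition, truncated subtraction and comparison of natural numbers; $+,-,\times,/,\sqrt{\cdot}$ and comparison of real numbers; conversion of a natural number into a real number; and a memory access with indirect addressing by natural numbers. It has no rounding operation, and the constants in its programs are natural numbers. \textbf{Theorem.} There are an absolute constant $C$, a function $T:(0,\tfrac12]\to(0,\infty)$ and two real RAM programs, \textsc{Reduce} and \textsc{Combine}, such that the following holds for every $0<\varepsilon\le\frac12$, every integer $k\ge1$, every $n\ge 1$ and every $k$-TC instance $P$ with $n$ points. \begin{enumerate} \item On input $(\varepsilon,k,P)$,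 \textsc{Reduce} outputs, within $T(\varepsilon)\, n\log (n+1)$ steps (that is, in time $O(n\log n)$ for fixed $\varepsilon$), $k$-TC instances $I_1,\dots,I_q$ such that \begin{itemize} \item $q\le C\,\varepsilon^{-1}\log(n/\varepsilon)/\log(1/\varepsilon)$; \item the instances are pairwise disjoint: no point of the plane occurs in both $I_i$ and $I_j$ for $i\ne j$; \item each $I_i$ has at most $C\,k^5\varepsilon^{-6}\log^2(1/\varepsilon)$ points, counted with multiplicity; \item in each $I_i$ the maximum distance of a point to the origin is at most $(1/\varepsilon)^{C/\varepsilon}$ times the minimum one. \end{itemize} \item Given $(\varepsilon,k,P)$ and arbitrary $(1+\varepsilon)$-approximate solutions $U_1,\dots,U_q$ for $I_1,\dots,I_q$, \textsc{Combine} outputs a $(1+C\varepsilon)$-approximate solution for $P$ within $T(\varepsilon)\,N\log(N+1)$ steps, where $N$ is $n$ plus the total number of tours of $U_1,\dots,U_q$ plus the total number of points on these tours (a point on several tours being counted once for each). \end{enumerate} -/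

import Mathlib

namespace TourCover

/-! ## The planar `k`-tour cover problem -/

/-- The Euclidean plane; the origin `O` is `0`. -/
abbrev Plane := EuclideanSpace ℝ (Fin 2)

/-- Length of the polygonal path through the listed points, in order. -/
noncomputable def pathLength : List Plane → ℝ
  | [] => 0
  | [_] => 0
  | p :: q :: l => dist p q + pathLength (q :: l)

/-- An instance is a finite family `P` of points (a multiset: different indices may carry the same
point).  A tour is given by the indices of the points it visits, in order; it starts and ends at
the origin. -/
noncomputable def tourLength (P : List Plane) (t : List ℕ) : ℝ :=
  pathLength (0 :: (t.map (fun i => P.getD i 0) ++ [0]))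

/-- Total length of a collection of tours. -/
noncomputable def coverLength (P : List Plane) (U : List (List ℕ)) : ℝ :=
  (U.map (tourLength P)).sum

/-- `U` is a `k`-tour cover of `P`: every tour is a cycle through the origin and at most `k` points
of `P`, and every point of `P` lies on some tour. -/
structure IsTourCover (k : ℕ) (P : List Plane) (U : List (List ℕ)) : Prop where
  index_lt : ∀ t ∈ U, ∀ i ∈ t, i < P.length
  nodup : ∀ t ∈ U, t.Nodup
  length_le : ∀ t ∈ U, t.length ≤ k
  covers : ∀ i < P.length, ∃ t ∈ U, i ∈ t

/-- The minimum length of a `k`-tour cover of `P` (for `k ≥ 1` covers exist). -/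
noncomputable def opt (k : ℕ) (P : List Plane) : ℝ :=
  sInf {x : ℝ | ∃ U, IsTourCover k P U ∧ x = coverLength P U}

/-- `U` is a `c`-approximate solution of the `k`-tour cover problem on `P`. -/
def IsApproxCover (c : ℝ) (k : ℕ) (P : List Plane) (U : List (List ℕ)) : Prop :=
  IsTourCover k P U ∧ coverLength P U ≤ c * opt k P

/-! ## The real RAM

A structured real random access machine.  It has natural-number and real registers, and arrays
of natural numbers and of reals with indirect addressing by natural numbers.  Unit-cost
operations: addition, truncated subtraction and comparison of natural numbers; `+, -, *, /, √` and
comparison of reals; conversion of a natural number to a real.  There is no rounding of reals, and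
the only constants in a program are natural numbers. -/

/-- Memory: registers `nreg`, `rreg` and arrays `narr`, `rarr` (array name, then address). -/
structure Store where
  nreg : ℕ → ℕ
  rreg : ℕ → ℝ
  narr : ℕ → ℕ → ℕ
  rarr : ℕ → ℕ → ℝ

inductive NExp where
  | const (c : ℕ)
  | reg (x : ℕ)
  | arr (a : ℕ) (i : NExp)
  | add (e f : NExp)
  | sub (e f : NExp)

inductive RExp where
  | ofNat (e : NExp)
  | reg (x : ℕ)
  | arr (a : ℕ) (i : NExp)
  | add (e f : RExp)
  | sub (e f : RExp)
  | mul (e f : RExp)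
  | div (e f : RExp)
  | sqrt (e : RExp)

inductive BExp where
  | nlt (e f : NExp)
  | rlt (e f : RExp)
  | not (b : BExp)
  | and (b c : BExp)

inductive Prog where
  | skip
  | setNReg (x : ℕ) (e : NExp)
  | setRReg (x : ℕ) (e : RExp)
  | setNArr (a : ℕ) (i : NExp) (e : NExp)
  | setRArr (a : ℕ) (i : NExp) (e : RExp)
  | seq (p q : Prog)
  | ite (b : BExp) (p q : Prog)
  | while (b : BExp) (p : Prog)

def NExp.eval (s : Store) : NExp → ℕ
  | .const c => c
  | .reg x => s.nreg x
  | .arr a i => s.narr a (i.eval s)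
  | .add e f => e.eval s + f.eval s
  | .sub e f => e.eval s - f.eval s

noncomputable def RExp.eval (s : Store) : RExp → ℝ
  | .ofNat e => (e.eval s : ℝ)
  | .reg x => s.rreg x
  | .arr a i => s.rarr a (i.eval s)
  | .add e f => e.eval s + f.eval s
  | .sub e f => e.eval s - f.eval s
  | .mul e f => e.eval s * f.eval s
  | .div e f => e.eval s / f.eval s
  | .sqrt e => Real.sqrt (e.eval s)

def BExp.eval (s : Store) : BExp → Prop
  | .nlt e f => e.eval s < f.eval s
  | .rlt e f => e.eval s < f.eval s
  | .not b => ¬ b.eval s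
  | .and b c => b.eval s ∧ c.eval s

/-! The cost of an expression is the number of its operations, including memory accesses. -/

def NExp.cost : NExp → ℕ
  | .const _ => 1
  | .reg _ => 1
  | .arr _ i => i.cost + 1
  | .add e f => e.cost + f.cost + 1
  | .sub e f => e.cost + f.cost + 1

def RExp.cost : RExp → ℕ
  | .ofNat e => e.cost + 1
  | .reg _ => 1
  | .arr _ i => i.cost + 1
  | .add e f => e.cost + f.cost + 1
  | .sub e f => e.cost + f.cost + 1
  | .mul e f => e.cost + f.cost + 1
  | .div e f => e.cost + f.cost + 1
  | .sqrt e => e.cost + 1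

def BExp.cost : BExp → ℕ
  | .nlt e f => e.cost + f.cost + 1
  | .rlt e f => e.cost + f.cost + 1
  | .not b => b.cost + 1
  | .and b c => b.cost + c.cost + 1

/-- Write `v` at address `i` of the array named `a`. -/
def write {α : Type*} (m : ℕ → ℕ → α) (a i : ℕ) (v : α) : ℕ → ℕ → α :=
  Function.update m a (Function.update (m a) i v)

/-- `Exec p s t s'`: started in memory `s`, the program `p` halts after exactly `t` steps with
memory `s'`. -/
inductive Exec : Prog → Store → ℕ → Store → Prop where
  | skip (s : Store) : Exec .skip s 1 s
  | setNReg (x : ℕ) (e : NExp) (s : Store) :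
      Exec (.setNReg x e) s (e.cost + 1)
        { s with nreg := Function.update s.nreg x (e.eval s) }
  | setRReg (x : ℕ) (e : RExp) (s : Store) :
      Exec (.setRReg x e) s (e.cost + 1)
        { s with rreg := Function.update s.rreg x (e.eval s) }
  | setNArr (a : ℕ) (i : NExp) (e : NExp) (s : Store) :
      Exec (.setNArr a i e) s (i.cost + e.cost + 1)
        { s with narr := write s.narr a (i.eval s) (e.eval s) }
  | setRArr (a : ℕ) (i : NExp) (e : RExp) (s : Store) :
      Exec (.setRArr a i e) s (i.cost + e.cost + 1)
        { s with rarr := write s.rarr a (i.eval s) (e.eval s) }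
  | seq {p q : Prog} {s s' s'' : Store} {t t' : ℕ} :
      Exec p s t s' → Exec q s' t' s'' → Exec (.seq p q) s (t + t') s''
  | iteTrue {b : BExp} {p q : Prog} {s s' : Store} {t : ℕ} :
      b.eval s → Exec p s t s' → Exec (.ite b p q) s (b.cost + t) s'
  | iteFalse {b : BExp} {p q : Prog} {s s' : Store} {t : ℕ} :
      ¬ b.eval s → Exec q s t s' → Exec (.ite b p q) s (b.cost + t) s'
  | whileFalse {b : BExp} {p : Prog} {s : Store} :
      ¬ b.eval s → Exec (.while b p) s b.cost s
  | whileTrue {b : BExp} {p : Prog} {s s' s'' : Store} {t t' : ℕ} :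
      b.eval s → Exec p s t s' → Exec (.while b p) s' t' s'' →
        Exec (.while b p) s (b.cost + t + t') s''

/-! ## Input and output formats -/

/-- The array `a` starts with the entries of `l`. -/
def StartsWith {α : Type*} (a : ℕ → α) (l : List α) : Prop :=
  ∀ i (h : i < l.length), a i = l[i]

/-- Input of the reduction: `n` and `k` in the natural registers `0, 1`, `ε` in the real register
`0`, the coordinates of the points in the real arrays `0, 1`; everything else is zero. -/
noncomputable def reduceInput (ε : ℝ) (k : ℕ) (P : List Plane) : Store where
  nreg x := if x = 0 then P.length else if x = 1 then k else 0
  rreg x := if x = 0 then ε else 0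
  narr _ _ := 0
  rarr a i := if a = 0 then P.getD i 0 0 else if a = 1 then P.getD i 0 1 else 0

/-- Output of the reduction: the number of instances in the natural register `2`, their
sizes in the natural array `0`, and the coordinates of their points, instance after instance, in the
real arrays `2, 3`. -/
structure HoldsInstances (s : Store) (Is : List (List Plane)) : Prop where
  count : s.nreg 2 = Is.length
  sizes : StartsWith (s.narr 0) (Is.map List.length)
  xcoord : StartsWith (s.rarr 2) (Is.flatten.map (fun p => p 0))
  ycoord : StartsWith (s.rarr 3) (Is.flatten.map (fun p => p 1))

/-- Input of the combination step: the original input, and a list `Us` of tour collections, one for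
each instance.  The number of instances is in the natural register `3`, the numbers of tours of the
collections in the natural array `1`, the numbers of points of the tours in the natural array `2`,
and the concatenation of all tours in the natural array `3`. -/
noncomputable def combineInput (ε : ℝ) (k : ℕ) (P : List Plane) (Us : List (List (List ℕ))) :
    Store where
  nreg x := if x = 3 then Us.length else (reduceInput ε k P).nreg x
  rreg := (reduceInput ε k P).rreg
  narr a i :=
    if a = 1 then (Us.map List.length).getD i 0
    else if a = 2 then (Us.flatten.map List.length).getD i 0
    else if a = 3 then Us.flatten.flatten.getD i 0
    else 0
  rarr := (reduceInput ε k P).rarr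

/-- Size of the description of the collections `Us`: the number of tours plus the number of
tour vertices other than the origin. -/
def coversSize (Us : List (List (List ℕ))) : ℕ :=
  Us.flatten.length + Us.flatten.flatten.length

/-- Output of the combination step: the number of tours in the natural register `4`, the numbers of
points of the tours in the natural array `4`, their concatenation in the natural array `5`. -/
structure HoldsCover (s : Store) (U : List (List ℕ)) : Prop where
  count : s.nreg 4 = U.length
  sizes : StartsWith (s.narr 4) (U.map List.length)
  vertices : StartsWith (s.narr 5) U.flatten

end TourCover

open TourCover

/-! The plane is cut into rings around the origin, each spanning a factor `W` between 1/ε and 2/ε in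
distance. Points so close to the origin that single tours to all of them cost at most ε·OPT form the
ring `J` and get such tours. For points in two rings that are neither equal nor adjacent, the way
through the origin is at most `1 + 4ε` times their distance, so tours can be split there
(`sum_closedLength_filter_le`). Fix a residue `j` modulo `m ≈ 1/ε` and cut the rings into blocks of
`m` consecutive rings ending at the rings `b ≡ j`. If the rings `b` are served by separate tours,
the rest of different blocks is separated by a full ring, and averaging over `j` shows that for some
`j` the extra cost is O(ε)·OPT (`IsPlan.exists_shift`). This `j` depends on an unknown optimum.
Hence the blocks of all residues are output, `J + m` overlapping ones, and the combination step
takes the cheapest residue class.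

Inside the rings the points are grouped into polar cells, called locations and numbered by `key`, of
relative diameter O(ε/k). A tour has at most `k` points, each at distance at most half the length of
the tour, so treating all points of a location as coincident changes lengths by a factor `1 + O(ε)`
only (`closedLength_map_near`). A block meets at most L = O(k² ε⁻³ log(1/ε)) locations.

Instances are kept small by fixing full tours at crowded locations in advance. If the points of each
location coincide, the loads of the tours can be exchanged until no two tours share two locations
(`exists_uncrossed`). Then at most L tours through a location `a` go elsewhere too, so among `kL +
kf` points at `a` there is room for `f` tours visiting `a` only (`exists_single_tours`). Deleting
these saves the price of `f` fixed tours, and the other tours still have enough slots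
(`exists_peeled_cover`). So fixing tours while `kL` points remain loses only a factor `1 + O(ε)`
(`IsPlan.opt_block_le`, `IsPlan.lengthOf_D_le`, `IsPlan.approx`). Fewer than `kL + k` points per
location survive, that is O(kL²) per block.

A point belongs to several blocks. It is moved along its ray, inside its cell, by an amount
depending on the block, which makes the instances disjoint (`Params.place_ne`).

Since the machine cannot round, rings, octaves and binary digits are found by repeated scaling and
comparison, in O(J + w + h) steps per point. This is O(log n) for fixed ε because `k` may be
replaced by `min k n`. The programs are verified by weakest preconditions with step counts. -/

namespace TourCover

/-! ## Lengths of closed paths through the origin -/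

/-- Length of the closed path from the origin through the points of `l` and back. -/
noncomputable def closedLength (l : List Plane) : ℝ := pathLength (0 :: (l ++ [0]))

theorem tourLength_eq (P : List Plane) (t : List ℕ) :
    tourLength P t = closedLength (t.map fun i => P.getD i 0) := rfl

@[simp] theorem pathLength_cons_cons (p q : Plane) (l : List Plane) :
    pathLength (p :: q :: l) = dist p q + pathLength (q :: l) := rfl

theorem pathLength_nonneg : ∀ l : List Plane, 0 ≤ pathLength l
  | [] => le_rfl
  | [_] => le_rfl
  | _ :: q :: l => add_nonneg dist_nonneg (pathLength_nonneg (q :: l))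

theorem closedLength_nonneg (l : List Plane) : 0 ≤ closedLength l := pathLength_nonneg _

theorem pathLength_start_le (p q : Plane) (l : List Plane) (hl : l ≠ []) :
    pathLength (p :: l) ≤ dist p q + pathLength (q :: l) := by
  cases l with
  | nil => exact absurd rfl hl
  | cons a l =>
    simp only [pathLength_cons_cons]
    linarith [dist_triangle p q a]

/-- Triangle inequality at every omitted vertex. Both ends stay in place, so the omitted vertices
are always interior. -/
theorem pathLength_cons_sublist {l₁ l₂ : List Plane} (h : l₁.Sublist l₂) :
    ∀ p q : Plane, pathLength (p :: (l₁ ++ [q])) ≤ pathLength (p :: (l₂ ++ [q])) := by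
  induction h with
  | slnil => intros; exact le_rfl
  | @cons l₁ l₂ a h ih =>
    intro p q
    refine (ih p q).trans ?_
    simp only [List.cons_append, pathLength_cons_cons]
    exact pathLength_start_le p a _ (by simp)
  | @cons_cons l₁ l₂ a h ih =>
    intro p q
    simp only [List.cons_append, pathLength_cons_cons]
    linarith [ih a q]

theorem closedLength_sublist {l₁ l₂ : List Plane} (h : l₁.Sublist l₂) :
    closedLength l₁ ≤ closedLength l₂ := pathLength_cons_sublist h 0 0

theorem closedLength_nil : closedLength [] = 0 := by
  simp [closedLength, pathLength]

theorem closedLength_singleton (p : Plane) : closedLength [p] = 2 * ‖p‖ := by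
  simp [closedLength, pathLength]; ring

/-- The shortcut through `p` alone. This is the lower bound on tours that pays for displacements,
for fixed tours and for the points near the origin. -/
theorem two_norm_le_closedLength {p : Plane} {l : List Plane} (h : p ∈ l) :
    2 * ‖p‖ ≤ closedLength l := by
  rw [← closedLength_singleton]
  exact closedLength_sublist (List.singleton_sublist.2 h)

/-- Every vertex is an end of two edges, whence the factor 2. The starting points are left free for
the induction. -/
theorem pathLength_map_le {ι : Type*} (f g : ι → Plane) (q : Plane) (t : List ι) :
    ∀ a b : Plane, pathLength (a :: (t.map f ++ [q])) ≤
      dist a b + pathLength (b :: (t.map g ++ [q])) + 2 * (t.map fun i => dist (f i) (g i)).sum := by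
  induction t with
  | nil =>
    intro a b
    simp only [List.map_nil, List.nil_append, List.sum_nil, mul_zero, add_zero]
    exact pathLength_start_le a b _ (by simp)
  | cons i t ih =>
    intro a b
    have := ih (f i) (g i)
    simp only [List.map_cons, List.cons_append, pathLength_cons_cons, List.sum_cons]
    have h1 := dist_triangle4 a b (g i) (f i)
    rw [dist_comm (g i) (f i)] at h1
    linarith

/-- Moving each of at most `k` points by a relative distance `η` changes the length by a factor of
at most `1 + η k`. -/
theorem closedLength_map_near {ι : Type*} (f g : ι → Plane) (t : List ι) {η : ℝ} {k : ℕ}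
    (hη : 0 ≤ η) (hk : t.length ≤ k) (h : ∀ i ∈ t, dist (f i) (g i) ≤ η * ‖g i‖) :
    closedLength (t.map f) ≤ (1 + η * k) * closedLength (t.map g) := by
  have h1 := pathLength_map_le f g 0 t 0 0
  rw [dist_self, zero_add] at h1
  -- Each displacement is at most `η ‖g i‖`, hence at most `η` times half the length of the tour.
  -- The factor 2 of the previous lemma cancels the half.
  have h2 : (t.map fun i => dist (f i) (g i)).sum ≤
      (t.map fun i => dist (f i) (g i)).length • (η * (closedLength (t.map g) / 2)) := by
    apply List.sum_le_card_nsmul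
    intro x hx
    obtain ⟨i, hi, rfl⟩ := List.mem_map.1 hx
    refine (h i hi).trans (mul_le_mul_of_nonneg_left ?_ hη)
    have := two_norm_le_closedLength (List.mem_map_of_mem (f := g) hi)
    linarith
  have h3 : (t.length : ℝ) ≤ k := by exact_mod_cast hk
  have h4 : 0 ≤ η * (closedLength (t.map g) / 2) :=
    mul_nonneg hη (by linarith [closedLength_nonneg (t.map g)])
  have h5 := mul_le_mul_of_nonneg_right h3 h4
  rw [nsmul_eq_mul, List.length_map] at h2
  change closedLength (t.map f) ≤ closedLength (t.map g) + _ at h1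
  nlinarith

/-- Walk along the tour, standing at `a`: the path of class `b` continues from `f a` if `a` has
class `b`, and from the origin otherwise. An edge within a class is charged to this class. An edge
between two classes becomes a return to the origin and a new start, which `hg` bounds by `A` times
the edge. -/
theorem sum_pathLength_filter_le {ι : Type*} (f : ι → Plane) (c : ι → ℕ) (N : ℕ) {A : ℝ}
    (hA : 1 ≤ A) (t : List ι) :
    ∀ a : ι, c a < N → (∀ i ∈ a :: t, c i < N) →
    (∀ i ∈ a :: t, ∀ j ∈ a :: t, c i ≠ c j → ‖f i‖ + ‖f j‖ ≤ A * dist (f i) (f j)) →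
    ∑ b ∈ Finset.range N, pathLength ((if c a = b then f a else 0) ::
        ((t.filter fun i => c i = b).map f ++ [0])) ≤ A * pathLength (f a :: (t.map f ++ [0])) := by
  induction t with
  | nil =>
    intro a ha _ _
    simp only [List.filter_nil, List.map_nil, List.nil_append, pathLength_cons_cons, pathLength,
      add_zero, dist_zero_right]
    rw [Finset.sum_eq_single (c a)]
    · simp only [if_true]
      nlinarith [norm_nonneg (f a)]
    · intro b _ hb
      simp [hb.symm]
    · intro h
      exact absurd (Finset.mem_range.2 ha) h
  | cons j t ih =>
    intro a ha hc hg
    have hj : c j < N := hc j (by simp)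
    have IH := ih j hj (fun i hi => hc i (List.mem_cons_of_mem _ hi))
      (fun i hi i' hi' => hg i (List.mem_cons_of_mem _ hi) i' (List.mem_cons_of_mem _ hi'))
    simp only [List.map_cons, List.cons_append, pathLength_cons_cons, mul_add]
    -- The price that the path of class `b` pays for the step from `a` to `j`.
    set d : ℕ → ℝ := fun b => if c a = c j then (if c j = b then dist (f a) (f j) else 0) else
      ((if c a = b then ‖f a‖ else 0) + (if c j = b then ‖f j‖ else 0)) with hd
    have key : ∀ b ∈ Finset.range N, pathLength ((if c a = b then f a else 0) ::
        (((j :: t).filter fun i => c i = b).map f ++ [0])) ≤ d b +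
        pathLength ((if c j = b then f j else 0) :: ((t.filter fun i => c i = b).map f ++ [0])) := by
      intro b _
      by_cases hjb : c j = b
      · have e : (j :: t).filter (fun i => decide (c i = b)) = j :: t.filter (fun i => decide (c i = b)) := by
          simp [hjb]
        rw [e]
        simp only [List.map_cons, List.cons_append, pathLength_cons_cons, hd, hjb, if_true]
        by_cases hab : c a = b
        · simp [hab]
        · simp [hab]
      · have e : (j :: t).filter (fun i => decide (c i = b)) = t.filter (fun i => decide (c i = b)) := by
          simp [hjb]
        rw [e]
        simp only [hd, hjb, if_false]
        by_cases hab : c a = b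
        · have hne : ¬ c a = c j := fun h => hjb (h ▸ hab)
          simp only [hab, if_true, if_neg (fun h : b = c j => hjb h.symm), add_zero]
          have := pathLength_start_le (f a) 0 ((t.filter fun i => decide (c i = b)).map f ++ [0]) (by simp)
          simpa using this
        · by_cases hac : c a = c j
          · simp [hac, hjb]
          · simp [hab, hac]
    refine (Finset.sum_le_sum key).trans ?_
    rw [Finset.sum_add_distrib]
    refine add_le_add ?_ IH
    by_cases hac : c a = c j
    · simp only [hd, hac, if_true]
      rw [Finset.sum_ite_eq, if_pos (Finset.mem_range.2 hj)]
      nlinarith [dist_nonneg (x := f a) (y := f j)]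
    · simp only [hd, hac, if_false]
      rw [Finset.sum_add_distrib, Finset.sum_ite_eq, Finset.sum_ite_eq,
        if_pos (Finset.mem_range.2 hj), if_pos (Finset.mem_range.2 ha)]
      exact hg a (by simp) j (by simp) hac

/-- Splitting a tour into classes of points such that a step between different classes is almost as
long as the detour through the origin. -/
theorem sum_closedLength_filter_le {ι : Type*} (f : ι → Plane) (c : ι → ℕ) (N : ℕ) {A : ℝ}
    (hA : 1 ≤ A) (t : List ι) (hc : ∀ i ∈ t, c i < N)
    (hg : ∀ i ∈ t, ∀ j ∈ t, c i ≠ c j → ‖f i‖ + ‖f j‖ ≤ A * dist (f i) (f j)) :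
    ∑ b ∈ Finset.range N, closedLength ((t.filter fun i => c i = b).map f) ≤
      A * closedLength (t.map f) := by
  cases t with
  | nil => simp [closedLength_nil]
  | cons j t =>
    have hj : c j < N := hc j (by simp)
    have IH := sum_pathLength_filter_le f c N hA t j hj hc hg
    have key : ∀ b ∈ Finset.range N, closedLength (((j :: t).filter fun i => c i = b).map f) ≤
        (if c j = b then ‖f j‖ else 0) +
        pathLength ((if c j = b then f j else 0) :: ((t.filter fun i => c i = b).map f ++ [0])) := by
      intro b _
      by_cases hjb : c j = b
      · have e : (j :: t).filter (fun i => decide (c i = b)) = j :: t.filter (fun i => decide (c i = b)) := by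
          simp [hjb]
        rw [e]
        simp [closedLength, hjb]
      · have e : (j :: t).filter (fun i => decide (c i = b)) = t.filter (fun i => decide (c i = b)) := by
          simp [hjb]
        rw [e]
        simp [closedLength, hjb]
    refine (Finset.sum_le_sum key).trans ?_
    rw [Finset.sum_add_distrib, Finset.sum_ite_eq, if_pos (Finset.mem_range.2 hj)]
    have : A * closedLength ((j :: t).map f) = A * ‖f j‖ + A * pathLength (f j :: (t.map f ++ [0])) := by
      simp [closedLength, mul_add]
    rw [this]
    refine add_le_add ?_ IH
    nlinarith [norm_nonneg (f j)]

/-- Repeated visits at one place are free. Only an inequality holds, since for `c = 0` the place is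
skipped. -/
theorem pathLength_replicate_le (q : Plane) (l : List Plane) (hl : l ≠ []) (c : ℕ) :
    ∀ p, pathLength (p :: (List.replicate c q ++ l)) ≤ pathLength (p :: q :: l) := by
  induction c with
  | zero =>
    intro p
    simpa using pathLength_start_le p q l hl
  | succ c ih =>
    intro p
    have := ih q
    simp only [List.replicate_succ, List.cons_append, pathLength_cons_cons, dist_self, zero_add]
      at this ⊢
    linarith

theorem pathLength_flatMap_replicate_le {κ : Type*} (ρ : κ → Plane) (c : κ → ℕ) (W : List κ) :
    ∀ p, pathLength (p :: (W.flatMap (fun a => List.replicate (c a) (ρ a)) ++ [0])) ≤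
      pathLength (p :: (W.map ρ ++ [0])) := by
  induction W with
  | nil => intro p; simp
  | cons a W ih =>
    intro p
    simp only [List.flatMap_cons, List.append_assoc, List.map_cons, List.cons_append]
    refine (pathLength_replicate_le (ρ a) _ (by simp) (c a) p).trans ?_
    simp only [pathLength_cons_cons]
    linarith [ih (ρ a)]

/-- Positions depend on the key only, so a tour serving the points location by location is no longer
than the tour through the locations in the order `W`. -/
theorem closedLength_flatMap_le {ι κ : Type*} (ρ : κ → Plane) (key : ι → κ) (F : κ → List ι)
    (W : List κ) (h : ∀ a ∈ W, ∀ i ∈ F a, key i = a) :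
    closedLength ((W.flatMap F).map fun i => ρ (key i)) ≤ closedLength (W.map ρ) := by
  have : (W.flatMap F).map (fun i => ρ (key i)) =
      W.flatMap (fun a => List.replicate (F a).length (ρ a)) := by
    rw [List.map_flatMap]
    refine List.flatMap_congr ?_
    intro a ha
    rw [List.eq_replicate_iff]
    refine ⟨by simp, ?_⟩
    intro x hx
    obtain ⟨i, hi, rfl⟩ := List.mem_map.1 hx
    rw [h a ha i hi]
  rw [this]
  exact pathLength_flatMap_replicate_le ρ _ W 0

end TourCover


namespace TourCover

/-! ## Uncrossing tours -/

/-- Redistribute loads `x τ a` of tours `τ` at locations `a`, keeping all totals, such that no two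
tours share two locations. -/
theorem exists_uncrossed {ι κ : Type*} [Fintype ι] [DecidableEq ι] [DecidableEq κ] (Λ : Finset κ) :
    ∀ (M : ℕ) (x : ι → κ → ℕ), (∑ τ, ∑ a ∈ Λ, if x τ a = 0 then 0 else 1) ≤ M →
    ∃ y : ι → κ → ℕ, (∀ a ∈ Λ, ∑ τ, y τ a = ∑ τ, x τ a) ∧
      (∀ τ, ∑ a ∈ Λ, y τ a = ∑ a ∈ Λ, x τ a) ∧
      (∀ τ a, x τ a = 0 → y τ a = 0) ∧
      ∀ τ τ', τ ≠ τ' → ∀ a ∈ Λ, ∀ b ∈ Λ, a ≠ b →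
        ¬ (0 < y τ a ∧ 0 < y τ b ∧ 0 < y τ' a ∧ 0 < y τ' b) := by
  intro M
  induction M with
  | zero =>
    intro x hx
    refine ⟨x, fun _ _ => rfl, fun _ => rfl, fun _ _ h => h, ?_⟩
    rintro τ τ' - a ha b - - ⟨h, -⟩
    have := Finset.sum_eq_zero_iff.1 (Nat.le_zero.1 hx) τ (Finset.mem_univ _)
    have := Finset.sum_eq_zero_iff.1 this a ha
    simp at this
    omega
  | succ M ih =>
    intro x hx
    by_cases hgood : ∀ τ τ', τ ≠ τ' → ∀ a ∈ Λ, ∀ b ∈ Λ, a ≠ b →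
        ¬ (0 < x τ a ∧ 0 < x τ b ∧ 0 < x τ' a ∧ 0 < x τ' b)
    · exact ⟨x, fun _ _ => rfl, fun _ => rfl, fun _ _ h => h, hgood⟩
    push Not at hgood
    obtain ⟨τ, τ', hτ, a, ha, b, hb, hab, h1, h2, h3, h4⟩ := hgood
    -- The tour `τ` hands `m` units at `a` to `τ'` and takes over `m` units at `b`. For this `m` one
    -- of the two diminished entries becomes zero, and no zero entry becomes positive, so the
    -- support shrinks; its size is bounded by the induction variable.
    set m := min (x τ a) (x τ' b) with hm
    set z : ι → κ → ℕ := fun σ c => if σ = τ then (if c = a then x τ a - m else if c = b then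
      x τ b + m else x σ c) else if σ = τ' then (if c = a then x τ' a + m else if c = b then
      x τ' b - m else x σ c) else x σ c with hz
    have hm1 : m ≤ x τ a := min_le_left _ _
    have hm2 : m ≤ x τ' b := min_le_right _ _
    have hm0 : 0 < m := lt_min h1 h4
    -- The change is a product of a row vector and a column vector, each with one entry 1, one entry
    -- -1 and zeros elsewhere. Over the integers its row and column sums visibly vanish.
    have hzint : ∀ σ c, (z σ c : ℤ) = x σ c + ((if σ = τ' then 1 else 0) - (if σ = τ then 1 else 0)) *
        (((if c = a then 1 else 0) - (if c = b then 1 else 0)) * m) := by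
      intro σ c
      simp only [hz]
      by_cases hσ : σ = τ
      · subst hσ
        by_cases hca : c = a
        · subst hca; simp [hτ, hab, Nat.cast_sub hm1]; ring
        · by_cases hcb : c = b
          · subst hcb; simp [hτ, hca]
          · simp [hca, hcb]
      · by_cases hσ' : σ = τ'
        · subst hσ'
          by_cases hca : c = a
          · subst hca; simp [hσ, hab]
          · by_cases hcb : c = b
            · subst hcb; simp [hσ, hca, Nat.cast_sub hm2]; ring
            · simp [hca, hcb]
        · simp [hσ, hσ']
    have hcol : ∀ c ∈ Λ, ∑ σ, z σ c = ∑ σ, x σ c := by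
      intro c _
      have : (∑ σ, z σ c : ℤ) = ∑ σ, (x σ c : ℤ) := by
        simp only [hzint, Finset.sum_add_distrib, ← Finset.sum_mul, Finset.sum_sub_distrib]
        simp
      exact_mod_cast this
    have hrow : ∀ σ, ∑ c ∈ Λ, z σ c = ∑ c ∈ Λ, x σ c := by
      intro σ
      have : (∑ c ∈ Λ, z σ c : ℤ) = ∑ c ∈ Λ, (x σ c : ℤ) := by
        simp only [hzint, Finset.sum_add_distrib, ← Finset.sum_mul, ← Finset.mul_sum,
          Finset.sum_sub_distrib]
        simp [ha, hb]
      exact_mod_cast this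
    have hsupp : ∀ σ c, x σ c = 0 → z σ c = 0 := by
      intro σ c h
      simp only [hz]
      by_cases hσ : σ = τ
      · subst hσ
        by_cases hca : c = a
        · subst hca; omega
        · by_cases hcb : c = b
          · subst hcb; omega
          · simp [hca, hcb, h]
      · by_cases hσ' : σ = τ'
        · subst hσ'
          by_cases hca : c = a
          · subst hca; omega
          · by_cases hcb : c = b
            · subst hcb; omega
            · simp [hσ, hca, hcb, h]
        · simp [hσ, hσ', h]
    have hle : ∀ σ c, (if z σ c = 0 then 0 else 1) ≤ (if x σ c = 0 then 0 else 1) := by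
      intro σ c
      by_cases h : x σ c = 0
      · simp [h, hsupp σ c h]
      · simp only [h, if_false]; split_ifs <;> omega
    have hlt : (∑ τ, ∑ a ∈ Λ, if z τ a = 0 then 0 else 1) <
        ∑ τ, ∑ a ∈ Λ, if x τ a = 0 then 0 else 1 := by
      rcases min_choice (x τ a) (x τ' b) with hmin | hmin
      · refine Finset.sum_lt_sum (fun σ _ => Finset.sum_le_sum fun c _ => hle σ c)
          ⟨τ, Finset.mem_univ _, Finset.sum_lt_sum (fun c _ => hle τ c) ⟨a, ha, ?_⟩⟩
        have : z τ a = 0 := by simp [hz, hm, hmin]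
        rw [if_pos this, if_neg (by omega)]; exact Nat.one_pos
      · refine Finset.sum_lt_sum (fun σ _ => Finset.sum_le_sum fun c _ => hle σ c)
          ⟨τ', Finset.mem_univ _, Finset.sum_lt_sum (fun c _ => hle τ' c) ⟨b, hb, ?_⟩⟩
        have : z τ' b = 0 := by simp [hz, hm, hmin, hτ.symm, hab.symm]
        rw [if_pos this, if_neg (by omega)]; exact Nat.one_pos
    obtain ⟨y, hy1, hy2, hy3, hy4⟩ := ih z (by omega)
    exact ⟨y, fun c hc => (hy1 c hc).trans (hcol c hc), fun σ => (hy2 σ).trans (hrow σ),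
      fun σ c h => hy3 σ c (hsupp σ c h), hy4⟩

/-- In an uncrossed distribution, a location with a load of at least `k |Λ| + k f` is the only
location of at least `f` tours. -/
theorem exists_single_tours {ι κ : Type*} [Fintype ι] [DecidableEq ι] [DecidableEq κ]
    (Λ : Finset κ) (y : ι → κ → ℕ) (k : ℕ) (hk : 1 ≤ k) (hrow : ∀ τ, ∑ a ∈ Λ, y τ a ≤ k)
    (hun : ∀ τ τ', τ ≠ τ' → ∀ a ∈ Λ, ∀ b ∈ Λ, a ≠ b →
        ¬ (0 < y τ a ∧ 0 < y τ b ∧ 0 < y τ' a ∧ 0 < y τ' b))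
    (a : κ) (ha : a ∈ Λ) (f : ℕ) (hf : k * Λ.card + k * f ≤ ∑ τ, y τ a) :
    ∃ S : Finset ι, S.card = f ∧ ∀ τ ∈ S, 0 < y τ a ∧ ∀ b ∈ Λ, b ≠ a → y τ b = 0 := by
  classical
  set S := Finset.univ.filter fun τ => 0 < y τ a ∧ ∀ b ∈ Λ, b ≠ a → y τ b = 0 with hS
  set T := Finset.univ.filter fun τ => 0 < y τ a ∧ ∃ b ∈ Λ, b ≠ a ∧ 0 < y τ b with hT
  have hya : ∀ τ, y τ a ≤ k := fun τ =>
    (Finset.single_le_sum (f := fun b => y τ b) (fun _ _ => Nat.zero_le _) ha).trans (hrow τ)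
  -- Send a tour in `T` to another location that it visits. This is injective, as two tours sharing
  -- that location and `a` would cross.
  have hTc : T.card ≤ Λ.card := by
    have hex : ∀ τ ∈ T, ∃ b, b ∈ Λ ∧ b ≠ a ∧ 0 < y τ b := by
      intro τ hτ
      obtain ⟨-, b, hb, h⟩ := (Finset.mem_filter.1 hτ).2
      exact ⟨b, hb, h⟩
    have : Nonempty κ := ⟨a⟩
    choose! g hg using hex
    refine Finset.card_le_card_of_injOn g (fun τ hτ => (hg τ hτ).1) ?_
    intro τ hτ τ' hτ' h
    by_contra hne
    have h1 := hg τ hτ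
    have h2 := hg τ' hτ'
    rw [← h] at h2
    exact hun τ τ' hne a ha (g τ) h1.1 h1.2.1.symm
      ⟨((Finset.mem_filter.1 hτ).2).1, h1.2.2, ((Finset.mem_filter.1 hτ').2).1, h2.2.2⟩
  have hsum : ∑ τ, y τ a ≤ k * S.card + k * T.card := by
    have : ∑ τ, y τ a ≤ ∑ τ, ((if τ ∈ S then k else 0) + (if τ ∈ T then k else 0)) := by
      refine Finset.sum_le_sum fun τ _ => ?_
      by_cases h0 : y τ a = 0
      · omega
      by_cases hs : τ ∈ S
      · rw [if_pos hs]; have := hya τ; omega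
      · have : τ ∈ T := by
          refine Finset.mem_filter.2 ⟨Finset.mem_univ _, Nat.pos_of_ne_zero h0, ?_⟩
          by_contra hcon
          push Not at hcon
          exact hs (Finset.mem_filter.2 ⟨Finset.mem_univ _, Nat.pos_of_ne_zero h0,
            fun b hb hba => Nat.le_zero.1 (hcon b hb hba)⟩)
        rw [if_pos this]; have := hya τ; omega
    refine this.trans (le_of_eq ?_)
    rw [Finset.sum_add_distrib]
    simp [mul_comm]
  have hcard : f ≤ S.card := by
    have h1 : k * T.card ≤ k * Λ.card := Nat.mul_le_mul_left k hTc
    have h2 : k * f ≤ k * S.card := by omega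
    exact Nat.le_of_mul_le_mul_left h2 hk
  obtain ⟨S', hS', hc⟩ := Finset.exists_subset_card_eq hcard
  exact ⟨S', hc, fun τ hτ => (Finset.mem_filter.1 (hS' hτ)).2⟩

/-- Distribute the elements of `A` to bins with capacities `c`. -/
theorem exists_assignment {α ι : Type*} [DecidableEq ι] [DecidableEq α] (S : Finset ι)
    (c : ι → ℕ) : ∀ A : Finset α, A.card ≤ ∑ τ ∈ S, c τ →
    ∃ G : ι → Finset α, (∀ τ, G τ ⊆ A ∧ (G τ).card ≤ c τ) ∧ ∀ i ∈ A, ∃ τ ∈ S, i ∈ G τ := by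
  induction S using Finset.induction_on with
  | empty =>
    intro A hA
    have : A = ∅ := by simpa using hA
    exact ⟨fun _ => ∅, by simp, by simp [this]⟩
  | insert τ S hτ ih =>
    intro A hA
    rw [Finset.sum_insert hτ] at hA
    obtain ⟨A', hA', hc⟩ := Finset.exists_subset_card_eq (min_le_right (c τ) A.card)
    have h1 : (A \ A').card ≤ ∑ τ ∈ S, c τ := by
      rw [Finset.card_sdiff_of_subset hA', hc]
      omega
    obtain ⟨G, hG1, hG2⟩ := ih (A \ A') h1
    refine ⟨Function.update G τ A', ?_, ?_⟩
    · intro σ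
      by_cases h : σ = τ
      · subst h
        simp only [Function.update_self]
        exact ⟨hA', by omega⟩
      · simp only [Function.update_of_ne h]
        exact ⟨(hG1 σ).1.trans Finset.sdiff_subset, (hG1 σ).2⟩
    · intro i hi
      by_cases h : i ∈ A'
      · exact ⟨τ, by simp, by simpa using h⟩
      · obtain ⟨σ, hσ, hi'⟩ := hG2 i (Finset.mem_sdiff.2 ⟨hi, h⟩)
        refine ⟨σ, Finset.mem_insert_of_mem hσ, ?_⟩
        rw [Function.update_of_ne (fun h : σ = τ => hτ (h ▸ hσ))]
        exact hi'

end TourCover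


/-! ### Savings from deleting full tours at crowded locations -/

namespace TourCover

/-- Total length of the tours of `U` if point `i` is placed at `f i`. -/
noncomputable def lengthOf {ι : Type*} (f : ι → Plane) (U : List (List ι)) : ℝ :=
  (U.map fun t => closedLength (t.map f)).sum

/-- If all points of a location coincide, and `k * f a` points are removed from each location `a`
which keeps at least `k * |Λ|` points when `f a > 0`, then the cost drops by that of the `f a`
tours to `a`. -/
theorem exists_peeled_cover (k : ℕ) (hk : 1 ≤ k) (key : ℕ → ℕ) (ρ : ℕ → Plane) (Q K Λ : Finset ℕ)
    (hΛ : ∀ i ∈ Q, key i ∈ Λ) (hKQ : K ⊆ Q) (f : ℕ → ℕ)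
    (hcount : ∀ a ∈ Λ, (Q.filter fun i => key i = a).card =
      (K.filter fun i => key i = a).card + k * f a)
    (hcap : ∀ a ∈ Λ, 0 < f a → k * Λ.card ≤ (K.filter fun i => key i = a).card)
    (V : List (List ℕ)) (hVk : ∀ t ∈ V, t.length ≤ k) (hV : ∀ i ∈ Q, ∃ t ∈ V, i ∈ t) :
    ∃ U : List (List ℕ), (∀ t ∈ U, t.Nodup ∧ t.length ≤ k ∧ ∀ i ∈ t, i ∈ K) ∧
      (∀ i ∈ K, ∃ t ∈ U, i ∈ t) ∧
      lengthOf (fun i => ρ (key i)) U + ∑ a ∈ Λ, f a * (2 * ‖ρ a‖) ≤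
        lengthOf (fun i => ρ (key i)) V := by
  classical
  have hg : ∀ i ∈ Q, ∃ τ : Fin V.length, i ∈ V[τ] := by
    intro i hi
    obtain ⟨t, ht, hit⟩ := hV i hi
    obtain ⟨j, hj, rfl⟩ := List.mem_iff_getElem.1 ht
    exact ⟨⟨j, hj⟩, hit⟩
  -- Without points `V` may be empty, and then no default tour exists for the choice of `g` below.
  by_cases hQ : Q = ∅
  · subst hQ
    have hK : K = ∅ := Finset.subset_empty.1 hKQ
    subst hK
    refine ⟨[], by simp, by simp, ?_⟩
    have : ∑ a ∈ Λ, (f a : ℝ) * (2 * ‖ρ a‖) = 0 := by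
      refine Finset.sum_eq_zero fun a ha => ?_
      have h := hcount a ha
      simp only [Finset.filter_empty, Finset.card_empty, zero_add] at h
      have : f a = 0 := by
        rcases Nat.mul_eq_zero.1 h.symm with h | h
        · omega
        · exact h
      simp [this]
    rw [this]
    simp only [lengthOf, List.map_nil, List.sum_nil, zero_add]
    exact List.sum_nonneg (by
      intro x hx
      obtain ⟨t, -, rfl⟩ := List.mem_map.1 hx
      exact closedLength_nonneg _)
  have : Nonempty (Fin V.length) := by
    obtain ⟨i, hi⟩ := Finset.nonempty_iff_ne_empty.2 hQ
    exact ⟨(hg i hi).choose⟩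
  -- Each point is assigned to one of the tours through it, so that points on several tours are not
  -- counted twice in the loads `x`.
  choose! g hg using hg
  set x : Fin V.length → ℕ → ℕ := fun τ a => (Q.filter fun i => g i = τ ∧ key i = a).card with hx
  have hxrow : ∀ τ, ∑ a ∈ Λ, x τ a ≤ k := by
    intro τ
    have h1 : ∑ a ∈ Λ, x τ a = (Q.filter fun i => g i = τ).card := by
      rw [Finset.card_eq_sum_card_fiberwise (f := key) (t := Λ)
        (fun i hi => hΛ i (Finset.mem_filter.1 hi).1)]
      simp only [hx, Finset.filter_filter]
    have h2 : (Q.filter fun i => g i = τ) ⊆ V[τ].toFinset := by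
      intro i hi
      obtain ⟨hi', rfl⟩ := Finset.mem_filter.1 hi
      exact List.mem_toFinset.2 (hg i hi')
    rw [h1]
    exact (Finset.card_le_card h2).trans
      ((List.toFinset_card_le _).trans (hVk _ (List.getElem_mem _)))
  have hxcol : ∀ a ∈ Λ, ∑ τ, x τ a = (Q.filter fun i => key i = a).card := by
    intro a _
    rw [Finset.card_eq_sum_card_fiberwise (f := g) (t := Finset.univ) (fun i _ => Finset.mem_univ _)]
    refine Finset.sum_congr rfl fun τ _ => ?_
    simp only [hx, Finset.filter_filter, and_comm]
  obtain ⟨y, hy1, hy2, hy3, hy4⟩ := exists_uncrossed Λ _ x le_rfl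
  have hyrow : ∀ τ, ∑ a ∈ Λ, y τ a ≤ k := fun τ => (hy2 τ).trans_le (hxrow τ)
  have hvisit : ∀ τ a, 0 < y τ a → a ∈ V[τ].map key := by
    intro τ a h
    have h1 : x τ a ≠ 0 := fun h0 => by have := hy3 τ a h0; omega
    obtain ⟨i, hi⟩ := Finset.card_pos.1 (Nat.pos_of_ne_zero h1)
    obtain ⟨hi', rfl, rfl⟩ := Finset.mem_filter.1 hi
    exact List.mem_map_of_mem (hg i hi')
  have hS : ∀ a ∈ Λ, ∃ S : Finset (Fin V.length), S.card = f a ∧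
      ∀ τ ∈ S, 0 < y τ a ∧ ∀ b ∈ Λ, b ≠ a → y τ b = 0 := by
    intro a ha
    by_cases hf : f a = 0
    · exact ⟨∅, by simp [hf], by simp⟩
    · refine exists_single_tours Λ y k hk hyrow hy4 a ha (f a) ?_
      rw [hy1 a ha, hxcol a ha, hcount a ha]
      have := hcap a ha (Nat.pos_of_ne_zero hf)
      omega
  choose! S hS using hS
  set Rm := Λ.biUnion S with hRm
  have hdisj : (Λ : Set ℕ).PairwiseDisjoint S := by
    intro a ha b hb hab
    refine Finset.disjoint_left.2 fun τ h1 h2 => ?_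
    have := ((hS b hb).2 τ h2).2 a ha hab
    have := ((hS a ha).2 τ h1).1
    omega
  set Rest := Finset.univ \ Rm with hRest
  -- The deleted tours through `a` are exactly those of `S a`, and they offer at most `k * f a`
  -- slots there; this is the number of points removed from `a`.
  have hslots : ∀ a ∈ Λ, (K.filter fun i => key i = a).card ≤ ∑ τ ∈ Rest, y τ a := by
    intro a ha
    have h1 : ∑ τ ∈ Rest, y τ a + ∑ τ ∈ Rm, y τ a = ∑ τ, y τ a :=
      Finset.sum_sdiff (Finset.subset_univ Rm)
    have h2 : ∑ τ ∈ Rm, y τ a = ∑ τ ∈ S a, y τ a := by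
      symm
      refine Finset.sum_subset (Finset.subset_biUnion_of_mem S ha) fun τ hτ hτa => ?_
      obtain ⟨b, hb, hτb⟩ := Finset.mem_biUnion.1 hτ
      have hba : a ≠ b := fun h => hτa (h ▸ hτb)
      exact ((hS b hb).2 τ hτb).2 a ha hba
    have h3 : ∑ τ ∈ S a, y τ a ≤ (S a).card • k := by
      refine Finset.sum_le_card_nsmul _ _ _ fun τ _ => ?_
      exact (Finset.single_le_sum (f := fun b => y τ b) (fun _ _ => Nat.zero_le _) ha).trans
        (hyrow τ)
    rw [(hS a ha).1, smul_eq_mul, mul_comm] at h3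
    have h4 := hy1 a ha
    rw [hxcol a ha, hcount a ha] at h4
    omega
  have hG := fun a (ha : a ∈ Λ) => exists_assignment Rest (fun τ => y τ a) _ (hslots a ha)
  choose! G hG1 hG2 using hG
  -- The new tour visits locations of the old one in their old order, each once. Uncrossing only
  -- removes locations from a tour, so all loads `y` are met on this route.
  set W : Fin V.length → List ℕ := fun τ => ((V[τ].map key).dedup).filter (· ∈ Λ) with hW
  have hWmem : ∀ τ a, a ∈ W τ → a ∈ Λ := fun τ a h => by simpa using (List.mem_filter.1 h).2
  have hWnd : ∀ τ, (W τ).Nodup := fun τ => (List.nodup_dedup _).filter _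
  have hGkey : ∀ τ, ∀ a ∈ W τ, ∀ i ∈ (G a τ).toList, i ∈ K ∧ key i = a := by
    intro τ a ha i hi
    exact Finset.mem_filter.1 ((hG1 a (hWmem τ a ha) τ).1 (Finset.mem_toList.1 hi))
  refine ⟨Rest.toList.map fun τ => (W τ).flatMap fun a => (G a τ).toList, ?_, ?_, ?_⟩
  · intro t ht
    obtain ⟨τ, hτ, rfl⟩ := List.mem_map.1 ht
    refine ⟨?_, ?_, ?_⟩
    · rw [List.nodup_flatMap]
      refine ⟨fun a _ => Finset.nodup_toList _, ?_⟩
      refine (hWnd τ).imp_of_mem ?_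
      intro a b ha hb hab i hia hib
      exact hab ((hGkey τ a ha i hia).2.symm.trans (hGkey τ b hb i hib).2)
    · rw [List.length_flatMap]
      simp only [Finset.length_toList]
      rw [← List.sum_toFinset _ (hWnd τ)]
      calc ∑ a ∈ (W τ).toFinset, (G a τ).card ≤ ∑ a ∈ (W τ).toFinset, y τ a :=
            Finset.sum_le_sum fun a ha => (hG1 a (hWmem τ a (List.mem_toFinset.1 ha)) τ).2
        _ ≤ ∑ a ∈ Λ, y τ a := Finset.sum_le_sum_of_subset fun a ha =>
            hWmem τ a (List.mem_toFinset.1 ha)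
        _ ≤ k := hyrow τ
    · intro i hi
      obtain ⟨a, ha, hi⟩ := List.mem_flatMap.1 hi
      exact (hGkey τ a ha i hi).1
  · intro i hi
    have ha := hΛ i (hKQ hi)
    obtain ⟨τ, hτ, hiG⟩ := hG2 (key i) ha i (Finset.mem_filter.2 ⟨hi, rfl⟩)
    refine ⟨_, List.mem_map_of_mem (Finset.mem_toList.2 hτ), ?_⟩
    refine List.mem_flatMap.2 ⟨key i, ?_, Finset.mem_toList.2 hiG⟩
    refine List.mem_filter.2 ⟨List.mem_dedup.2 (hvisit τ _ ?_), by simpa using ha⟩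
    exact (Finset.card_pos.2 ⟨i, hiG⟩).trans_le (hG1 (key i) ha τ).2
  · have hV' : lengthOf (fun i => ρ (key i)) V =
        ∑ τ : Fin V.length, closedLength (V[τ].map fun i => ρ (key i)) := by
      simp only [lengthOf]
      exact (Fin.sum_univ_fun_getElem V (fun t => closedLength (t.map fun i => ρ (key i)))).symm
    have hU' : lengthOf (fun i => ρ (key i))
        (Rest.toList.map fun τ => (W τ).flatMap fun a => (G a τ).toList) ≤
        ∑ τ ∈ Rest, closedLength (V[τ].map fun i => ρ (key i)) := by
      simp only [lengthOf, List.map_map]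
      rw [← Finset.sum_map_toList]
      refine List.sum_le_sum fun τ _ => ?_
      refine (closedLength_flatMap_le ρ key _ (W τ) fun a ha i hi => (hGkey τ a ha i hi).2).trans ?_
      have : (V[τ].map fun i => ρ (key i)) = (V[τ].map key).map ρ := by simp
      rw [this]
      exact closedLength_sublist ((List.filter_sublist.trans (List.dedup_sublist _)).map ρ)
    have hRm' : ∑ a ∈ Λ, (f a : ℝ) * (2 * ‖ρ a‖) ≤
        ∑ τ ∈ Rm, closedLength (V[τ].map fun i => ρ (key i)) := by
      rw [hRm, Finset.sum_biUnion hdisj]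
      refine Finset.sum_le_sum fun a ha => ?_
      rw [← (hS a ha).1, ← nsmul_eq_mul]
      refine Finset.card_nsmul_le_sum _ _ _ fun τ hτ => ?_
      refine two_norm_le_closedLength ?_
      have := hvisit τ a ((hS a ha).2 τ hτ).1
      obtain ⟨i, hi, hia⟩ := List.mem_map.1 this
      exact List.mem_map.2 ⟨i, hi, by rw [hia]⟩
    have h1 : ∑ τ ∈ Rest, closedLength (V[τ].map fun i => ρ (key i)) +
        ∑ τ ∈ Rm, closedLength (V[τ].map fun i => ρ (key i)) =
        ∑ τ : Fin V.length, closedLength (V[τ].map fun i => ρ (key i)) := Finset.sum_sdiff (Finset.subset_univ Rm)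
    rw [hV']
    linarith

end TourCover


/-! ### Total lengths and comparison with the optimum -/

namespace TourCover

theorem lengthOf_nonneg {ι : Type*} (f : ι → Plane) (U : List (List ι)) : 0 ≤ lengthOf f U :=
  List.sum_nonneg (by
    intro x hx
    obtain ⟨t, -, rfl⟩ := List.mem_map.1 hx
    exact closedLength_nonneg _)

theorem coverLength_eq (P : List Plane) (U : List (List ℕ)) :
    coverLength P U = lengthOf (fun i => P.getD i 0) U := rfl

theorem lengthOf_append {ι : Type*} (f : ι → Plane) (U V : List (List ι)) :
    lengthOf f (U ++ V) = lengthOf f U + lengthOf f V := by simp [lengthOf]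

theorem lengthOf_near {ι : Type*} (f g : ι → Plane) (U : List (List ι)) {η : ℝ} {k : ℕ}
    (hη : 0 ≤ η) (h : ∀ t ∈ U, t.length ≤ k ∧ ∀ i ∈ t, dist (f i) (g i) ≤ η * ‖g i‖) :
    lengthOf f U ≤ (1 + η * k) * lengthOf g U := by
  simp only [lengthOf]
  rw [← List.sum_map_mul_left]
  exact List.sum_le_sum fun t ht => closedLength_map_near f g t hη (h t ht).1 (h t ht).2

theorem lengthOf_map_map {ι κ : Type*} (f : κ → Plane) (e : ι → κ) (U : List (List ι)) :
    lengthOf f (U.map (List.map e)) = lengthOf (fun i => f (e i)) U := by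
  simp [lengthOf, List.map_map, Function.comp_def]

theorem lengthOf_congr {ι : Type*} {f g : ι → Plane} {U : List (List ι)}
    (h : ∀ t ∈ U, ∀ i ∈ t, f i = g i) : lengthOf f U = lengthOf g U := by
  simp only [lengthOf]
  congr 1
  refine List.map_congr_left fun t ht => ?_
  rw [List.map_congr_left (h t ht)]

theorem opt_le {k : ℕ} {P : List Plane} {U : List (List ℕ)} (h : IsTourCover k P U) :
    opt k P ≤ coverLength P U :=
  csInf_le ⟨0, by rintro _ ⟨V, -, rfl⟩; exact lengthOf_nonneg _ _⟩ ⟨U, h, rfl⟩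

theorem exists_tourCover {k : ℕ} (hk : 1 ≤ k) (P : List Plane) : ∃ U, IsTourCover k P U :=
  ⟨(List.range P.length).map fun i => [i], by simp, by simp, by simpa using fun _ _ => hk, by simp⟩

/-- Allows comparing with an arbitrary cover, without knowing that the infimum is attained. -/
theorem le_mul_opt {k : ℕ} (hk : 1 ≤ k) {P : List Plane} {c x : ℝ} (hc : 0 < c)
    (h : ∀ V, IsTourCover k P V → x ≤ c * coverLength P V) : x ≤ c * opt k P := by
  rw [← div_le_iff₀' hc]
  obtain ⟨U, hU⟩ := exists_tourCover hk P
  refine le_csInf ⟨_, U, hU, rfl⟩ ?_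
  rintro _ ⟨V, hV, rfl⟩
  rw [div_le_iff₀' hc]
  exact h V hV

/-- The distance is at least `(1 - ε) ‖p‖` and the sum of the norms at most `(1 + ε) ‖p‖`; for `ε ≤
1/2` one has `(1 + 4ε)(1 - ε) ≥ 1 + ε`. -/
theorem norm_add_norm_le {ε : ℝ} (hε : 0 < ε) (hε2 : ε ≤ 1 / 2) {p q : Plane} (h : ‖q‖ ≤ ε * ‖p‖) :
    ‖p‖ + ‖q‖ ≤ (1 + 4 * ε) * dist p q := by
  have h1 : ‖p‖ - ‖q‖ ≤ dist p q := by rw [dist_eq_norm]; exact norm_sub_norm_le p q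
  have h2 : (1 + 4 * ε) * (‖p‖ - ‖q‖) ≤ (1 + 4 * ε) * dist p q :=
    mul_le_mul_of_nonneg_left h1 (by linarith)
  have h3 : (1 + 4 * ε) * (‖p‖ - ε * ‖p‖) ≤ (1 + 4 * ε) * (‖p‖ - ‖q‖) :=
    mul_le_mul_of_nonneg_left (by linarith) (by linarith)
  have h4 : 0 ≤ ε * (1 - 2 * ε) * ‖p‖ :=
    mul_nonneg (mul_nonneg hε.le (by linarith)) (norm_nonneg p)
  nlinarith

/-! ## Assembling a cover from covers of overlapping blocks of rings -/

/-- The first number `b ≥ r` with `b % m = j`. -/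
def blockOf (m j r : ℕ) : ℕ := r + (j + (m - 1) * r) % m

/-- The term `(m - 1) * r` plays the role of `-r` modulo `m`. -/
theorem blockOf_mod {m j : ℕ} (hj : j < m) (r : ℕ) : blockOf m j r % m = j := by
  unfold blockOf
  rw [Nat.add_mod, Nat.mod_mod, ← Nat.add_mod]
  have : r + (j + (m - 1) * r) = j + m * r := by
    obtain ⟨m, rfl⟩ : ∃ m', m = m' + 1 := ⟨m - 1, by omega⟩
    simp only [Nat.add_sub_cancel]; ring
  rw [this, Nat.add_mul_mod_self_left, Nat.mod_eq_of_lt hj]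

theorem le_blockOf (m j r : ℕ) : r ≤ blockOf m j r := Nat.le_add_right _ _

theorem blockOf_lt {m j : ℕ} (hj : j < m) (r : ℕ) : blockOf m j r < r + m :=
  Nat.add_lt_add_left (Nat.mod_lt _ (by omega)) _

theorem eq_of_mod_eq_of_lt {m a b : ℕ} (h : a % m = b % m) (h1 : a < b + m) (h2 : b < a + m) :
    a = b := by
  rcases le_total a b with hab | hab
  · obtain ⟨c, hc⟩ := (Nat.modEq_iff_dvd' hab).1 h
    have hc0 : c = 0 := by
      by_contra hne
      have : m * 1 ≤ m * c := Nat.mul_le_mul_left m (Nat.pos_of_ne_zero hne)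
      omega
    subst hc0; omega
  · obtain ⟨c, hc⟩ := (Nat.modEq_iff_dvd' hab).1 h.symm
    have hc0 : c = 0 := by
      by_contra hne
      have : m * 1 ≤ m * c := Nat.mul_le_mul_left m (Nat.pos_of_ne_zero hne)
      omega
    subst hc0; omega

theorem eq_blockOf {m j b r : ℕ} (hj : j < m) (hb : b % m = j) (h1 : r ≤ b) (h2 : b < r + m) :
    b = blockOf m j r := by
  have := blockOf_mod hj r
  have := le_blockOf m j r
  have := blockOf_lt hj r
  exact eq_of_mod_eq_of_lt (m := m) (by omega) (by omega) (by omega)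

/-- What the reduction knows about the points: their rings (ring `J` for points very close to the
origin) and location keys, the tours `D` that are fixed in advance, and the positions `sc b i`
of the points in the instance of the block `b`. -/
structure IsPlan (ε : ℝ) (k n m J L : ℕ) (pt : ℕ → Plane) (ring key : ℕ → ℕ) (D : List (List ℕ))
    (sc : ℕ → ℕ → Plane) : Prop where
  eps_pos : 0 < ε
  eps_le : ε ≤ 1 / 2
  k_pos : 1 ≤ k
  m_pos : 1 ≤ m
  m_eps : 1 ≤ m * ε
  ring_le : ∀ i < n, ring i ≤ J
  -- All points of ring `J` together, on tours of their own, cost at most `ε` times a tour to `i₀`.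
  far : ∃ i₀ < n, ∀ i < n, ring i = J → n * ‖pt i‖ ≤ ε * ‖pt i₀‖
  gap : ∀ i < n, ∀ j < n, ring j < J → ring i + 2 ≤ ring j → ‖pt j‖ ≤ ε * ‖pt i‖
  key_ring : ∀ i < n, ∀ j < n, ring i < J → ring j < J → key i = key j → ring i = ring j
  -- Comparisons in both directions are needed: from points to representatives, from these to the
  -- positions in an instance, and back to the points.
  near : ∃ η : ℝ, 0 ≤ η ∧ η * k ≤ 4 * ε ∧ ∀ i < n, ∀ j < n, ring i < J → ring j < J →
    key i = key j → dist (pt i) (pt j) ≤ η * ‖pt j‖ ∧ ∀ b,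
      dist (sc b i) (pt j) ≤ η * ‖pt j‖ ∧ dist (pt j) (sc b i) ≤ η * ‖sc b i‖
  card_keys : ∀ b, (((Finset.range n).filter fun i => ring i < J ∧ ring i ≤ b ∧
    b < ring i + m).image key).card ≤ L
  D_nodup : D.flatten.Nodup
  -- A full tour is fixed only at a location that keeps `k * L` points, which is what the exchange
  -- argument requires.
  D_tour : ∀ t ∈ D, (∃ i < n, ring i = J ∧ t = [i]) ∨ (t.length = k ∧
    (∀ i ∈ t, i < n ∧ ring i < J) ∧ ∃ a, (∀ i ∈ t, key i = a) ∧ k * L ≤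
      ((Finset.range n).filter fun i => ring i < J ∧ key i = a ∧ i ∉ D.flatten).card)
  D_tiny : ∀ i < n, ring i = J → i ∈ D.flatten

/-- The points of the block `b` that are not on tours of `D`. -/
def keptList (n m : ℕ) (ring : ℕ → ℕ) (D : List (List ℕ)) (b : ℕ) : List ℕ :=
  (List.range n).filter fun i => i ∉ D.flatten ∧ ring i ≤ b ∧ b < ring i + m

/-- The tours of the blocks in the residue class `j` in terms of the original indices. -/
def pulledTours (n m B : ℕ) (ring : ℕ → ℕ) (D : List (List ℕ)) (Us : List (List (List ℕ)))
    (j : ℕ) : List (List ℕ) :=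
  ((List.range B).filter fun b => b % m = j).flatMap fun b =>
    (Us.getD b []).map (List.map fun p => (keptList n m ring D b).getD p 0)

section Plan

variable {ε : ℝ} {k n m J L : ℕ} {pt : ℕ → Plane} {ring key : ℕ → ℕ} {D : List (List ℕ)}
  {sc : ℕ → ℕ → Plane}

theorem mem_keptList {b i : ℕ} : i ∈ keptList n m ring D b ↔
    i < n ∧ i ∉ D.flatten ∧ ring i ≤ b ∧ b < ring i + m := by
  simp [keptList]

theorem nodup_keptList (b : ℕ) : (keptList n m ring D b).Nodup := List.nodup_range.filter _

namespace IsPlan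

theorem ring_lt (h : IsPlan ε k n m J L pt ring key D sc) {i : ℕ} (hi : i < n)
    (hD : i ∉ D.flatten) : ring i < J :=
  lt_of_le_of_ne (h.ring_le i hi) fun e => hD (h.D_tiny i hi e)

theorem lt_of_mem_D (h : IsPlan ε k n m J L pt ring key D sc) {t : List ℕ} (ht : t ∈ D) {i : ℕ}
    (hi : i ∈ t) : i < n := by
  rcases h.D_tour t ht with ⟨j, hj, -, rfl⟩ | ⟨-, h1, -⟩
  · obtain rfl := List.mem_singleton.1 hi; exact hj
  · exact (h1 i hi).1

theorem isTourCover (h : IsPlan ε k n m J L pt ring key D sc) {P : List Plane} (hP : P.length = n)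
    {Us : List (List (List ℕ))}
    (hUs : ∀ b < J + m, IsTourCover k ((keptList n m ring D b).map (sc b)) (Us.getD b []))
    {j : ℕ} (hj : j < m) : IsTourCover k P (D ++ pulledTours n m (J + m) ring D Us j) := by
  have hmem : ∀ t ∈ pulledTours n m (J + m) ring D Us j, ∃ b < J + m, ∃ u ∈ Us.getD b [],
      t = u.map fun p => (keptList n m ring D b).getD p 0 := by
    intro t ht
    obtain ⟨b, hb, ht⟩ := List.mem_flatMap.1 ht
    obtain ⟨u, hu, rfl⟩ := List.mem_map.1 ht
    exact ⟨b, List.mem_range.1 (List.mem_filter.1 hb).1, u, hu, rfl⟩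
  constructor
  · intro t ht i hi
    rw [hP]
    rcases List.mem_append.1 ht with ht | ht
    · exact h.lt_of_mem_D ht hi
    · obtain ⟨b, hb, u, hu, rfl⟩ := hmem t ht
      obtain ⟨p, hp, rfl⟩ := List.mem_map.1 hi
      have hlt := (hUs b hb).index_lt u hu p hp
      rw [List.length_map] at hlt
      rw [List.getD_eq_getElem _ _ hlt]
      exact (mem_keptList.1 (List.getElem_mem hlt)).1
  · intro t ht
    rcases List.mem_append.1 ht with ht | ht
    · exact (List.nodup_flatten.1 h.D_nodup).1 t ht
    · obtain ⟨b, hb, u, hu, rfl⟩ := hmem t ht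
      refine List.Nodup.map_on ?_ ((hUs b hb).nodup u hu)
      intro p hp q hq hpq
      have hp' := (hUs b hb).index_lt u hu p hp
      have hq' := (hUs b hb).index_lt u hu q hq
      rw [List.length_map] at hp' hq'
      rw [List.getD_eq_getElem _ _ hp', List.getD_eq_getElem _ _ hq'] at hpq
      exact (List.Nodup.getElem_inj_iff (nodup_keptList b)).1 hpq
  · intro t ht
    rcases List.mem_append.1 ht with ht | ht
    · rcases h.D_tour t ht with ⟨i, -, -, rfl⟩ | ⟨h1, -⟩
      · simpa using h.k_pos
      · exact h1.le
    · obtain ⟨b, hb, u, hu, rfl⟩ := hmem t ht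
      rw [List.length_map]
      exact (hUs b hb).length_le u hu
  · intro i hi
    rw [hP] at hi
    by_cases hD : i ∈ D.flatten
    · obtain ⟨t, ht, hit⟩ := List.mem_flatten.1 hD
      exact ⟨t, List.mem_append_left _ ht, hit⟩
    · have hr := h.ring_lt hi hD
      -- The only block of the class that contains the ring of `i`.
      set b := blockOf m j (ring i) with hb
      have hblt := blockOf_lt hj (ring i)
      have hk : i ∈ keptList n m ring D b :=
        mem_keptList.2 ⟨hi, hD, le_blockOf m j (ring i), hblt⟩
      obtain ⟨p, hp, hpi⟩ := List.mem_iff_getElem.1 hk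
      obtain ⟨u, hu, hpu⟩ := (hUs b (by omega)).covers p (by simpa using hp)
      refine ⟨u.map fun p => (keptList n m ring D b).getD p 0, List.mem_append_right _ ?_, ?_⟩
      · refine List.mem_flatMap.2 ⟨b, List.mem_filter.2 ⟨List.mem_range.2 (by omega), ?_⟩,
          List.mem_map_of_mem hu⟩
        simpa using blockOf_mod hj (ring i)
      · refine List.mem_map.2 ⟨p, hpu, ?_⟩
        rw [List.getD_eq_getElem _ _ hp, hpi]

/-- Points in rings that are not adjacent. -/
theorem norm_add_le (h : IsPlan ε k n m J L pt ring key D sc) {i j : ℕ} (hi : i < n) (hj : j < n)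
    (hiJ : ring i < J) (hjJ : ring j < J) (hij : ring i + 2 ≤ ring j ∨ ring j + 2 ≤ ring i) :
    ‖pt i‖ + ‖pt j‖ ≤ (1 + 4 * ε) * dist (pt i) (pt j) := by
  rcases hij with hij | hij
  · exact norm_add_norm_le h.eps_pos h.eps_le (h.gap i hi j hj hjJ hij)
  · rw [add_comm, dist_comm]
    exact norm_add_norm_le h.eps_pos h.eps_le (h.gap j hj i hi hiJ hij)

/-- Once each block has lost its last ring `b`, points of different blocks lie in rings at least two
apart. The tour is therefore split by blocks at the cost of a factor `1 + 4ε`. -/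
theorem sum_rest_le (h : IsPlan ε k n m J L pt ring key D sc) {j : ℕ} (hj : j < m) (t : List ℕ)
    (ht : ∀ i ∈ t, i < n) :
    ∑ b ∈ (Finset.range (J + m)).filter (fun b => b % m = j), closedLength ((t.filter fun i =>
      ring i < J ∧ ring i ≤ b ∧ b < ring i + m ∧ ring i ≠ b).map pt) ≤
      (1 + 4 * ε) * closedLength (t.map pt) := by
  set t' := t.filter fun i => ring i < J ∧ ring i % m ≠ j with ht'
  have hε := h.eps_pos
  have hmem : ∀ i ∈ t', i < n ∧ ring i < J ∧ ring i % m ≠ j := by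
    intro i hi
    have := List.mem_filter.1 hi
    exact ⟨ht i this.1, by simpa using this.2⟩
  have h1 := sum_closedLength_filter_le pt (fun i => blockOf m j (ring i)) (J + m)
    (A := 1 + 4 * ε) (by linarith) t' (by
      intro i hi
      have := blockOf_lt hj (ring i)
      have := hmem i hi
      omega) (by
      intro i hi i' hi' hne
      have a := hmem i hi
      have a' := hmem i' hi'
      refine h.norm_add_le a.1 a'.1 a.2.1 a'.2.1 ?_
      have b1 := le_blockOf m j (ring i)
      have b1' := le_blockOf m j (ring i')
      have b2 := blockOf_lt hj (ring i)
      have b2' := blockOf_lt hj (ring i')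
      have b3 := blockOf_mod hj (ring i)
      have b3' := blockOf_mod hj (ring i')
      have c : ring i ≠ blockOf m j (ring i) := fun e => a.2.2 (by rw [← e] at b3; exact b3)
      have c' : ring i' ≠ blockOf m j (ring i') := fun e => a'.2.2 (by rw [← e] at b3'; exact b3')
      -- If the rings were equal or adjacent, the blocks would be less than `m` apart, as neither
      -- ring is the last of its block. Being congruent modulo `m`, they would coincide.
      by_contra hcon
      refine hne (eq_of_mod_eq_of_lt (m := m) (by rw [b3, b3']) ?_ ?_) <;> omega)
  have h2 : closedLength (t'.map pt) ≤ closedLength (t.map pt) :=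
    closedLength_sublist (List.filter_sublist.map pt)
  have h3 : ∑ b ∈ (Finset.range (J + m)).filter (fun b => b % m = j), closedLength ((t.filter fun i =>
      ring i < J ∧ ring i ≤ b ∧ b < ring i + m ∧ ring i ≠ b).map pt) ≤
      ∑ b ∈ Finset.range (J + m), closedLength ((t'.filter fun i =>
        blockOf m j (ring i) = b).map pt) := by
    refine le_trans (le_of_eq ?_) (Finset.sum_le_sum_of_subset_of_nonneg
      (Finset.filter_subset (fun b => b % m = j) _) fun _ _ _ => closedLength_nonneg _)
    refine Finset.sum_congr rfl fun b hb => ?_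
    have hbj := (Finset.mem_filter.1 hb).2
    rw [ht', List.filter_filter]
    congr 2
    refine List.filter_congr fun i _ => ?_
    rw [← Bool.decide_and, decide_eq_decide]
    constructor
    · rintro ⟨e1, e2, e3, e4⟩
      refine ⟨(eq_blockOf hj hbj e2 e3).symm, e1, fun e => e4 ?_⟩
      exact eq_of_mod_eq_of_lt (m := m) (by rw [e, hbj]) (by omega) (by omega)
    · rintro ⟨e1, e2, e3⟩
      have := le_blockOf m j (ring i)
      have := blockOf_lt hj (ring i)
      exact ⟨e2, by omega, by omega, fun e => e3 (by rw [e, hbj])⟩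
  calc _ ≤ _ := h3
    _ ≤ _ := h1
    _ ≤ _ := mul_le_mul_of_nonneg_left h2 (by linarith)

/-- Distinct rings of equal parity are not adjacent, so splitting the points of one parity by rings
costs a factor `1 + 4ε ≤ 3`. The two parities give 6. -/
theorem sum_mark_le (h : IsPlan ε k n m J L pt ring key D sc) (t : List ℕ) (ht : ∀ i ∈ t, i < n) :
    ∑ b ∈ Finset.range (J + m), closedLength ((t.filter fun i => ring i < J ∧ ring i = b).map pt) ≤
      6 * closedLength (t.map pt) := by
  have hε := h.eps_pos
  have hε2 := h.eps_le
  have h1 : ∀ e, ∑ b ∈ Finset.range (J + m), closedLength (((t.filter fun i =>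
      ring i < J ∧ ring i % 2 = e).filter fun i => ring i = b).map pt) ≤
      3 * closedLength (t.map pt) := by
    intro e
    set t' := t.filter fun i => ring i < J ∧ ring i % 2 = e with ht'
    have hmem : ∀ i ∈ t', i < n ∧ ring i < J ∧ ring i % 2 = e := by
      intro i hi
      have := List.mem_filter.1 hi
      exact ⟨ht i this.1, by simpa using this.2⟩
    refine (sum_closedLength_filter_le pt ring (J + m) (A := 1 + 4 * ε) (by linarith) t' ?_ ?_).trans ?_
    · intro i hi
      have := hmem i hi
      omega
    · intro i hi i' hi' hne
      have a := hmem i hi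
      have a' := hmem i' hi'
      exact h.norm_add_le a.1 a'.1 a.2.1 a'.2.1 (by omega)
    · have h2 : closedLength (t'.map pt) ≤ closedLength (t.map pt) :=
        closedLength_sublist (List.filter_sublist.map pt)
      have := closedLength_nonneg (t'.map pt)
      nlinarith
  have h2 : ∀ b ∈ Finset.range (J + m),
      closedLength ((t.filter fun i => ring i < J ∧ ring i = b).map pt) ≤
      closedLength (((t.filter fun i => ring i < J ∧ ring i % 2 = 0).filter
        fun i => ring i = b).map pt) + closedLength (((t.filter fun i => ring i < J ∧
        ring i % 2 = 1).filter fun i => ring i = b).map pt) := by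
    intro b _
    have key : ∀ e, b % 2 = e → t.filter (fun i => decide (ring i < J ∧ ring i = b)) =
        (t.filter fun i => decide (ring i < J ∧ ring i % 2 = e)).filter fun i => decide (ring i = b) := by
      intro e he
      rw [List.filter_filter]
      refine List.filter_congr fun i _ => ?_
      rw [← Bool.decide_and, decide_eq_decide]
      constructor
      · rintro ⟨a1, rfl⟩; exact ⟨rfl, a1, he⟩
      · rintro ⟨rfl, a1, -⟩; exact ⟨a1, rfl⟩
    rcases Nat.mod_two_eq_zero_or_one b with hb | hb
    · rw [← key 0 hb]
      linarith [closedLength_nonneg (((t.filter fun i => ring i < J ∧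
        ring i % 2 = 1).filter fun i => ring i = b).map pt)]
    · rw [← key 1 hb]
      linarith [closedLength_nonneg (((t.filter fun i => ring i < J ∧
        ring i % 2 = 0).filter fun i => ring i = b).map pt)]
  refine (Finset.sum_le_sum h2).trans ?_
  rw [Finset.sum_add_distrib]
  linarith [h1 0, h1 1]

end IsPlan

/-- A cover of the points of the block `b`, in which ring `b` is served separately. -/
def blockTours (m J : ℕ) (ring : ℕ → ℕ) (V : List (List ℕ)) (b : ℕ) : List (List ℕ) :=
  (V.map fun t => t.filter fun i => ring i < J ∧ ring i ≤ b ∧ b < ring i + m ∧ ring i ≠ b) ++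
    V.map fun t => t.filter fun i => ring i < J ∧ ring i = b

theorem finsetSum_listSum_comm {α β : Type*} (s : Finset α) (l : List β) (f : α → β → ℝ) :
    ∑ a ∈ s, (l.map (f a)).sum = (l.map fun x => ∑ a ∈ s, f a x).sum := by
  induction l with
  | nil => simp
  | cons x l ih => simp [Finset.sum_add_distrib, ih]

/-- For some residue class, the covers of its blocks are hardly longer than `V`. -/
theorem IsPlan.exists_shift (h : IsPlan ε k n m J L pt ring key D sc) (V : List (List ℕ))
    (hV : ∀ t ∈ V, ∀ i ∈ t, i < n) :
    ∃ j < m, ∑ b ∈ (Finset.range (J + m)).filter (fun b => b % m = j),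
      lengthOf pt (blockTours m J ring V b) ≤ (1 + 10 * ε) * lengthOf pt V := by
  -- The cost of the separate tours in the class `j`. Every ring is separate in exactly one class,
  -- so these costs add up to at most six times the length of `V`.
  set μ : ℕ → ℝ := fun j => ∑ b ∈ (Finset.range (J + m)).filter (fun b => b % m = j),
    (V.map fun t => closedLength ((t.filter fun i => ring i < J ∧ ring i = b).map pt)).sum with hμ
  have h1 : ∑ j ∈ Finset.range m, μ j ≤ 6 * lengthOf pt V := by
    simp only [hμ]
    rw [Finset.sum_fiberwise_of_maps_to (fun b _ => Finset.mem_range.2 (Nat.mod_lt b h.m_pos)),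
      finsetSum_listSum_comm, lengthOf, ← List.sum_map_mul_left]
    exact List.sum_le_sum fun t ht => h.sum_mark_le t (hV t ht)
  have hm : (0 : ℝ) < m := by exact_mod_cast h.m_pos
  -- Averaging over the `m ≥ 1/ε` classes turns the factor 6 into `6ε`.
  obtain ⟨j, hj, hμj⟩ : ∃ j ∈ Finset.range m, μ j ≤ 6 * lengthOf pt V / m := by
    refine Finset.exists_le_of_sum_le ⟨0, Finset.mem_range.2 h.m_pos⟩ ?_
    rw [Finset.sum_const, Finset.card_range, nsmul_eq_mul, mul_div_cancel₀ _ hm.ne']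
    exact h1
  have hj := Finset.mem_range.1 hj
  refine ⟨j, hj, ?_⟩
  have h2 : 6 * lengthOf pt V / m ≤ 6 * ε * lengthOf pt V := by
    rw [div_le_iff₀ hm]
    have := mul_le_mul_of_nonneg_left h.m_eps (lengthOf_nonneg pt V)
    nlinarith
  have h3 : ∑ b ∈ (Finset.range (J + m)).filter (fun b => b % m = j), (V.map fun t =>
      closedLength ((t.filter fun i => ring i < J ∧ ring i ≤ b ∧ b < ring i + m ∧
        ring i ≠ b).map pt)).sum ≤ (1 + 4 * ε) * lengthOf pt V := by
    rw [finsetSum_listSum_comm, lengthOf, ← List.sum_map_mul_left]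
    exact List.sum_le_sum fun t ht => h.sum_rest_le hj t (hV t ht)
  have h4 : ∑ b ∈ (Finset.range (J + m)).filter (fun b => b % m = j),
      lengthOf pt (blockTours m J ring V b) = ∑ b ∈ (Finset.range (J + m)).filter
      (fun b => b % m = j), (V.map fun t => closedLength ((t.filter fun i => ring i < J ∧
        ring i ≤ b ∧ b < ring i + m ∧ ring i ≠ b).map pt)).sum + μ j := by
    rw [hμ, ← Finset.sum_add_distrib]
    refine Finset.sum_congr rfl fun b _ => ?_
    simp only [blockTours, lengthOf, List.map_append, List.sum_append, List.map_map]
    rfl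
  rw [h4]
  linarith

end Plan

end TourCover


/-! ### Fixed tours are paid for by savings in the blocks -/

namespace TourCover

section Plan

variable {ε : ℝ} {k n m J L : ℕ} {pt : ℕ → Plane} {ring key : ℕ → ℕ} {D : List (List ℕ)}
  {sc : ℕ → ℕ → Plane}

open Classical in
/-- A point representing the location `a`. -/
noncomputable def locPoint (n J : ℕ) (pt : ℕ → Plane) (ring key : ℕ → ℕ) (a : ℕ) : Plane :=
  if h : ∃ i, i < n ∧ ring i < J ∧ key i = a then pt h.choose else 0

/-- Number of tours of `D` serving the location `a`. -/
def peelCount (J : ℕ) (ring key : ℕ → ℕ) (D : List (List ℕ)) (a : ℕ) : ℕ :=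
  D.countP fun t => t.any fun i => ring i < J ∧ key i = a

/-- The points of the block `b`. -/
def blockPoints (n m J : ℕ) (ring : ℕ → ℕ) (b : ℕ) : Finset ℕ :=
  (Finset.range n).filter fun i => ring i < J ∧ ring i ≤ b ∧ b < ring i + m

theorem mem_blockPoints {b i : ℕ} : i ∈ blockPoints n m J ring b ↔
    i < n ∧ ring i < J ∧ ring i ≤ b ∧ b < ring i + m := by
  simp [blockPoints]

theorem length_filter_flatten {α : Type*} (k : ℕ) (p : α → Bool) (D : List (List α))
    (h : ∀ t ∈ D, (t.filter p).length = if t.any p then k else 0) :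
    (D.flatten.filter p).length = k * D.countP fun t => t.any p := by
  induction D with
  | nil => simp
  | cons t D ih =>
    have h1 := h t (by simp)
    have h2 := ih fun u hu => h u (by simp [hu])
    rw [List.flatten_cons, List.filter_append, List.length_append, h1, h2, List.countP_cons]
    split_ifs <;> ring

theorem sum_map_ite {α : Type*} (D : List α) (p : α → Bool) (c : ℝ) :
    (D.map fun t => if p t then c else 0).sum = D.countP p * c := by
  induction D with
  | nil => simp
  | cons t D ih =>
    simp only [List.map_cons, List.sum_cons, ih, List.countP_cons]
    split_ifs
    · push_cast; ring
    · push_cast; ring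

theorem length_le_lengthOf {ι : Type*} (f : ι → Plane) {V : List (List ι)} {t : List ι}
    (ht : t ∈ V) : closedLength (t.map f) ≤ lengthOf f V := by
  refine List.single_le_sum ?_ _ (List.mem_map_of_mem (f := fun t => closedLength (t.map f)) ht)
  intro x hx
  obtain ⟨t, -, rfl⟩ := List.mem_map.1 hx
  exact closedLength_nonneg _

namespace IsPlan

theorem locPoint_spec {i : ℕ} (hi : i < n) (hiJ : ring i < J) :
    ∃ j < n, ring j < J ∧ key j = key i ∧ locPoint n J pt ring key (key i) = pt j := by
  have h : ∃ j, j < n ∧ ring j < J ∧ key j = key i := ⟨i, hi, hiJ, rfl⟩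
  refine ⟨h.choose, h.choose_spec.1, h.choose_spec.2.1, h.choose_spec.2.2, ?_⟩
  rw [locPoint, dif_pos h]

theorem near_locPoint (h : IsPlan ε k n m J L pt ring key D sc) :
    ∃ η : ℝ, 0 ≤ η ∧ η * k ≤ 4 * ε ∧ ∀ i < n, ring i < J →
      dist (pt i) (locPoint n J pt ring key (key i)) ≤ η * ‖locPoint n J pt ring key (key i)‖ ∧
      dist (locPoint n J pt ring key (key i)) (pt i) ≤ η * ‖pt i‖ ∧
      ∀ b, dist (sc b i) (locPoint n J pt ring key (key i)) ≤
        η * ‖locPoint n J pt ring key (key i)‖ ∧ dist (pt i) (sc b i) ≤ η * ‖sc b i‖ := by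
  obtain ⟨η, h0, h1, h2⟩ := h.near
  refine ⟨η, h0, h1, fun i hi hiJ => ?_⟩
  obtain ⟨j, hj, hjJ, hk, hp⟩ := locPoint_spec (pt := pt) (key := key) hi hiJ
  rw [hp]
  exact ⟨(h2 i hi j hj hiJ hjJ hk.symm).1, (h2 j hj i hi hjJ hiJ hk).1, fun b =>
    ⟨((h2 i hi j hj hiJ hjJ hk.symm).2 b).1, ((h2 i hi i hi hiJ hiJ rfl).2 b).2⟩⟩

/-- Every fixed tour outside ring `J` has exactly `k` points, all at one location. So the fixed
points of a location come in groups of `k`. -/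
theorem count_eq (h : IsPlan ε k n m J L pt ring key D sc) (a : ℕ) :
    ((Finset.range n).filter fun i => ring i < J ∧ key i = a).card =
      ((Finset.range n).filter fun i => ring i < J ∧ key i = a ∧ i ∉ D.flatten).card +
        k * peelCount J ring key D a := by
  have h1 : k * peelCount J ring key D a =
      ((Finset.range n).filter fun i => ring i < J ∧ key i = a ∧ i ∈ D.flatten).card := by
    rw [peelCount, ← length_filter_flatten, ← List.toFinset_card_of_nodup (h.D_nodup.filter _)]
    · congr 1
      ext i
      simp only [List.mem_toFinset, List.mem_filter, decide_eq_true_eq, Finset.mem_filter,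
        Finset.mem_range]
      constructor
      · rintro ⟨h1, h2, h3⟩
        obtain ⟨t, ht, hit⟩ := List.mem_flatten.1 h1
        exact ⟨h.lt_of_mem_D ht hit, h2, h3, h1⟩
      · rintro ⟨-, h2, h3, h1⟩
        exact ⟨h1, h2, h3⟩
    · intro t ht
      rcases h.D_tour t ht with ⟨i, hi, hiJ, rfl⟩ | ⟨h1, h2, b, h3, -⟩
      · simp [hiJ]
      · by_cases hba : b = a
        · subst hba
          have e : t.filter (fun i => decide (ring i < J ∧ key i = b)) = t := by
            rw [List.filter_eq_self]
            intro i hi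
            simpa using ⟨(h2 i hi).2, h3 i hi⟩
          have hne : t ≠ [] := by
            rintro rfl
            have := h.k_pos
            simp at h1
            omega
          obtain ⟨i, hi⟩ := List.exists_mem_of_ne_nil t hne
          rw [e, if_pos, h1]
          rw [List.any_eq_true]
          exact ⟨i, hi, by simpa using ⟨(h2 i hi).2, h3 i hi⟩⟩
        · have e : t.filter (fun i => decide (ring i < J ∧ key i = a)) = [] := by
            rw [List.filter_eq_nil_iff]
            intro i hi
            simp only [decide_eq_true_eq, not_and]
            intro _ hk
            exact hba ((h3 i hi).symm.trans hk)
          rw [e, if_neg]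
          · rfl
          · rw [List.any_eq_true]
            rintro ⟨i, hi, hi'⟩
            simp only [decide_eq_true_eq] at hi'
            exact hba ((h3 i hi).symm.trans hi'.2)
  rw [h1, ← Finset.card_union_of_disjoint]
  · congr 1
    ext i
    simp only [Finset.mem_union, Finset.mem_filter, Finset.mem_range]
    tauto
  · rw [Finset.disjoint_left]
    intro i hi hi'
    exact (Finset.mem_filter.1 hi).2.2.2 (Finset.mem_filter.1 hi').2.2.2

/-- A cover of all points yields a cheap cover of the instance of the block `b`. -/
theorem opt_block_le (h : IsPlan ε k n m J L pt ring key D sc) (V : List (List ℕ))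
    (hVk : ∀ t ∈ V, t.length ≤ k) (hVn : ∀ t ∈ V, ∀ i ∈ t, i < n)
    (hV : ∀ i < n, ∃ t ∈ V, i ∈ t) (b : ℕ) :
    opt k ((keptList n m ring D b).map (sc b)) + (1 + 4 * ε) *
      ∑ a ∈ (blockPoints n m J ring b).image key, peelCount J ring key D a *
        (2 * ‖locPoint n J pt ring key a‖) ≤
      (1 + 4 * ε) ^ 2 * lengthOf pt (blockTours m J ring V b) := by
  obtain ⟨η, hη, hηk, hnear⟩ := h.near_locPoint
  have hε := h.eps_pos
  set ρ := locPoint n J pt ring key with hρ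
  set Q := blockPoints n m J ring b with hQ
  set K := Q.filter fun i => i ∉ D.flatten with hK
  -- The key determines the ring, so a block contains a location entirely or not at all.
  have hfib : ∀ a ∈ Q.image key, ∀ i < n, ring i < J → key i = a → i ∈ Q := by
    intro a ha i hi hiJ hia
    obtain ⟨j, hj, rfl⟩ := Finset.mem_image.1 ha
    have hj' := mem_blockPoints.1 hj
    have := h.key_ring i hi j hj'.1 hiJ hj'.2.1 hia
    exact mem_blockPoints.2 ⟨hi, hiJ, by omega, by omega⟩
  have hQfib : ∀ a ∈ Q.image key, Q.filter (fun i => key i = a) =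
      (Finset.range n).filter fun i => ring i < J ∧ key i = a := by
    intro a ha
    ext i
    simp only [Finset.mem_filter, Finset.mem_range]
    constructor
    · rintro ⟨h1, h2⟩
      have := mem_blockPoints.1 h1
      exact ⟨this.1, this.2.1, h2⟩
    · rintro ⟨h1, h2, h3⟩
      exact ⟨hfib a ha i h1 h2 h3, h3⟩
  have hKfib : ∀ a ∈ Q.image key, K.filter (fun i => key i = a) =
      (Finset.range n).filter fun i => ring i < J ∧ key i = a ∧ i ∉ D.flatten := by
    intro a ha
    ext i
    simp only [hK, Finset.mem_filter, Finset.mem_range]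
    constructor
    · rintro ⟨⟨h1, h3⟩, h2⟩
      have := mem_blockPoints.1 h1
      exact ⟨this.1, this.2.1, h2, h3⟩
    · rintro ⟨h1, h2, h3, h4⟩
      exact ⟨⟨hfib a ha i h1 h2 h3, h4⟩, h3⟩
  have hBk : ∀ t ∈ blockTours m J ring V b, t.length ≤ k ∧ ∀ i ∈ t, i < n ∧ ring i < J := by
    intro t ht
    rcases List.mem_append.1 ht with ht | ht <;> obtain ⟨u, hu, rfl⟩ := List.mem_map.1 ht
    · refine ⟨(List.length_filter_le _ _).trans (hVk u hu), fun i hi => ?_⟩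
      have := List.mem_filter.1 hi
      exact ⟨hVn u hu i this.1, (by simpa using this.2 : _ ∧ _).1⟩
    · refine ⟨(List.length_filter_le _ _).trans (hVk u hu), fun i hi => ?_⟩
      have := List.mem_filter.1 hi
      exact ⟨hVn u hu i this.1, (by simpa using this.2 : _ ∧ _).1⟩
  -- The exchange is carried out with all points moved to the representatives of their locations. A
  -- location with a fixed tour keeps `k * L` points, and the block has at most `L` locations.
  obtain ⟨U, hU1, hU2, hU3⟩ := exists_peeled_cover k h.k_pos key ρ Q K (Q.image key)
    (fun i hi => Finset.mem_image_of_mem key hi) (Finset.filter_subset _ _)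
    (peelCount J ring key D)
    (fun a ha => by rw [hQfib a ha, hKfib a ha]; exact h.count_eq a)
    (fun a ha hpos => by
      rw [hKfib a ha]
      refine (Nat.mul_le_mul_left k (h.card_keys b)).trans ?_
      obtain ⟨t, ht, hta⟩ := List.countP_pos_iff.1 hpos
      obtain ⟨i, hit, hi⟩ := List.any_eq_true.1 hta
      simp only [decide_eq_true_eq] at hi
      rcases h.D_tour t ht with ⟨j, hj, hjJ, rfl⟩ | ⟨-, -, c, hc, hcard⟩
      · obtain rfl := List.mem_singleton.1 hit
        omega
      · have : c = a := (hc i hit).symm.trans hi.2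
        exact this ▸ hcard)
    (blockTours m J ring V b) (fun t ht => (hBk t ht).1) (by
      intro i hi
      have hi' := mem_blockPoints.1 hi
      obtain ⟨t, ht, hit⟩ := hV i hi'.1
      by_cases hib : ring i = b
      · exact ⟨_, List.mem_append_right _ (List.mem_map_of_mem ht), List.mem_filter.2
          ⟨hit, by simpa using ⟨hi'.2.1, hib⟩⟩⟩
      · exact ⟨_, List.mem_append_left _ (List.mem_map_of_mem ht), List.mem_filter.2
          ⟨hit, by simpa using ⟨hi'.2.1, hi'.2.2.1, hi'.2.2.2, hib⟩⟩⟩)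
  have hKkept : ∀ i, i ∈ K ↔ i ∈ keptList n m ring D b := by
    intro i
    rw [mem_keptList, hK, Finset.mem_filter, mem_blockPoints]
    constructor
    · rintro ⟨⟨h1, -, h2⟩, h3⟩; exact ⟨h1, h3, h2⟩
    · rintro ⟨h1, h3, h2⟩; exact ⟨⟨h1, h.ring_lt h1 h3, h2⟩, h3⟩
  have hKn : ∀ i ∈ K, i < n ∧ ring i < J := fun i hi =>
    have := mem_blockPoints.1 (Finset.mem_filter.1 hi).1
    ⟨this.1, this.2.1⟩
  set l := keptList n m ring D b with hl
  -- Tours of an instance refer to positions in the list of its points, hence the translation by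
  -- `idxOf`.
  have hcover : IsTourCover k (l.map (sc b)) (U.map (List.map fun i => l.idxOf i)) := by
    constructor
    · intro t ht p hp
      obtain ⟨u, hu, rfl⟩ := List.mem_map.1 ht
      obtain ⟨i, hi, rfl⟩ := List.mem_map.1 hp
      rw [List.length_map]
      exact List.idxOf_lt_length_iff.2 ((hKkept i).1 ((hU1 u hu).2.2 i hi))
    · intro t ht
      obtain ⟨u, hu, rfl⟩ := List.mem_map.1 ht
      refine (hU1 u hu).1.map_on ?_
      intro i hi j _ hij
      exact (List.idxOf_inj ((hKkept i).1 ((hU1 u hu).2.2 i hi))).1 hij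
    · intro t ht
      obtain ⟨u, hu, rfl⟩ := List.mem_map.1 ht
      rw [List.length_map]
      exact (hU1 u hu).2.1
    · intro p hp
      rw [List.length_map] at hp
      obtain ⟨t, ht, hit⟩ := hU2 l[p] ((hKkept _).2 (List.getElem_mem hp))
      refine ⟨_, List.mem_map_of_mem ht, List.mem_map.2 ⟨_, hit, ?_⟩⟩
      exact (nodup_keptList b).idxOf_getElem p hp
  have hopt := opt_le hcover
  rw [coverLength_eq, lengthOf_map_map, lengthOf_congr (g := sc b)] at hopt
  swap
  · intro t ht i hi
    have hil := (hKkept i).1 ((hU1 t ht).2.2 i hi)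
    have hlt := List.idxOf_lt_length_iff.2 hil
    rw [List.getD_eq_getElem _ _ (by simpa using hlt), List.getElem_map, List.getElem_idxOf]
  -- One factor `1 + 4ε` arises from moving representatives to the positions in the instance, the
  -- other from moving points to representatives.
  have h1 : lengthOf (sc b) U ≤ (1 + η * k) * lengthOf (fun i => ρ (key i)) U :=
    lengthOf_near _ _ U hη fun t ht => ⟨(hU1 t ht).2.1, fun i hi =>
      have := hKn i ((hU1 t ht).2.2 i hi)
      ((hnear i this.1 this.2).2.2 b).1⟩
  have h2 : lengthOf (fun i => ρ (key i)) (blockTours m J ring V b) ≤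
      (1 + η * k) * lengthOf pt (blockTours m J ring V b) :=
    lengthOf_near _ _ _ hη fun t ht => ⟨(hBk t ht).1, fun i hi =>
      have := (hBk t ht).2 i hi
      (hnear i this.1 this.2).2.1⟩
  have e1 := lengthOf_nonneg (fun i => ρ (key i)) U
  have e2 := lengthOf_nonneg pt (blockTours m J ring V b)
  have h1' : lengthOf (sc b) U ≤ (1 + 4 * ε) * lengthOf (fun i => ρ (key i)) U :=
    h1.trans (mul_le_mul_of_nonneg_right (by linarith) e1)
  have h2' : lengthOf (fun i => ρ (key i)) (blockTours m J ring V b) ≤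
      (1 + 4 * ε) * lengthOf pt (blockTours m J ring V b) :=
    h2.trans (mul_le_mul_of_nonneg_right (by linarith) e2)
  have h3' := mul_le_mul_of_nonneg_left hU3 (show 0 ≤ 1 + 4 * ε by linarith)
  have h4' := mul_le_mul_of_nonneg_left h2' (show 0 ≤ 1 + 4 * ε by linarith)
  rw [mul_add] at h3'
  rw [pow_two, mul_assoc]
  linarith

/-- The tours fixed in advance are paid for by the locations they serve, up to the points close to
the origin. -/
theorem lengthOf_D_le (h : IsPlan ε k n m J L pt ring key D sc) (V : List (List ℕ))
    (hV : ∀ i < n, ∃ t ∈ V, i ∈ t) {j : ℕ} (hj : j < m) :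
    lengthOf pt D ≤ ε * lengthOf pt V + ∑ b ∈ (Finset.range (J + m)).filter (fun b => b % m = j),
      (1 + 4 * ε) * ∑ a ∈ (blockPoints n m J ring b).image key, peelCount J ring key D a *
        (2 * ‖locPoint n J pt ring key a‖) := by
  obtain ⟨η, hη, hηk, hnear⟩ := h.near_locPoint
  have hε := h.eps_pos
  obtain ⟨i₀, hi₀, hfar⟩ := h.far
  set ρ := locPoint n J pt ring key with hρ
  have hn : (0 : ℝ) < n := by exact_mod_cast (by omega : 0 < n)
  set B := (Finset.range (J + m)).filter (fun b => b % m = j) with hB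
  -- A bound for a single tour to a point of ring `J`; `n` such bounds amount to `ε` times a tour to
  -- the far point `i₀`.
  set c := 2 * ε * ‖pt i₀‖ / n with hc
  have hc0 : 0 ≤ c := by positivity
  have key1 : ∀ t ∈ D, closedLength (t.map pt) ≤ c + ∑ b ∈ B, (1 + 4 * ε) *
      ∑ a ∈ (blockPoints n m J ring b).image key,
        if t.any (fun i => ring i < J ∧ key i = a) then 2 * ‖ρ a‖ else 0 := by
    intro t ht
    have hpos : ∀ b ∈ B, 0 ≤ (1 + 4 * ε) * ∑ a ∈ (blockPoints n m J ring b).image key,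
        if t.any (fun i => ring i < J ∧ key i = a) then 2 * ‖ρ a‖ else 0 := by
      intro b _
      refine mul_nonneg (by linarith) (Finset.sum_nonneg fun a _ => ?_)
      split_ifs <;> positivity
    rcases h.D_tour t ht with ⟨i, hi, hiJ, rfl⟩ | ⟨h1, h2, a, h3, -⟩
    · have h1 : closedLength ([i].map pt) ≤ c := by
        rw [List.map_singleton, closedLength_singleton, hc, le_div_iff₀ hn]
        linarith [hfar i hi hiJ]
      linarith [Finset.sum_nonneg hpos]
    · have hne : t ≠ [] := by
        rintro rfl
        have := h.k_pos
        simp at h1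
        omega
      obtain ⟨i, hi⟩ := List.exists_mem_of_ne_nil t hne
      obtain ⟨hin, hiJ⟩ := h2 i hi
      have hia := h3 i hi
      -- A full tour is charged to its location within the one block of the class that contains it.
      have hbB : blockOf m j (ring i) ∈ B := by
        refine Finset.mem_filter.2 ⟨Finset.mem_range.2 ?_, blockOf_mod hj _⟩
        have := blockOf_lt hj (ring i)
        omega
      have hab : a ∈ (blockPoints n m J ring (blockOf m j (ring i))).image key :=
        Finset.mem_image.2 ⟨i, mem_blockPoints.2 ⟨hin, hiJ, le_blockOf _ _ _, blockOf_lt hj _⟩, hia⟩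
      have e1 : closedLength (t.map pt) ≤ (1 + 4 * ε) * (2 * ‖ρ a‖) := by
        have := closedLength_map_near pt (fun i => ρ (key i)) t hη h1.le
          (fun i hi => (hnear i (h2 i hi).1 (h2 i hi).2).1)
        have e2 := closedLength_flatMap_le ρ key (fun _ => t) [a] (by
          intro a' ha' i hi
          rw [List.mem_singleton.1 ha']
          exact h3 i hi)
        rw [List.map_singleton, closedLength_singleton] at e2
        simp only [List.flatMap_cons, List.flatMap_nil, List.append_nil] at e2
        have e3 := closedLength_nonneg (t.map fun i => ρ (key i))
        calc _ ≤ _ := this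
          _ ≤ (1 + 4 * ε) * closedLength (t.map fun i => ρ (key i)) :=
            mul_le_mul_of_nonneg_right (by linarith) e3
          _ ≤ _ := mul_le_mul_of_nonneg_left e2 (by linarith)
      have e2 := Finset.single_le_sum hpos hbB
      have e3 := Finset.single_le_sum (s := (blockPoints n m J ring (blockOf m j (ring i))).image key)
        (f := fun a => if t.any (fun i => ring i < J ∧ key i = a) then 2 * ‖ρ a‖ else 0)
        (fun a _ => by split_ifs <;> positivity) hab
      have e4 : t.any (fun i => ring i < J ∧ key i = a) = true := by
        rw [List.any_eq_true]
        exact ⟨i, hi, by simpa using ⟨hiJ, hia⟩⟩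
      rw [if_pos e4] at e3
      have e5 := mul_le_mul_of_nonneg_left e3 (show 0 ≤ 1 + 4 * ε by linarith)
      linarith
  -- Fixed tours are disjoint and nonempty.
  have hlen : D.length ≤ n := by
    have h1 : D.length ≤ D.flatten.length := by
      rw [List.length_flatten]
      have := List.card_nsmul_le_sum (D.map List.length) 1 (by
        intro x hx
        obtain ⟨t, ht, rfl⟩ := List.mem_map.1 hx
        rcases h.D_tour t ht with ⟨i, hi, hiJ, rfl⟩ | ⟨h1, -⟩
        · simp
        · rw [h1]; exact h.k_pos)
      simpa using this
    refine h1.trans ?_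
    rw [← List.toFinset_card_of_nodup h.D_nodup, ← Finset.card_range n]
    refine Finset.card_le_card fun i hi => ?_
    obtain ⟨t, ht, hit⟩ := List.mem_flatten.1 (List.mem_toFinset.1 hi)
    exact Finset.mem_range.2 (h.lt_of_mem_D ht hit)
  have hR : 2 * ‖pt i₀‖ ≤ lengthOf pt V := by
    obtain ⟨t, ht, hit⟩ := hV i₀ hi₀
    exact (two_norm_le_closedLength (List.mem_map_of_mem hit)).trans (length_le_lengthOf pt ht)
  have hsum := List.sum_le_sum key1
  rw [List.sum_map_add, List.map_const', List.sum_replicate, nsmul_eq_mul,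
    ← finsetSum_listSum_comm] at hsum
  have h5 : (D.length : ℝ) * c ≤ ε * lengthOf pt V := by
    have : (D.length : ℝ) ≤ n := by exact_mod_cast hlen
    calc (D.length : ℝ) * c ≤ n * c := mul_le_mul_of_nonneg_right this hc0
      _ = ε * (2 * ‖pt i₀‖) := by rw [hc]; field_simp
      _ ≤ _ := mul_le_mul_of_nonneg_left hR hε.le
  refine hsum.trans (add_le_add h5 (le_of_eq (Finset.sum_congr rfl fun b _ => ?_)))
  rw [List.sum_map_mul_left, ← finsetSum_listSum_comm]
  congr 1
  refine Finset.sum_congr rfl fun a _ => ?_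
  rw [sum_map_ite]
  rfl

/-- The fixed tours do not depend on the class, so the cheapest class may be compared with the one
from `exists_shift`. There `opt_block_le` bounds the optimum of a block plus its savings `S b`, and
`lengthOf_D_le` shows that the savings of all blocks pay for `D` up to `ε` times the length of `V`.
-/
theorem approx (h : IsPlan ε k n m J L pt ring key D sc) {P : List Plane} (hP : P.length = n)
    (hpt : ∀ i < n, P.getD i 0 = pt i) {Us : List (List (List ℕ))}
    (hUs : ∀ b < J + m, IsApproxCover (1 + ε) k ((keptList n m ring D b).map (sc b)) (Us.getD b []))
    {j : ℕ} (hj : j < m) (hmin : ∀ j' < m, lengthOf pt (pulledTours n m (J + m) ring D Us j) ≤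
      lengthOf pt (pulledTours n m (J + m) ring D Us j')) :
    IsApproxCover (1 + 40000 * ε) k P (D ++ pulledTours n m (J + m) ring D Us j) := by
  have hcov := h.isTourCover hP (fun b hb => (hUs b hb).1) hj
  refine ⟨hcov, ?_⟩
  have hε := h.eps_pos
  have hε2 := h.eps_le
  refine le_mul_opt h.k_pos (by linarith) fun V hV => ?_
  have hVn : ∀ t ∈ V, ∀ i ∈ t, i < n := fun t ht i hi => hP ▸ hV.index_lt t ht i hi
  have hVc : ∀ i < n, ∃ t ∈ V, i ∈ t := fun i hi => hV.covers i (by omega)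
  rw [coverLength_eq, coverLength_eq, lengthOf_congr (g := pt) (U := V)
    (fun t ht i hi => hpt i (hVn t ht i hi)), lengthOf_congr (g := pt)
    (fun t ht i hi => hpt i (hP ▸ hcov.index_lt t ht i hi)), lengthOf_append]
  obtain ⟨j', hj', hshift⟩ := h.exists_shift V hVn
  have hD := h.lengthOf_D_le V hVc hj'
  have hmin := hmin j' hj'
  obtain ⟨η, hη, hηk, hnear⟩ := h.near_locPoint
  set S : ℕ → ℝ := fun b => (1 + 4 * ε) * ∑ a ∈ (blockPoints n m J ring b).image key,
    peelCount J ring key D a * (2 * ‖locPoint n J pt ring key a‖) with hS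
  have hS0 : ∀ b, 0 ≤ S b := fun b =>
    mul_nonneg (by linarith) (Finset.sum_nonneg fun a _ => by positivity)
  set F := (Finset.range (J + m)).filter (fun b => b % m = j') with hF
  have hpull : lengthOf pt (pulledTours n m (J + m) ring D Us j') ≤
      ∑ b ∈ F, (1 + 4 * ε) * ((1 + ε) * opt k ((keptList n m ring D b).map (sc b))) := by
    have e : lengthOf pt (pulledTours n m (J + m) ring D Us j') = ∑ b ∈ F,
        lengthOf pt ((Us.getD b []).map (List.map fun p => (keptList n m ring D b).getD p 0)) := by
      have hl : ∀ l : List ℕ, lengthOf pt (l.flatMap fun b => (Us.getD b []).map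
          (List.map fun p => (keptList n m ring D b).getD p 0)) = (l.map fun b => lengthOf pt
          ((Us.getD b []).map (List.map fun p => (keptList n m ring D b).getD p 0))).sum := by
        intro l
        induction l with
        | nil => simp [lengthOf]
        | cons b l ih => rw [List.flatMap_cons, lengthOf_append, ih]; simp
      rw [pulledTours, hl, ← List.sum_toFinset _ (List.nodup_range.filter _)]
      refine Finset.sum_congr ?_ fun _ _ => rfl
      ext b
      simp [hF]
    rw [e]
    refine Finset.sum_le_sum fun b hb => ?_
    have hb := Finset.mem_range.1 (Finset.mem_filter.1 hb).1
    obtain ⟨hc, hlen⟩ := hUs b hb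
    rw [lengthOf_map_map]
    have h1 := lengthOf_near (fun p => pt ((keptList n m ring D b).getD p 0))
      (fun p => ((keptList n m ring D b).map (sc b)).getD p 0) (Us.getD b []) (k := k) hη (by
        intro t ht
        refine ⟨hc.length_le t ht, fun p hp => ?_⟩
        have hlt := hc.index_lt t ht p hp
        rw [List.length_map] at hlt
        rw [List.getD_eq_getElem _ _ hlt, List.getD_eq_getElem _ _ (by simpa using hlt),
          List.getElem_map]
        have hm := mem_keptList.1 (List.getElem_mem hlt)
        exact ((hnear _ hm.1 (h.ring_lt hm.1 hm.2.1)).2.2 b).2)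
    have h2 := lengthOf_nonneg (fun p => ((keptList n m ring D b).map (sc b)).getD p 0) (Us.getD b [])
    calc _ ≤ _ := h1
      _ ≤ (1 + 4 * ε) * coverLength ((keptList n m ring D b).map (sc b)) (Us.getD b []) :=
        mul_le_mul_of_nonneg_right (by linarith) h2
      _ ≤ _ := mul_le_mul_of_nonneg_left hlen (by linarith)
  have hblock := fun b => h.opt_block_le V hV.length_le hVn hVc b
  have htotal : ∑ b ∈ F, (1 + 4 * ε) * ((1 + ε) * opt k ((keptList n m ring D b).map (sc b))) +
      ∑ b ∈ F, S b ≤ (1 + 4 * ε) * (1 + ε) * ((1 + 4 * ε) ^ 2 * ((1 + 10 * ε) * lengthOf pt V)) := by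
    rw [← Finset.sum_add_distrib]
    calc _ ≤ ∑ b ∈ F, (1 + 4 * ε) * (1 + ε) *
          ((1 + 4 * ε) ^ 2 * lengthOf pt (blockTours m J ring V b)) := by
          refine Finset.sum_le_sum fun b _ => ?_
          -- The savings enter with coefficient 1 on the left, while `hblock` is multiplied by this
          -- larger factor.
          have h1 : 1 ≤ (1 + 4 * ε) * (1 + ε) := by nlinarith
          have h2 := mul_le_mul_of_nonneg_left (hblock b) (zero_le_one.trans h1)
          have h3 := mul_le_mul_of_nonneg_right h1 (hS0 b)
          simp only [hS] at h3 ⊢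
          linarith
      _ = (1 + 4 * ε) * (1 + ε) * ((1 + 4 * ε) ^ 2 *
          ∑ b ∈ F, lengthOf pt (blockTours m J ring V b)) := by
          rw [Finset.mul_sum, Finset.mul_sum]
      _ ≤ _ := by
          refine mul_le_mul_of_nonneg_left (mul_le_mul_of_nonneg_left hshift (by positivity))
            (by positivity)
  have hV0 := lengthOf_nonneg pt V
  -- As powers of `ε` are at most `ε`, only the sum of the coefficients matters, and it is far below
  -- 40000.
  have hnum : (1 + 4 * ε) * (1 + ε) * ((1 + 4 * ε) ^ 2 * (1 + 10 * ε)) + ε ≤ 1 + 40000 * ε := by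
    have e1 : ε ^ 2 ≤ ε := by nlinarith
    have e2 : ε ^ 3 ≤ ε := by nlinarith [pow_pos hε 2]
    have e3 : ε ^ 4 ≤ ε := by nlinarith [pow_pos hε 3]
    have e4 : ε ^ 5 ≤ ε := by nlinarith [pow_pos hε 4]
    nlinarith
  have := mul_le_mul_of_nonneg_right hnum hV0
  nlinarith

end IsPlan

end Plan

end TourCover


namespace TourCover

/-! ## Rings, locations and positions of points -/

/-- Parameters: rings consist of `w` octaves, blocks of `m` rings, there are `J` rings below the
maximal distance `R` from the origin, and positions have `h` binary digits. -/
structure Params where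
  w : ℕ
  m : ℕ
  J : ℕ
  h : ℕ
  R : ℝ

/-- Shifts one binary digit of the fraction `x.1` to the end of the number `x.2`. A comparison with
1 replaces rounding. The fraction may equal 1, in which case all digits are 1. -/
noncomputable def digitStep (x : ℝ × ℕ) : ℝ × ℕ :=
  if x.1 + x.1 < 1 then (x.1 + x.1, x.2 + x.2) else (x.1 + x.1 - 1, x.2 + x.2 + 1)

/-- Appending `h` binary digits of `v` to `c`. -/
theorem digitStep_iterate (h : ℕ) : ∀ (v : ℝ) (c : ℕ), 0 ≤ v → v ≤ 1 →
    ∃ a < 2 ^ h, (digitStep^[h] (v, c)).2 = 2 ^ h * c + a ∧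
      2 ^ h * v = a + (digitStep^[h] (v, c)).1 ∧
      0 ≤ (digitStep^[h] (v, c)).1 ∧ (digitStep^[h] (v, c)).1 ≤ 1 := by
  induction h with
  | zero => intro v c h0 h1; exact ⟨0, by simp, by simp, by simp, by simpa, by simpa⟩
  | succ h ih =>
    intro v c h0 h1
    obtain ⟨a, ha, e1, e2, e3, e4⟩ := ih v c h0 h1
    rw [Function.iterate_succ_apply']
    set x := digitStep^[h] (v, c) with hx
    unfold digitStep
    split_ifs with hlt
    · refine ⟨2 * a, by rw [pow_succ]; omega, by simp only [e1]; ring, ?_, by simp only; linarith,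
        by simp only; linarith⟩
      push_cast; rw [pow_succ]; linarith
    · refine ⟨2 * a + 1, by rw [pow_succ]; omega, by simp only [e1]; ring, ?_, by simp only; linarith,
        by simp only; linarith⟩
      push_cast; rw [pow_succ]; linarith

/-- The sector of the point among the four cut out by the diagonals of the coordinate system. -/
noncomputable def sideOf (p : Plane) : ℕ :=
  if p 0 * p 0 < p 1 * p 1 then (if p 1 < 0 then 3 else 2) else if p 0 < 0 then 1 else 0

/-- Within a sector, the coordinate of smaller modulus of the unit vector determines the direction,
with a Lipschitz bound. It is mapped affinely to `[0, 1]` so that binary digits can be taken. -/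
noncomputable def slopeOf (p : Plane) : ℝ :=
  if p 0 * p 0 < p 1 * p 1 then (p 0 / ‖p‖ + 1) / 2 else (p 1 / ‖p‖ + 1) / 2

/-- For `0 < v ≤ 1` the number of doublings that bring `v` into `(1/2, 1]`. -/
noncomputable def octOf (v : ℝ) : ℕ := sInf {u | 1 < v * 2 ^ u + v * 2 ^ u}

namespace Params

noncomputable def W (q : Params) : ℝ := 2 ^ q.w

noncomputable def H (q : Params) : ℝ := 2 ^ q.h

/-- Ring `r` consists of the distances between `R / W ^ (r + 1)`, excluded, and `R / W ^ r`. The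
alternative `r = q.J` keeps the set nonempty and collects everything closer to the origin in ring
`J`. -/
noncomputable def ring (q : Params) (p : Plane) : ℕ :=
  sInf {r | r = q.J ∨ 1 < ‖p‖ / q.R * q.W ^ r * q.W}

/-- The distance from the origin relative to the outer radius of the ring. -/
noncomputable def inRing (q : Params) (p : Plane) : ℝ := ‖p‖ / q.R * q.W ^ q.ring p

/-- The distance from the origin relative to the outer radius of the octave. -/
noncomputable def inOct (q : Params) (p : Plane) : ℝ := q.inRing p * 2 ^ octOf (q.inRing p)

noncomputable def oct (q : Params) (p : Plane) : ℕ := q.ring p * q.w + octOf (q.inRing p)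

noncomputable def radial (q : Params) (p : Plane) : ℝ × ℕ := digitStep^[q.h] (q.inOct p, q.oct p)

/-- A concatenation of the octave, `h` radial digits, two bits for the sector and `h + 1` digits of
the slope. The factor 4 is written with additions because the machine does not multiply natural
numbers. -/
noncomputable def key (q : Params) (p : Plane) : ℕ :=
  (digitStep^[q.h + 1] (slopeOf p,
    (q.radial p).2 + (q.radial p).2 + ((q.radial p).2 + (q.radial p).2) + sideOf p)).2

/-- Let `a` be the number formed by the radial digits. Then scaling `p` by `alpha + beta * θ` puts
it at radius `(a + θ) / H` of its octave. The numbers `θ = 1 / (b + 2)` lie strictly between 0 and 1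
and differ from block to block. The two coefficients serve all blocks. -/
noncomputable def alpha (q : Params) (p : Plane) : ℝ :=
  (q.inOct p - (q.radial p).1 / q.H) / q.inOct p

noncomputable def beta (q : Params) (p : Plane) : ℝ := 1 / q.H / q.inOct p

/-- The position of `p` in the instance of the block `b`. -/
noncomputable def place (q : Params) (b : ℕ) (p : Plane) : Plane :=
  (q.alpha p + q.beta p / ((b + 2 : ℕ) : ℝ)) • p

/-- Bound for the number of locations in a block. -/
def numLoc (q : Params) : ℕ := q.m * q.w * 2 ^ (2 * q.h + 3)

/-- One inequality for each error term: `W_eps` for splitting between rings, `m_eps` for averaging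
over the classes, `J_eps` for the points near the origin, `h_eps` for the displacement within
locations. -/
structure Valid (q : Params) (ε : ℝ) (k n : ℕ) : Prop where
  eps_pos : 0 < ε
  eps_le : ε ≤ 1 / 2
  k_pos : 1 ≤ k
  n_pos : 1 ≤ n
  R_pos : 0 < q.R
  w_pos : 1 ≤ q.w
  W_eps : 1 ≤ q.W * ε
  m_pos : 1 ≤ q.m
  m_eps : 1 ≤ q.m * ε
  J_eps : (n : ℝ) ≤ q.W ^ q.J * ε
  h_pos : 1 ≤ q.h
  h_eps : (k : ℝ) ≤ q.H * ε

end Params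

/-- From `c² - c'² = s'² - s²` one gets `|c - c'| |c + c'| = |s - s'| |s + s'|`. Since `c` and `c'`
have equal signs and dominate `s` and `s'`, moreover `|s + s'| ≤ |c + c'|`. -/
theorem abs_sub_le_of_unit {c s c' s' δ : ℝ} (h1 : c ^ 2 + s ^ 2 = 1) (h2 : c' ^ 2 + s' ^ 2 = 1)
    (h3 : s ^ 2 ≤ c ^ 2) (h4 : s' ^ 2 ≤ c' ^ 2) (h5 : 0 ≤ c * c') (h6 : |s - s'| ≤ δ) :
    |c - c'| ≤ δ := by
  have h7 : |s + s'| ≤ |c + c'| := by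
    have e1 : |s| ≤ |c| := sq_le_sq.1 h3
    have e2 : |s'| ≤ |c'| := sq_le_sq.1 h4
    have e3 : |c + c'| = |c| + |c'| := abs_add_eq_add_abs_iff c c' |>.2 (by
      rcases mul_nonneg_iff.1 h5 with h | h
      · exact Or.inl h
      · exact Or.inr h)
    rw [e3]
    exact (abs_add_le s s').trans (add_le_add e1 e2)
  have h8 : 0 < |c + c'| := by
    rw [abs_pos]
    intro h0
    have : c' = -c := by linarith
    subst this
    nlinarith
  have h9 : |c - c'| * |c + c'| = |s - s'| * |s + s'| := by
    rw [← abs_mul, ← abs_mul, ← abs_neg]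
    congr 1
    linarith
  have h10 : |c - c'| * |c + c'| ≤ δ * |c + c'| := by
    rw [h9]
    exact mul_le_mul h6 h7 (abs_nonneg _) ((abs_nonneg _).trans h6)
  exact le_of_mul_le_mul_right h10 h8

theorem norm_sq_eq (p : Plane) : ‖p‖ ^ 2 = p 0 ^ 2 + p 1 ^ 2 := by
  rw [EuclideanSpace.norm_sq_eq]
  simp

theorem norm_eq_sqrt (p : Plane) : ‖p‖ = Real.sqrt (p 0 * p 0 + p 1 * p 1) := by
  rw [← Real.sqrt_sq (norm_nonneg p), norm_sq_eq]
  congr 1; ring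

/-- Points with nearby directions. -/
theorem norm_unit_sub_le {x y : Plane} (hx : x ≠ 0) (hy : y ≠ 0) (hside : sideOf x = sideOf y)
    {δ : ℝ} (hslope : |slopeOf x - slopeOf y| ≤ δ / 2) :
    ‖(‖x‖⁻¹ • x - ‖y‖⁻¹ • y : Plane)‖ ≤ 2 * δ := by
  have hx' : 0 < ‖x‖ := norm_pos_iff.2 hx
  have hy' : 0 < ‖y‖ := norm_pos_iff.2 hy
  have unit : ∀ z : Plane, 0 < ‖z‖ → (z 0 / ‖z‖) ^ 2 + (z 1 / ‖z‖) ^ 2 = 1 := by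
    intro z hz
    rw [div_pow, div_pow, ← add_div, ← norm_sq_eq, div_self (by positivity)]
  have ux := unit x hx'
  have uy := unit y hy'
  have key : |x 0 / ‖x‖ - y 0 / ‖y‖| ≤ δ ∧ |x 1 / ‖x‖ - y 1 / ‖y‖| ≤ δ := by
    unfold sideOf at hside
    unfold slopeOf at hslope
    by_cases hxs : x 0 * x 0 < x 1 * x 1 <;> by_cases hys : y 0 * y 0 < y 1 * y 1
    · simp only [hxs, hys, if_true] at hside hslope
      have h1 : |x 0 / ‖x‖ - y 0 / ‖y‖| ≤ δ := by
        rw [abs_le] at hslope ⊢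
        constructor <;> linarith [hslope.1, hslope.2]
      refine ⟨h1, abs_sub_le_of_unit (by linarith) (by linarith) ?_ ?_ ?_ h1⟩
      · rw [div_pow, div_pow]; gcongr 1; nlinarith
      · rw [div_pow, div_pow]; gcongr 1; nlinarith
      · rw [div_mul_div_comm]
        refine div_nonneg ?_ (by positivity)
        by_cases e1 : x 1 < 0 <;> by_cases e2 : y 1 < 0
        · exact mul_nonneg_of_nonpos_of_nonpos e1.le e2.le
        · simp [e1, e2] at hside
        · simp [e1, e2] at hside
        · exact mul_nonneg (not_lt.1 e1) (not_lt.1 e2)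
    · simp only [hxs, hys, if_true, if_false] at hside
      split_ifs at hside <;> omega
    · simp only [hxs, hys, if_true, if_false] at hside
      split_ifs at hside <;> omega
    · simp only [hxs, hys, if_false] at hside hslope
      have h1 : |x 1 / ‖x‖ - y 1 / ‖y‖| ≤ δ := by
        rw [abs_le] at hslope ⊢
        constructor <;> linarith [hslope.1, hslope.2]
      refine ⟨abs_sub_le_of_unit ux uy ?_ ?_ ?_ h1, h1⟩
      · rw [div_pow, div_pow]; gcongr 1; nlinarith
      · rw [div_pow, div_pow]; gcongr 1; nlinarith
      · rw [div_mul_div_comm]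
        refine div_nonneg ?_ (by positivity)
        by_cases e1 : x 0 < 0 <;> by_cases e2 : y 0 < 0
        · exact mul_nonneg_of_nonpos_of_nonpos e1.le e2.le
        · simp [e1, e2] at hside
        · simp [e1, e2] at hside
        · exact mul_nonneg (not_lt.1 e1) (not_lt.1 e2)
  have hδ : 0 ≤ δ := (abs_nonneg _).trans key.1
  -- Both coordinates of the unit vectors differ by at most `δ`, and `2δ² ≤ (2δ)²`.
  refine le_of_sq_le_sq ?_ (by linarith)
  rw [norm_sq_eq]
  simp only [PiLp.sub_apply, PiLp.smul_apply, smul_eq_mul]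
  have e1 := sq_le_sq' (by linarith [(abs_le.1 key.1).1]) (abs_le.1 key.1).2
  have e2 := sq_le_sq' (by linarith [(abs_le.1 key.2).1]) (abs_le.1 key.2).2
  have f : ∀ (z : Plane) (i : Fin 2), ‖z‖⁻¹ * z i = z i / ‖z‖ := fun z i => by
    rw [div_eq_inv_mul]
  rw [f, f, f, f]
  nlinarith

/-- The difference splits into a radial part and a part due to the directions, each at most `2 δ
‖y‖`. -/
theorem dist_le_of_near {x y : Plane} (hx : x ≠ 0) (hy : y ≠ 0) (hside : sideOf x = sideOf y)
    {δ : ℝ} (hslope : |slopeOf x - slopeOf y| ≤ δ / 2) (hnorm : |‖x‖ - ‖y‖| ≤ 2 * δ * ‖y‖) :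
    dist x y ≤ 4 * δ * ‖y‖ := by
  have h := norm_unit_sub_le hx hy hside hslope
  have hx' : ‖x‖ ≠ 0 := norm_ne_zero_iff.2 hx
  have hy' : ‖y‖ ≠ 0 := norm_ne_zero_iff.2 hy
  have e : x - y = (‖x‖ - ‖y‖) • (‖x‖⁻¹ • x) + ‖y‖ • (‖x‖⁻¹ • x - ‖y‖⁻¹ • y) := by
    rw [sub_smul, smul_sub, smul_inv_smul₀ hx', smul_inv_smul₀ hy']
    abel
  rw [dist_eq_norm, e]
  refine (norm_add_le _ _).trans ?_
  rw [norm_smul, norm_smul, norm_smul, norm_inv, norm_norm, norm_norm, inv_mul_cancel₀ hx', mul_one,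
    Real.norm_eq_abs]
  have := mul_le_mul_of_nonneg_left h (norm_nonneg y)
  linarith

theorem sideOf_smul {c : ℝ} (hc : 0 < c) (p : Plane) : sideOf (c • p) = sideOf p := by
  have h1 : (c * p 0 * (c * p 0) < c * p 1 * (c * p 1)) ↔ p 0 * p 0 < p 1 * p 1 := by
    rw [show c * p 0 * (c * p 0) = c * c * (p 0 * p 0) by ring,
      show c * p 1 * (c * p 1) = c * c * (p 1 * p 1) by ring]
    exact mul_lt_mul_iff_right₀ (by positivity)
  have h2 : ∀ i, c * p i < 0 ↔ p i < 0 := fun i => by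
    constructor
    · intro h; by_contra h'; nlinarith [not_lt.1 h']
    · intro h; exact mul_neg_of_pos_of_neg hc h
  simp only [sideOf, PiLp.smul_apply, smul_eq_mul, h1, h2]

theorem slopeOf_smul {c : ℝ} (hc : 0 < c) (p : Plane) : slopeOf (c • p) = slopeOf p := by
  have h1 : (c * p 0 * (c * p 0) < c * p 1 * (c * p 1)) ↔ p 0 * p 0 < p 1 * p 1 := by
    rw [show c * p 0 * (c * p 0) = c * c * (p 0 * p 0) by ring,
      show c * p 1 * (c * p 1) = c * c * (p 1 * p 1) by ring]
    exact mul_lt_mul_iff_right₀ (by positivity)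
  have h2 : ∀ i, c * p i / (c * ‖p‖) = p i / ‖p‖ := fun i => mul_div_mul_left _ _ hc.ne'
  simp only [slopeOf, PiLp.smul_apply, smul_eq_mul, h1, norm_smul, Real.norm_eq_abs, abs_of_pos hc, h2]

theorem sideOf_lt (p : Plane) : sideOf p < 4 := by
  unfold sideOf; split_ifs <;> norm_num

theorem slopeOf_mem {p : Plane} : 0 ≤ slopeOf p ∧ slopeOf p ≤ 1 := by
  have h : ∀ i, |p i / ‖p‖| ≤ 1 := by
    intro i
    rw [abs_div, abs_norm]
    refine div_le_one_of_le₀ ?_ (norm_nonneg _)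
    simpa using PiLp.norm_apply_le p i
  have h0 := abs_le.1 (h 0)
  have h1 := abs_le.1 (h 1)
  unfold slopeOf
  split_ifs <;> constructor <;> linarith [h0.1, h0.2, h1.1, h1.2]

end TourCover


/-! ### Estimates for rings, keys and positions -/

namespace TourCover

theorem mul_add_inj {M x g x' g' : ℕ} (hg : g < M) (hg' : g' < M) (h : M * x + g = M * x' + g') :
    x = x' ∧ g = g' := by
  have h1 : (M * x + g) / M = x := by
    rw [Nat.mul_add_div (by omega), Nat.div_eq_of_lt hg, add_zero]
  have h2 : (M * x' + g') / M = x' := by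
    rw [Nat.mul_add_div (by omega), Nat.div_eq_of_lt hg', add_zero]
  have h3 : x = x' := by rw [← h1, ← h2, h]
  subst h3
  exact ⟨rfl, by omega⟩

namespace Params

variable {q : Params} {ε : ℝ} {k n : ℕ} {p p' : Plane}

theorem ring_le (q : Params) (p : Plane) : q.ring p ≤ q.J := Nat.sInf_le (Or.inl rfl)

theorem one_lt_of_ring_lt (h : q.ring p < q.J) : 1 < q.inRing p * q.W := by
  have : q.ring p ∈ {r | r = q.J ∨ 1 < ‖p‖ / q.R * q.W ^ r * q.W} := Nat.sInf_mem ⟨q.J, Or.inl rfl⟩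
  rcases this with h' | h'
  · omega
  · exact h'

theorem le_one_of_le_ring (hR : 0 < q.R) (hp : ‖p‖ ≤ q.R) {r : ℕ} (hr : r ≤ q.ring p) :
    ‖p‖ / q.R * q.W ^ r ≤ 1 := by
  cases r with
  | zero => simpa using div_le_one_of_le₀ hp hR.le
  | succ r =>
    have : r ∉ {r | r = q.J ∨ 1 < ‖p‖ / q.R * q.W ^ r * q.W} := Nat.notMem_of_lt_sInf hr
    have h2 : ¬ 1 < ‖p‖ / q.R * q.W ^ r * q.W := fun h => this (Or.inr h)
    rw [pow_succ, ← mul_assoc]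
    exact not_lt.1 h2

theorem W_pos (q : Params) : 0 < q.W := by unfold W; positivity

theorem H_pos (q : Params) : 0 < q.H := by unfold H; positivity

theorem inRing_le (hR : 0 < q.R) (hp : ‖p‖ ≤ q.R) : q.inRing p ≤ 1 :=
  le_one_of_le_ring hR hp le_rfl

theorem octOf_mem {v : ℝ} {w : ℕ} (hw : 1 ≤ w) (h : 1 < v * 2 ^ w) :
    w - 1 ∈ {u | 1 < v * 2 ^ u + v * 2 ^ u} := by
  obtain ⟨w, rfl⟩ : ∃ w', w = w' + 1 := ⟨w - 1, by omega⟩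
  rw [pow_succ] at h
  simp only [Nat.add_sub_cancel, Set.mem_ofPred_eq]
  linarith

theorem octOf_lt {v : ℝ} {w : ℕ} (hw : 1 ≤ w) (h : 1 < v * 2 ^ w) : octOf v < w :=
  lt_of_le_of_lt (Nat.sInf_le (octOf_mem hw h)) (by omega)

theorem one_lt_octOf {v : ℝ} {w : ℕ} (hw : 1 ≤ w) (h : 1 < v * 2 ^ w) :
    1 < v * 2 ^ octOf v + v * 2 ^ octOf v :=
  Nat.sInf_mem ⟨w - 1, octOf_mem hw h⟩

theorem octOf_le_one {v : ℝ} (hv : v ≤ 1) : v * 2 ^ octOf v ≤ 1 := by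
  rcases Nat.eq_zero_or_pos (octOf v) with h | h
  · rw [h]; simpa
  · have : octOf v - 1 ∉ {u | 1 < v * 2 ^ u + v * 2 ^ u} :=
      Nat.notMem_of_lt_sInf (Nat.sub_lt h Nat.one_pos)
    obtain ⟨u, hu⟩ : ∃ u, octOf v = u + 1 := ⟨octOf v - 1, by omega⟩
    rw [hu] at this ⊢
    simp only [Nat.add_sub_cancel, Set.mem_ofPred_eq, not_lt] at this
    rw [pow_succ]
    linarith

theorem oct_lt (hw : 1 ≤ q.w) (hr : q.ring p < q.J) : octOf (q.inRing p) < q.w :=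
  octOf_lt hw (one_lt_of_ring_lt hr)

theorem inOct_gt (hw : 1 ≤ q.w) (hr : q.ring p < q.J) : 1 / 2 < q.inOct p := by
  have := one_lt_octOf hw (one_lt_of_ring_lt hr)
  unfold inOct
  linarith

theorem inOct_le (hR : 0 < q.R) (hp : ‖p‖ ≤ q.R) : q.inOct p ≤ 1 := octOf_le_one (inRing_le hR hp)

theorem norm_eq_inOct (hR : 0 < q.R) : ‖p‖ = q.R / 2 ^ q.oct p * q.inOct p := by
  have hR' := hR.ne'
  have h : q.inRing p = ‖p‖ / q.R * 2 ^ (q.w * q.ring p) := by rw [inRing, W, ← pow_mul]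
  rw [inOct, oct, pow_add, mul_comm (q.ring p) q.w]
  set u := octOf (q.inRing p)
  rw [h]
  field_simp

theorem oct_div (hw : 1 ≤ q.w) (hr : q.ring p < q.J) : q.oct p / q.w = q.ring p := by
  unfold oct
  rw [mul_comm, Nat.mul_add_div (by omega), Nat.div_eq_of_lt (oct_lt hw hr), add_zero]

/-- The radial digits. -/
theorem exists_radial (hv : q.Valid ε k n) (hp : ‖p‖ ≤ q.R) (hr : q.ring p < q.J) :
    ∃ a : ℕ, a < 2 ^ q.h ∧ 2 ^ q.h ≤ 2 * a ∧ (q.radial p).2 = 2 ^ q.h * q.oct p + a ∧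
      q.H * q.inOct p = a + (q.radial p).1 ∧ 0 ≤ (q.radial p).1 ∧ (q.radial p).1 ≤ 1 := by
  have h1 := inOct_gt hv.w_pos hr
  have h2 := inOct_le hv.R_pos hp
  obtain ⟨a, ha, e1, e2, e3, e4⟩ := digitStep_iterate q.h (q.inOct p) (q.oct p) (by linarith) h2
  refine ⟨a, ha, ?_, e1, e2, e3, e4⟩
  -- As `2 ^ q.h` is even for `q.h ≥ 1`, the strict bound `2 ^ q.h < 2 * (a + 1)` improves to `2 ^
  -- q.h ≤ 2 * a`: the leading digit is 1.
  obtain ⟨h, hh⟩ : ∃ h, q.h = h + 1 := ⟨q.h - 1, by have := hv.h_pos; omega⟩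
  have h3 : (2 : ℝ) ^ q.h < 2 * (a + 1) := by
    have : (2 : ℝ) ^ q.h * (1 / 2) < 2 ^ q.h * q.inOct p := mul_lt_mul_of_pos_left h1 (by positivity)
    linarith
  have h4 : 2 ^ q.h < 2 * (a + 1) := by exact_mod_cast h3
  rw [hh, pow_succ] at h4 ⊢
  omega

theorem exists_key (q : Params) (p : Plane) : ∃ (g : ℕ) (r : ℝ), g < 2 ^ (q.h + 1) ∧
    q.key p = 2 ^ (q.h + 1) * (4 * (q.radial p).2 + sideOf p) + g ∧
    2 ^ (q.h + 1) * slopeOf p = g + r ∧ 0 ≤ r ∧ r ≤ 1 := by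
  obtain ⟨a, ha, e1, e2, e3, e4⟩ := digitStep_iterate (q.h + 1) (slopeOf p)
    ((q.radial p).2 + (q.radial p).2 + ((q.radial p).2 + (q.radial p).2) + sideOf p)
    slopeOf_mem.1 slopeOf_mem.2
  refine ⟨a, _, ha, ?_, e2, e3, e4⟩
  rw [key, e1]
  ring

/-- All fields of the key after the octave have bounded range, so equal keys agree field by field.
Equal `h + 1` digits leave a difference of at most `2 ^ -(h + 1)` between the slopes. -/
theorem eq_of_key_eq (hv : q.Valid ε k n) (hp : ‖p‖ ≤ q.R) (hr : q.ring p < q.J)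
    (hp' : ‖p'‖ ≤ q.R) (hr' : q.ring p' < q.J) (hk : q.key p = q.key p') :
    q.oct p = q.oct p' ∧ (q.radial p).2 = (q.radial p').2 ∧ sideOf p = sideOf p' ∧
      |slopeOf p - slopeOf p'| ≤ 1 / q.H / 2 := by
  obtain ⟨g, r, hg, e1, e2, e3, e4⟩ := q.exists_key p
  obtain ⟨g', r', hg', e1', e2', e3', e4'⟩ := q.exists_key p'
  obtain ⟨a, ha, -, f1, -⟩ := exists_radial hv hp hr
  obtain ⟨a', ha', -, f1', -⟩ := exists_radial hv hp' hr'
  rw [e1, e1'] at hk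
  obtain ⟨h1, h2⟩ := mul_add_inj hg hg' hk
  obtain ⟨h3, h4⟩ := mul_add_inj (sideOf_lt p) (sideOf_lt p') h1
  have h5 := h3
  rw [f1, f1'] at h5
  refine ⟨(mul_add_inj ha ha' h5).1, h3, h4, ?_⟩
  subst h2
  have hH : (0 : ℝ) < 2 ^ (q.h + 1) := by positivity
  have : (1 / q.H / 2) = 1 / 2 ^ (q.h + 1) := by unfold H; rw [pow_succ]; field_simp
  rw [this, abs_le]
  constructor
  · rw [neg_le_iff_add_nonneg, ← mul_nonneg_iff_of_pos_left hH]
    field_simp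
    linarith
  · rw [le_div_iff₀ hH]
    linarith

/-- Below the octave there are `h` radial digits, 2 bits for the sector and `h + 1` slope digits,
together `2 h + 3` bits. -/
theorem key_div (hv : q.Valid ε k n) (hp : ‖p‖ ≤ q.R) (hr : q.ring p < q.J) :
    q.key p / 2 ^ (2 * q.h + 3) = q.oct p := by
  obtain ⟨g, r, hg, e1, -⟩ := q.exists_key p
  obtain ⟨a, ha, -, f1, -⟩ := exists_radial hv hp hr
  have hs := sideOf_lt p
  have e : q.key p = 2 ^ (2 * q.h + 3) * q.oct p + (2 ^ (q.h + 1) * (4 * a + sideOf p) + g) := by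
    rw [e1, f1]; ring
  have hlt : 2 ^ (q.h + 1) * (4 * a + sideOf p) + g < 2 ^ (2 * q.h + 3) := by
    have h1 : 4 * a + sideOf p + 1 ≤ 4 * 2 ^ q.h := by omega
    have h2 := Nat.mul_le_mul_left (2 ^ (q.h + 1)) h1
    have h3 : 2 ^ (q.h + 1) * (4 * 2 ^ q.h) = 2 ^ (2 * q.h + 3) := by ring
    rw [h3, mul_add, mul_one] at h2
    omega
  rw [e, Nat.mul_add_div (by positivity), Nat.div_eq_of_lt hlt, add_zero]

/-- Positions in the instance of a block: same direction, and a norm determined by the octave, the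
radial digits and the block. -/
theorem place_spec (hv : q.Valid ε k n) (hp : ‖p‖ ≤ q.R) (hr : q.ring p < q.J)
    (b : ℕ) : ∃ (a : ℕ) (c : ℝ), 0 < c ∧ q.place b p = c • p ∧ a < 2 ^ q.h ∧ 2 ^ q.h ≤ 2 * a ∧
      (q.radial p).2 = 2 ^ q.h * q.oct p + a ∧
      ‖q.place b p‖ = q.R / 2 ^ q.oct p * ((a + 1 / ((b + 2 : ℕ) : ℝ)) / q.H) ∧
      q.R / 2 ^ q.oct p * (a / q.H) ≤ ‖p‖ ∧ ‖p‖ ≤ q.R / 2 ^ q.oct p * ((a + 1) / q.H) := by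
  obtain ⟨a, ha, ha2, e1, e2, e3, e4⟩ := exists_radial hv hp hr
  have hH := q.H_pos
  have hO : 0 < q.inOct p := by linarith [inOct_gt hv.w_pos hr]
  have hb : (0 : ℝ) < ((b + 2 : ℕ) : ℝ) := by positivity
  have hc : q.alpha p + q.beta p / ((b + 2 : ℕ) : ℝ) =
      (a + 1 / ((b + 2 : ℕ) : ℝ)) / q.H / q.inOct p := by
    have : q.inOct p = (a + (q.radial p).1) / q.H := by rw [← e2]; field_simp
    unfold alpha beta
    nth_rewrite 1 [this]
    field_simp
    ring
  have hcpos : 0 < q.alpha p + q.beta p / ((b + 2 : ℕ) : ℝ) := by rw [hc]; positivity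
  have hn := norm_eq_inOct (p := p) hv.R_pos
  have hR2 : 0 < q.R / 2 ^ q.oct p := div_pos hv.R_pos (by positivity)
  refine ⟨a, _, hcpos, rfl, ha, ha2, e1, ?_, ?_, ?_⟩
  · rw [place, norm_smul, Real.norm_eq_abs, abs_of_pos hcpos, hc]
    rw [hn]
    field_simp
  · rw [hn]
    refine mul_le_mul_of_nonneg_left ?_ hR2.le
    rw [div_le_iff₀ hH]; linarith
  · rw [hn]
    refine mul_le_mul_of_nonneg_left ?_ hR2.le
    rw [le_div_iff₀ hH]; linarith

theorem theta_lt (b : ℕ) : 1 / ((b + 2 : ℕ) : ℝ) < 1 := by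
  rw [div_lt_one (by positivity)]
  exact_mod_cast (by omega : 1 < b + 2)

/-- Positions stay strictly inside their octave, because `2 ^ h ≤ 2 a`, `a + 1 ≤ 2 ^ h` and the
offset is strictly between 0 and 1. -/
theorem place_bounds (hv : q.Valid ε k n) (hp : ‖p‖ ≤ q.R) (hr : q.ring p < q.J)
    (b : ℕ) : q.R / 2 ^ q.oct p / 2 < ‖q.place b p‖ ∧ ‖q.place b p‖ < q.R / 2 ^ q.oct p := by
  obtain ⟨a, c, -, -, ha, ha2, -, hn, -⟩ := place_spec hv hp hr b
  have hR2 : 0 < q.R / 2 ^ q.oct p := div_pos hv.R_pos (by positivity)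
  have h1 := theta_lt b
  have h0 : 0 < 1 / ((b + 2 : ℕ) : ℝ) := by positivity
  have h2 : (a : ℝ) + 1 ≤ q.H := by unfold H; exact_mod_cast ha
  have h3 : q.H ≤ 2 * a := by unfold H; exact_mod_cast ha2
  rw [hn]
  constructor
  · rw [div_eq_mul_one_div]
    refine mul_lt_mul_of_pos_left ?_ hR2
    rw [div_lt_div_iff₀ two_pos q.H_pos]
    linarith
  · refine mul_lt_of_lt_one_right hR2 ?_
    rw [div_lt_one q.H_pos]
    linarith

theorem norm_gt (hv : q.Valid ε k n) (hr : q.ring p < q.J) : q.R / 2 ^ q.oct p / 2 < ‖p‖ := by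
  rw [norm_eq_inOct (p := p) hv.R_pos, div_eq_mul_one_div]
  exact mul_lt_mul_of_pos_left (inOct_gt hv.w_pos hr) (div_pos hv.R_pos (by positivity))

theorem place_ne_zero (hv : q.Valid ε k n) (hp0 : p ≠ 0) (hp : ‖p‖ ≤ q.R) (hr : q.ring p < q.J)
    (b : ℕ) : q.place b p ≠ 0 := by
  obtain ⟨a, c, hc, e, -⟩ := place_spec hv hp hr b
  rw [e]
  exact smul_ne_zero hc.ne' hp0

/-- All points involved share the sector, have slopes within `1 / (2 H)`, and have norms in one
interval of length `s / H`, where `s` is the outer radius of the octave. Their norms exceed `s / 2`,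
so `dist_le_of_near` applies with `δ = 1 / H`. -/
theorem near_of_key_eq (hv : q.Valid ε k n) (hp0 : p ≠ 0) (hp : ‖p‖ ≤ q.R) (hr : q.ring p < q.J)
    (hp0' : p' ≠ 0) (hp' : ‖p'‖ ≤ q.R) (hr' : q.ring p' < q.J) (hk : q.key p = q.key p') (b : ℕ) :
    dist p p' ≤ 4 * (1 / q.H) * ‖p'‖ ∧ dist (q.place b p) p' ≤ 4 * (1 / q.H) * ‖p'‖ ∧
      dist p' (q.place b p) ≤ 4 * (1 / q.H) * ‖q.place b p‖ := by
  obtain ⟨h1, h2, h3, h4⟩ := eq_of_key_eq hv hp hr hp' hr' hk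
  obtain ⟨a, c, hc, ec, ha, -, e1, e2, e3, e4⟩ := place_spec hv hp hr b
  obtain ⟨a', c', -, -, ha', -, e1', -, e3', e4'⟩ := place_spec hv hp' hr' b
  have haa : a = a' := by
    rw [e1, e1'] at h2
    exact (mul_add_inj ha ha' h2).2
  subst haa
  have hb := theta_lt b
  have hb0 : 0 < 1 / ((b + 2 : ℕ) : ℝ) := by positivity
  rw [← h1] at e3' e4'
  set s := q.R / 2 ^ q.oct p with hs
  have hs0 : 0 < s := div_pos hv.R_pos (by positivity)
  have hH := q.H_pos
  have g1 := norm_gt hv hr'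
  rw [← h1, ← hs] at g1
  have g2 := (place_bounds hv hp hr b).1
  rw [← hs] at g2
  have f3 : q.R / 2 ^ q.oct p * (a / q.H) ≤ ‖q.place b p‖ := by
    rw [e2]
    refine mul_le_mul_of_nonneg_left ?_ hs0.le
    gcongr; linarith
  have f4 : ‖q.place b p‖ ≤ q.R / 2 ^ q.oct p * ((a + 1) / q.H) := by
    rw [e2]
    refine mul_le_mul_of_nonneg_left ?_ hs0.le
    gcongr
  rw [← hs] at f3 f4
  have hw : s * ((a + 1) / q.H) - s * (a / q.H) = s * (1 / q.H) := by ring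
  have t1 : s * (1 / q.H) ≤ 2 * (1 / q.H) * ‖p'‖ := by
    have := mul_lt_mul_of_pos_right g1 (one_div_pos.2 hH)
    linarith
  have t2 : s * (1 / q.H) ≤ 2 * (1 / q.H) * ‖q.place b p‖ := by
    have := mul_lt_mul_of_pos_right g2 (one_div_pos.2 hH)
    linarith
  have hside : sideOf (q.place b p) = sideOf p := by rw [ec, sideOf_smul hc]
  have hslope : slopeOf (q.place b p) = slopeOf p := by rw [ec, slopeOf_smul hc]
  have hpl := place_ne_zero hv hp0 hp hr b
  refine ⟨dist_le_of_near hp0 hp0' h3 h4 ?_, dist_le_of_near hpl hp0' (by rw [hside, h3])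
    (by rw [hslope]; exact h4) ?_, dist_le_of_near hp0' hpl (by rw [hside, h3])
    (by rw [hslope, abs_sub_comm]; exact h4) ?_⟩
  · rw [abs_le]; constructor <;> linarith
  · rw [abs_le]; constructor <;> linarith
  · rw [abs_le]; constructor <;> linarith

/-- Positions in different blocks are different. -/
theorem place_ne (hv : q.Valid ε k n) (hp : ‖p‖ ≤ q.R) (hr : q.ring p < q.J)
    (hp' : ‖p'‖ ≤ q.R) (hr' : q.ring p' < q.J) {b b' : ℕ} (hb : b ≠ b') :
    q.place b p ≠ q.place b' p' := by
  intro h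
  have hn : ‖q.place b p‖ = ‖q.place b' p'‖ := by rw [h]
  -- Equal norms force equal octaves, since positions lie strictly inside their octaves.
  have key : ∀ {x y : Plane} {c d : ℕ}, ‖x‖ ≤ q.R → q.ring x < q.J → ‖y‖ ≤ q.R →
      q.ring y < q.J → ‖q.place c x‖ = ‖q.place d y‖ → q.oct x ≤ q.oct y := by
    intro x y c d hx hxr hy hyr hxy
    by_contra hlt
    have h1 := (place_bounds hv hx hxr c).2
    have h2 := (place_bounds hv hy hyr d).1
    have h3 : q.R / 2 ^ q.oct x ≤ q.R / 2 ^ q.oct y / 2 := by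
      rw [div_div, ← pow_succ]
      exact div_le_div_of_nonneg_left hv.R_pos.le (by positivity)
        (pow_le_pow_right₀ (by norm_num) (by omega))
    linarith
  have ho := le_antisymm (key hp hr hp' hr' hn) (key hp' hr' hp hr hn.symm)
  obtain ⟨a, c, -, -, -, -, -, e, -⟩ := place_spec hv hp hr b
  obtain ⟨a', c', -, -, -, -, -, e', -⟩ := place_spec hv hp' hr' b'
  rw [e, e', ← ho] at hn
  have hs0 : 0 < q.R / 2 ^ q.oct p := div_pos hv.R_pos (by positivity)
  have h1 := mul_left_cancel₀ hs0.ne' hn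
  rw [div_left_inj' q.H_pos.ne'] at h1
  have t := theta_lt b
  have t' := theta_lt b'
  have u : 0 < 1 / ((b + 2 : ℕ) : ℝ) := by positivity
  have u' : 0 < 1 / ((b' + 2 : ℕ) : ℝ) := by positivity
  -- Integers plus offsets in `(0, 1)` agree only if both integers and offsets agree, and the offset
  -- determines the block.
  have haa : a = a' := by
    have l1 : (a : ℝ) < a' + 1 := by linarith
    have l2 : (a' : ℝ) < a + 1 := by linarith
    have l1' : a < a' + 1 := by exact_mod_cast l1
    have l2' : a' < a + 1 := by exact_mod_cast l2
    omega
  subst haa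
  have h2 : 1 / ((b + 2 : ℕ) : ℝ) = 1 / ((b' + 2 : ℕ) : ℝ) := by linarith
  rw [one_div, one_div, inv_inj] at h2
  have h3 : b + 2 = b' + 2 := by exact_mod_cast h2
  omega

/-- The first point is farther than `R / W ^ (r + 1)` for its ring `r`, the second within `R / W ^
(r + 2)`, and `W ≥ 1 / ε`. -/
theorem gap (hv : q.Valid ε k n) (hp' : ‖p'‖ ≤ q.R) (hr' : q.ring p' < q.J)
    (h : q.ring p + 2 ≤ q.ring p') : ‖p'‖ ≤ ε * ‖p‖ := by
  have h1 := one_lt_of_ring_lt (q := q) (p := p) (by omega)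
  have h2 := le_one_of_le_ring hv.R_pos hp' h
  unfold inRing at h1
  have hR := hv.R_pos
  have hW := q.W_pos
  have hWr := pow_pos hW (q.ring p)
  rw [pow_add, pow_two] at h2
  have h3 : ‖p'‖ / q.R * q.W * (q.W ^ q.ring p * q.W) < ‖p‖ / q.R * (q.W ^ q.ring p * q.W) := by
    calc _ = ‖p'‖ / q.R * (q.W ^ q.ring p * (q.W * q.W)) := by ring
      _ ≤ 1 := h2
      _ < _ := by rw [← mul_assoc]; exact h1
  have h4 := lt_of_mul_lt_mul_right h3 (by positivity)
  have h5 : ‖p'‖ * q.W < ‖p‖ := by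
    rw [div_mul_eq_mul_div] at h4
    exact (div_lt_div_iff_of_pos_right hR).1 h4
  have h6 := mul_le_mul_of_nonneg_left hv.W_eps (norm_nonneg p')
  have h7 := mul_le_mul_of_nonneg_right h5.le hv.eps_pos.le
  linarith

theorem tiny (hv : q.Valid ε k n) (hp : ‖p‖ ≤ q.R) (hr : q.ring p = q.J) :
    n * ‖p‖ ≤ ε * q.R := by
  have h1 := le_one_of_le_ring hv.R_pos hp hr.ge
  rw [div_mul_eq_mul_div, div_le_one hv.R_pos] at h1
  have h2 := mul_le_mul_of_nonneg_right hv.J_eps (norm_nonneg p)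
  have h3 := mul_le_mul_of_nonneg_left h1 hv.eps_pos.le
  linarith

/-- Dividing a key by `2 ^ (2 h + 3) * w` gives the ring, so the keys of `m` consecutive rings lie
in one interval of length `numLoc`. For `b + 1 < m` truncated subtraction starts the interval at
ring 0. -/
theorem card_keys_le (hv : q.Valid ε k n) (S : Finset Plane) (b : ℕ)
    (hS : ∀ p ∈ S, p ≠ 0 ∧ ‖p‖ ≤ q.R ∧ q.ring p < q.J ∧ q.ring p ≤ b ∧ b < q.ring p + q.m) :
    (S.image q.key).card ≤ q.numLoc := by
  set M := 2 ^ (2 * q.h + 3) with hM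
  have hM0 : 0 < M := by positivity
  have hsub : S.image q.key ⊆ Finset.Ico (M * q.w * (b + 1 - q.m)) (M * q.w * (b + 1)) := by
    intro a ha
    obtain ⟨p, hp, rfl⟩ := Finset.mem_image.1 ha
    obtain ⟨h0, hR, hJ, hb, hb'⟩ := hS p hp
    have h1 := key_div hv hR hJ
    rw [← hM] at h1
    have h2 := oct_div hv.w_pos hJ
    have h3 : q.key p / (M * q.w) = q.ring p := by rw [← Nat.div_div_eq_div_mul, h1, h2]
    have hMw : 0 < M * q.w := Nat.mul_pos hM0 hv.w_pos
    have h4 := Nat.div_add_mod (q.key p) (M * q.w)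
    have h5 := Nat.mod_lt (q.key p) hMw
    rw [h3] at h4
    have h6 : M * q.w * (b + 1 - q.m) ≤ M * q.w * q.ring p := Nat.mul_le_mul_left _ (by omega)
    have h7 : M * q.w * (q.ring p + 1) ≤ M * q.w * (b + 1) := Nat.mul_le_mul_left _ (by omega)
    rw [mul_add, mul_one] at h7
    exact Finset.mem_Ico.2 ⟨by omega, by omega⟩
  refine (Finset.card_le_card hsub).trans ?_
  rw [Nat.card_Ico, ← Nat.mul_sub, numLoc, ← hM]
  calc M * q.w * (b + 1 - (b + 1 - q.m)) ≤ M * q.w * q.m := Nat.mul_le_mul_left _ (by omega)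
    _ = _ := by ring

/-- The rings of a block span at most `w * m` octaves, and positions do not leave their octaves. -/
theorem spread (hv : q.Valid ε k n) (hp : ‖p‖ ≤ q.R) (hr : q.ring p < q.J)
    (hp' : ‖p'‖ ≤ q.R) (hr' : q.ring p' < q.J) (h : q.ring p' < q.ring p + q.m)
    (b : ℕ) : ‖q.place b p‖ ≤ q.W ^ q.m * ‖q.place b p'‖ := by
  have h1 := (place_bounds hv hp hr b).2
  have h2 := (place_bounds hv hp' hr' b).1
  have h3 : q.oct p' + 1 ≤ q.oct p + q.w * q.m := by
    have h4 := oct_lt hv.w_pos hr'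
    have h5 : (q.ring p' + 1) * q.w ≤ (q.ring p + q.m) * q.w := Nat.mul_le_mul_right _ (by omega)
    unfold oct
    rw [add_mul, add_mul, one_mul, mul_comm q.m] at h5
    omega
  have h4 : q.R / 2 ^ q.oct p ≤ q.W ^ q.m * (q.R / 2 ^ q.oct p' / 2) := by
    unfold W
    rw [← pow_mul, div_div, ← pow_succ, mul_div_assoc', div_le_div_iff₀ (by positivity) (by positivity)]
    have h5 : (2 : ℝ) ^ (q.oct p' + 1) ≤ 2 ^ (q.oct p + q.w * q.m) :=
      pow_le_pow_right₀ (by norm_num) h3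
    rw [pow_add 2 (q.oct p)] at h5
    have := mul_le_mul_of_nonneg_left h5 hv.R_pos.le
    linarith
  have h5 := mul_lt_mul_of_pos_left h2 (pow_pos q.W_pos q.m)
  linarith

end Params

end TourCover


namespace TourCover

/-! ## Fixing full tours at crowded locations -/

/-- For each location the stack of its points, and the tours that have been fixed. -/
structure PeelState where
  stack : ℕ → List ℕ
  done : List (List ℕ)

/-- Treat the point `i`: points of ring `J` get a tour of their own, other points are put on the
stack of their location, from which `k` points are taken when it reaches the height `c`. -/
def peelStep (J k c : ℕ) (ring key : ℕ → ℕ) (s : PeelState) (i : ℕ) : PeelState :=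
  if ring i < J then
    if (i :: s.stack (key i)).length < c then
      ⟨Function.update s.stack (key i) (i :: s.stack (key i)), s.done⟩
    else ⟨Function.update s.stack (key i) ((i :: s.stack (key i)).drop k),
      s.done ++ [(i :: s.stack (key i)).take k]⟩
  else ⟨s.stack, s.done ++ [[i]]⟩

def peel (J k c : ℕ) (ring key : ℕ → ℕ) : ℕ → PeelState
  | 0 => ⟨fun _ => [], []⟩
  | i + 1 => peelStep J k c ring key (peel J k c ring key i) i

/-- The stack of `a` contains exactly the points of `a` seen so far that are on no fixed tour. The
bound `k * L` at a location with a fixed tour persists, as stacks shrink only from height `k * L +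
k`, and then by `k`. -/
structure PeelInv (J k L : ℕ) (ring key : ℕ → ℕ) (i : ℕ) (s : PeelState) : Prop where
  nodup : s.done.flatten.Nodup
  lt : ∀ x ∈ s.done.flatten, x < i
  stack_nodup : ∀ a, (s.stack a).Nodup
  mem_stack : ∀ a x, x ∈ s.stack a ↔ x < i ∧ ring x < J ∧ key x = a ∧ x ∉ s.done.flatten
  stack_lt : ∀ a, (s.stack a).length < k * L + k
  tour : ∀ t ∈ s.done, (∃ x < i, ¬ ring x < J ∧ t = [x]) ∨ (t.length = k ∧
    (∀ x ∈ t, x < i ∧ ring x < J) ∧ ∃ a, (∀ x ∈ t, key x = a) ∧ k * L ≤ (s.stack a).length)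
  tiny : ∀ x < i, ¬ ring x < J → x ∈ s.done.flatten

theorem peelInv_step {J k L : ℕ} (hk : 1 ≤ k) {ring key : ℕ → ℕ} {i : ℕ} {s : PeelState}
    (h : PeelInv J k L ring key i s) :
    PeelInv J k L ring key (i + 1) (peelStep J k (k * L + k) ring key s i) := by
  have hi : i ∉ s.done.flatten := fun hi => by have := h.lt i hi; omega
  have hist : ∀ a, i ∉ s.stack a := fun a ha => by have := ((h.mem_stack a i).1 ha).1; omega
  unfold peelStep
  split_ifs with hr hc
  · refine ⟨h.nodup, fun x hx => (h.lt x hx).trans (by omega), ?_, ?_, ?_, ?_, ?_⟩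
    · intro a
      by_cases ha : a = key i
      · subst ha
        simp only [Function.update_self]
        exact List.nodup_cons.2 ⟨hist _, h.stack_nodup _⟩
      · simp only [Function.update_of_ne ha]; exact h.stack_nodup a
    · intro a x
      by_cases ha : a = key i
      · subst ha
        simp only [Function.update_self, List.mem_cons, h.mem_stack]
        constructor
        · rintro (rfl | ⟨h1, h2⟩)
          · exact ⟨by omega, hr, rfl, hi⟩
          · exact ⟨by omega, h2⟩
        · rintro ⟨h1, h2⟩
          by_cases hx : x = i
          · exact Or.inl hx
          · exact Or.inr ⟨by omega, h2⟩
      · simp only [Function.update_of_ne ha, h.mem_stack]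
        constructor
        · rintro ⟨h1, h2⟩; exact ⟨by omega, h2⟩
        · rintro ⟨h1, h2⟩
          refine ⟨?_, h2⟩
          have : x ≠ i := by rintro rfl; exact ha h2.2.1.symm
          omega
    · intro a
      by_cases ha : a = key i
      · subst ha; simpa only [Function.update_self] using hc
      · simp only [Function.update_of_ne ha]; exact h.stack_lt a
    · intro t ht
      rcases h.tour t ht with ⟨x, hx, h1⟩ | ⟨h1, h2, a, h3, h4⟩
      · exact Or.inl ⟨x, by omega, h1⟩
      · refine Or.inr ⟨h1, fun x hx => ⟨(h2 x hx).1.trans (by omega), (h2 x hx).2⟩, a, h3, ?_⟩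
        by_cases ha : a = key i
        · subst ha; simp only [Function.update_self, List.length_cons]; omega
        · simpa only [Function.update_of_ne ha] using h4
    · intro x hx hxr
      have : x ≠ i := by rintro rfl; exact hxr hr
      exact h.tiny x (by omega) hxr
  · set l := i :: s.stack (key i) with hl
    -- The threshold is met exactly, since the height was below it before this point was added. So
    -- `k * L` points remain after `k` have been taken.
    have hlen : l.length = k * L + k := by
      have := h.stack_lt (key i)
      simp only [hl, List.length_cons] at hc ⊢
      omega
    have hlnd : l.Nodup := List.nodup_cons.2 ⟨hist _, h.stack_nodup _⟩
    have hlmem : ∀ x, x ∈ l ↔ x < i + 1 ∧ ring x < J ∧ key x = key i ∧ x ∉ s.done.flatten := by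
      intro x
      rw [hl, List.mem_cons, h.mem_stack]
      constructor
      · rintro (rfl | ⟨h1, h2⟩)
        · exact ⟨by omega, hr, rfl, hi⟩
        · exact ⟨by omega, h2⟩
      · rintro ⟨h1, h2⟩
        by_cases hx : x = i
        · exact Or.inl hx
        · exact Or.inr ⟨by omega, h2⟩
    have htd : ∀ x, x ∈ l.take k → x ∉ l.drop k := fun x h1 h2 =>
      List.disjoint_take_drop hlnd le_rfl h1 h2
    have htd' : ∀ x, x ∈ l ↔ x ∈ l.take k ∨ x ∈ l.drop k := by
      intro x
      conv_lhs => rw [← List.take_append_drop k l]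
      exact List.mem_append
    have hfl : (s.done ++ [l.take k]).flatten = s.done.flatten ++ l.take k := by simp
    refine ⟨?_, ?_, ?_, ?_, ?_, ?_, ?_⟩
    · rw [hfl, List.nodup_append]
      refine ⟨h.nodup, hlnd.sublist (List.take_sublist _ _), ?_⟩
      rintro x hx y hy rfl
      exact ((hlmem x).1 ((htd' x).2 (Or.inl hy))).2.2.2 hx
    · intro x hx
      rw [hfl, List.mem_append] at hx
      rcases hx with hx | hx
      · exact (h.lt x hx).trans (by omega)
      · exact ((hlmem x).1 ((htd' x).2 (Or.inl hx))).1
    · intro a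
      by_cases ha : a = key i
      · subst ha
        simp only [Function.update_self]
        exact hlnd.sublist (List.drop_sublist _ _)
      · simp only [Function.update_of_ne ha]; exact h.stack_nodup a
    · intro a x
      rw [hfl, List.mem_append, not_or]
      by_cases ha : a = key i
      · subst ha
        simp only [Function.update_self]
        constructor
        · intro hx
          have := (hlmem x).1 ((htd' x).2 (Or.inr hx))
          exact ⟨this.1, this.2.1, this.2.2.1, this.2.2.2, fun h' => htd x h' hx⟩
        · rintro ⟨h1, h2, h3, h4, h5⟩
          exact ((htd' x).1 ((hlmem x).2 ⟨h1, h2, h3, h4⟩)).resolve_left h5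
      · simp only [Function.update_of_ne ha, h.mem_stack]
        constructor
        · rintro ⟨h1, h2, h3, h4⟩
          refine ⟨by omega, h2, h3, h4, fun h' => ha ?_⟩
          rw [← h3]
          exact ((hlmem x).1 ((htd' x).2 (Or.inl h'))).2.2.1
        · rintro ⟨h1, h2, h3, h4, -⟩
          refine ⟨?_, h2, h3, h4⟩
          have : x ≠ i := by rintro rfl; exact ha h3.symm
          omega
    · intro a
      by_cases ha : a = key i
      · subst ha; simp only [Function.update_self, List.length_drop]; omega
      · simp only [Function.update_of_ne ha]; exact h.stack_lt a
    · intro t ht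
      rcases List.mem_append.1 ht with ht | ht
      · rcases h.tour t ht with ⟨x, hx, h1⟩ | ⟨h1, h2, a, h3, h4⟩
        · exact Or.inl ⟨x, by omega, h1⟩
        · refine Or.inr ⟨h1, fun x hx => ⟨(h2 x hx).1.trans (by omega), (h2 x hx).2⟩, a, h3, ?_⟩
          by_cases ha : a = key i
          · subst ha; simp only [Function.update_self, List.length_drop]; omega
          · simpa only [Function.update_of_ne ha] using h4
      · obtain rfl := List.mem_singleton.1 ht
        refine Or.inr ⟨?_, fun x hx => ?_, key i, fun x hx => ?_, ?_⟩
        · rw [List.length_take]; omega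
        · have := (hlmem x).1 ((htd' x).2 (Or.inl hx)); exact ⟨this.1, this.2.1⟩
        · exact ((hlmem x).1 ((htd' x).2 (Or.inl hx))).2.2.1
        · simp only [Function.update_self, List.length_drop]; omega
    · intro x hx hxr
      have : x ≠ i := by rintro rfl; exact hxr hr
      rw [hfl]
      exact List.mem_append_left _ (h.tiny x (by omega) hxr)
  · have hfl : (s.done ++ [[i]]).flatten = s.done.flatten ++ [i] := by simp
    refine ⟨?_, ?_, h.stack_nodup, ?_, h.stack_lt, ?_, ?_⟩
    · rw [hfl, List.nodup_append]
      refine ⟨h.nodup, by simp, ?_⟩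
      rintro x hx y hy rfl
      obtain rfl := List.mem_singleton.1 hy
      exact hi hx
    · intro x hx
      rw [hfl, List.mem_append] at hx
      rcases hx with hx | hx
      · exact (h.lt x hx).trans (by omega)
      · obtain rfl := List.mem_singleton.1 hx; omega
    · intro a x
      rw [hfl, List.mem_append, not_or, List.mem_singleton, h.mem_stack]
      constructor
      · rintro ⟨h1, h2, h3, h4⟩; exact ⟨by omega, h2, h3, h4, by omega⟩
      · rintro ⟨h1, h2, h3, h4, h5⟩; exact ⟨by omega, h2, h3, h4⟩
    · intro t ht
      rcases List.mem_append.1 ht with ht | ht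
      · rcases h.tour t ht with ⟨x, hx, h1⟩ | ⟨h1, h2, a, h3, h4⟩
        · exact Or.inl ⟨x, by omega, h1⟩
        · exact Or.inr ⟨h1, fun x hx => ⟨(h2 x hx).1.trans (by omega), (h2 x hx).2⟩, a, h3, h4⟩
      · exact Or.inl ⟨i, by omega, hr, List.mem_singleton.1 ht⟩
    · intro x hx hxr
      rw [hfl, List.mem_append, List.mem_singleton]
      by_cases hxi : x = i
      · exact Or.inr hxi
      · exact Or.inl (h.tiny x (by omega) hxr)

theorem peelInv {J k L : ℕ} (hk : 1 ≤ k) (ring key : ℕ → ℕ) (i : ℕ) :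
    PeelInv J k L ring key i (peel J k (k * L + k) ring key i) := by
  induction i with
  | zero => exact ⟨by simp [peel], by simp [peel], by simp [peel], by simp [peel],
      fun a => by simp only [peel, List.length_nil]; omega, by simp [peel], by simp⟩
  | succ i ih => exact peelInv_step hk ih

theorem PeelInv.card_stack {J k L : ℕ} {ring key : ℕ → ℕ} {i : ℕ} {s : PeelState}
    (h : PeelInv J k L ring key i s) (a : ℕ) :
    ((Finset.range i).filter fun x => ring x < J ∧ key x = a ∧ x ∉ s.done.flatten).card =
      (s.stack a).length := by
  rw [← List.toFinset_card_of_nodup (h.stack_nodup a)]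
  congr 1
  ext x
  simp [h.mem_stack]

namespace Params

/-- The tours fixed in advance. -/
noncomputable def fixedTours (q : Params) (k : ℕ) (P : List Plane) : List (List ℕ) :=
  (peel q.J k (k * q.numLoc + k) (fun i => q.ring (P.getD i 0)) (fun i => q.key (P.getD i 0))
    P.length).done

/-- The points in the instance of the block `b`. -/
noncomputable def kept (q : Params) (k : ℕ) (P : List Plane) (b : ℕ) : List ℕ :=
  keptList P.length q.m (fun i => q.ring (P.getD i 0)) (q.fixedTours k P) b

/-- The instance of the block `b`. -/
noncomputable def inst (q : Params) (k : ℕ) (P : List Plane) (b : ℕ) : List Plane :=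
  (q.kept k P b).map fun i => q.place b (P.getD i 0)

variable {q : Params} {ε : ℝ} {k : ℕ} {P : List Plane}

theorem isPlan (hv : q.Valid ε k P.length) (h0 : ∀ p ∈ P, p ≠ 0) (hR : ∀ p ∈ P, ‖p‖ ≤ q.R)
    (hR' : ∃ p ∈ P, ‖p‖ = q.R) :
    IsPlan ε k P.length q.m q.J q.numLoc (fun i => P.getD i 0) (fun i => q.ring (P.getD i 0))
      (fun i => q.key (P.getD i 0)) (q.fixedTours k P) (fun b i => q.place b (P.getD i 0)) := by
  have inv := peelInv (J := q.J) (L := q.numLoc) hv.k_pos (fun i => q.ring (P.getD i 0))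
    (fun i => q.key (P.getD i 0)) P.length
  have hmem : ∀ i < P.length, P.getD i 0 ∈ P := fun i hi => by
    rw [List.getD_eq_getElem _ _ hi]; exact List.getElem_mem hi
  have hJ : ∀ i, ¬ q.ring (P.getD i 0) < q.J → q.ring (P.getD i 0) = q.J := fun i h =>
    le_antisymm (q.ring_le _) (not_lt.1 h)
  refine ⟨hv.eps_pos, hv.eps_le, hv.k_pos, hv.m_pos, hv.m_eps, fun i _ => q.ring_le _, ?_, ?_, ?_,
    ⟨4 * (1 / q.H), by have := q.H_pos; positivity, ?_, ?_⟩, ?_, inv.nodup, ?_, ?_⟩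
  · obtain ⟨p, hp, hpR⟩ := hR'
    obtain ⟨i, hi, rfl⟩ := List.mem_iff_getElem.1 hp
    refine ⟨i, hi, fun j hj hjJ => ?_⟩
    rw [List.getD_eq_getElem _ _ hi, hpR]
    exact tiny hv (hR _ (hmem j hj)) hjJ
  · intro i hi j hj hjJ hij
    exact gap hv (hR _ (hmem j hj)) hjJ hij
  · intro i hi j hj hiJ hjJ hk
    have := (eq_of_key_eq hv (hR _ (hmem i hi)) hiJ (hR _ (hmem j hj)) hjJ hk).1
    rw [← oct_div hv.w_pos hiJ, ← oct_div hv.w_pos hjJ, this]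
  · have := hv.h_eps
    have hH := q.H_pos
    rw [mul_one_div, div_mul_eq_mul_div, div_le_iff₀ hH]
    linarith
  · intro i hi j hj hiJ hjJ hk
    have := near_of_key_eq hv (h0 _ (hmem i hi)) (hR _ (hmem i hi)) hiJ (h0 _ (hmem j hj))
      (hR _ (hmem j hj)) hjJ hk
    exact ⟨(this 0).1, fun b => (this b).2⟩
  · intro b
    classical
    have := card_keys_le hv (((Finset.range P.length).filter fun i => q.ring (P.getD i 0) < q.J ∧
      q.ring (P.getD i 0) ≤ b ∧ b < q.ring (P.getD i 0) + q.m).image fun i => P.getD i 0) b (by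
        intro p hp
        obtain ⟨i, hi, rfl⟩ := Finset.mem_image.1 hp
        obtain ⟨hi, h1⟩ := Finset.mem_filter.1 hi
        have hi := hmem i (Finset.mem_range.1 hi)
        exact ⟨h0 _ hi, hR _ hi, h1⟩)
    rwa [Finset.image_image] at this
  · intro t ht
    rcases inv.tour t ht with ⟨x, hx, hxJ, rfl⟩ | ⟨h1, h2, a, h3, h4⟩
    · exact Or.inl ⟨x, hx, hJ x hxJ, rfl⟩
    · refine Or.inr ⟨h1, h2, a, h3, ?_⟩
      rw [← inv.card_stack] at h4
      exact h4
  · intro i hi hiJ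
    exact inv.tiny i hi (by simp only [hiJ]; exact lt_irrefl _)

theorem mem_kept (hv : q.Valid ε k P.length) {b i : ℕ} (hi : i ∈ q.kept k P b) :
    i < P.length ∧ P.getD i 0 ∈ P ∧ q.ring (P.getD i 0) < q.J ∧ i ∉ (q.fixedTours k P).flatten ∧
      q.ring (P.getD i 0) ≤ b ∧ b < q.ring (P.getD i 0) + q.m := by
  have inv := peelInv (J := q.J) (L := q.numLoc) hv.k_pos (fun i => q.ring (P.getD i 0))
    (fun i => q.key (P.getD i 0)) P.length
  obtain ⟨h1, h2, h3⟩ := mem_keptList.1 hi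
  refine ⟨h1, ?_, ?_, h2, h3⟩
  · rw [List.getD_eq_getElem _ _ h1]; exact List.getElem_mem h1
  · by_contra h
    exact h2 (inv.tiny i h1 h)

/-- At most `numLoc` locations, with fewer than `k * numLoc + k` unfixed points each. -/
theorem length_inst_le (hv : q.Valid ε k P.length) (h0 : ∀ p ∈ P, p ≠ 0) (hR : ∀ p ∈ P, ‖p‖ ≤ q.R)
    (b : ℕ) : (q.inst k P b).length ≤ q.numLoc * (k * q.numLoc + k) := by
  classical
  have inv := peelInv (J := q.J) (L := q.numLoc) hv.k_pos (fun i => q.ring (P.getD i 0))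
    (fun i => q.key (P.getD i 0)) P.length
  have hnd : (q.kept k P b).Nodup := nodup_keptList b
  rw [inst, List.length_map, ← List.toFinset_card_of_nodup hnd]
  have hkeys := card_keys_le hv ((q.kept k P b).toFinset.image fun i => P.getD i 0) b (by
    intro p hp
    obtain ⟨i, hi, rfl⟩ := Finset.mem_image.1 hp
    have := mem_kept hv (List.mem_toFinset.1 hi)
    exact ⟨h0 _ this.2.1, hR _ this.2.1, this.2.2.1, this.2.2.2.2⟩)
  rw [Finset.image_image] at hkeys
  rw [Finset.card_eq_sum_card_image (fun i => q.key (P.getD i 0))]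
  refine (Finset.sum_le_card_nsmul _ _ (k * q.numLoc + k) fun a _ => ?_).trans ?_
  · have hlt := inv.stack_lt a
    rw [← inv.card_stack] at hlt
    refine le_trans (Finset.card_le_card ?_) hlt.le
    intro i hi
    obtain ⟨h1, h2⟩ := Finset.mem_filter.1 hi
    have := mem_kept hv (List.mem_toFinset.1 h1)
    exact Finset.mem_filter.2 ⟨Finset.mem_range.2 this.1, this.2.2.1, h2, this.2.2.2.1⟩
  · rw [smul_eq_mul]
    exact Nat.mul_le_mul_right _ hkeys

theorem inst_spread (hv : q.Valid ε k P.length) (hR : ∀ p ∈ P, ‖p‖ ≤ q.R)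
    {b : ℕ} {x y : Plane} (hx : x ∈ q.inst k P b) (hy : y ∈ q.inst k P b) :
    ‖x‖ ≤ q.W ^ q.m * ‖y‖ := by
  obtain ⟨i, hi, rfl⟩ := List.mem_map.1 hx
  obtain ⟨j, hj, rfl⟩ := List.mem_map.1 hy
  have hi := mem_kept hv hi
  have hj := mem_kept hv hj
  exact spread hv (hR _ hi.2.1) hi.2.2.1 (hR _ hj.2.1) hj.2.2.1
    (by omega) b

theorem inst_ne_zero (hv : q.Valid ε k P.length) (h0 : ∀ p ∈ P, p ≠ 0) (hR : ∀ p ∈ P, ‖p‖ ≤ q.R)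
    {b : ℕ} {x : Plane} (hx : x ∈ q.inst k P b) : x ≠ 0 := by
  obtain ⟨i, hi, rfl⟩ := List.mem_map.1 hx
  have hi := mem_kept hv hi
  exact place_ne_zero hv (h0 _ hi.2.1) (hR _ hi.2.1) hi.2.2.1 b

theorem inst_disjoint (hv : q.Valid ε k P.length) (hR : ∀ p ∈ P, ‖p‖ ≤ q.R)
    {b b' : ℕ} (hb : b ≠ b') : (q.inst k P b).Disjoint (q.inst k P b') := by
  intro x hx hx'
  obtain ⟨i, hi, rfl⟩ := List.mem_map.1 hx
  obtain ⟨j, hj, e⟩ := List.mem_map.1 hx'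
  have hi := mem_kept hv hi
  have hj := mem_kept hv hj
  exact place_ne hv (hR _ hi.2.1) hi.2.2.1 (hR _ hj.2.1) hj.2.2.1 hb
    e.symm

end Params

end TourCover


namespace TourCover

/-! ## Choice of the parameters -/

/-- This and the next parameters are the least values at which a loop test fails. So the loops
compute them by definition, and minimality provides the upper bounds. -/
noncomputable def wOf (ε : ℝ) : ℕ := sInf {w | ¬ (2 : ℝ) ^ w * ε < 1}

noncomputable def mOf (ε : ℝ) : ℕ := sInf {m | ¬ (m : ℝ) * ε < 1}

noncomputable def JOf (ε : ℝ) (n : ℕ) : ℕ := sInf {J | ¬ ((2 : ℝ) ^ wOf ε) ^ J * ε < n}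

noncomputable def hOf (ε : ℝ) (k : ℕ) : ℕ := sInf {h | ¬ (2 : ℝ) ^ h * ε < k}

/-- Maximal norm of the first `i` points. -/
noncomputable def maxNorm (P : List Plane) : ℕ → ℝ
  | 0 => 0
  | i + 1 => if maxNorm P i < ‖P.getD i 0‖ then ‖P.getD i 0‖ else maxNorm P i

/-- The number of digits is chosen for the capacity `min k n`, which keeps it O(log(n/ε)) however
large `k` is. -/
noncomputable def paramsOf (ε : ℝ) (k : ℕ) (P : List Plane) : Params where
  w := wOf ε
  m := mOf ε
  J := JOf ε P.length
  h := hOf ε (min k P.length)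
  R := maxNorm P P.length

theorem le_maxNorm (P : List Plane) (i : ℕ) : ∀ j < i, ‖P.getD j 0‖ ≤ maxNorm P i := by
  induction i with
  | zero => intro j hj; omega
  | succ i ih =>
    intro j hj
    unfold maxNorm
    rcases Nat.lt_succ_iff_lt_or_eq.1 hj with h | rfl
    · have := ih j h
      split_ifs with h2
      · linarith
      · exact this
    · split_ifs with h2
      · exact le_rfl
      · exact not_lt.1 h2

theorem exists_maxNorm (P : List Plane) (i : ℕ) :
    maxNorm P i = 0 ∨ ∃ j < i, ‖P.getD j 0‖ = maxNorm P i := by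
  induction i with
  | zero => exact Or.inl rfl
  | succ i ih =>
    unfold maxNorm
    split_ifs with h
    · exact Or.inr ⟨i, by omega, rfl⟩
    · rcases ih with h | ⟨j, hj, e⟩
      · exact Or.inl h
      · exact Or.inr ⟨j, by omega, e⟩

section

variable {ε : ℝ}

theorem exists_pow_mul_ge (hε : 0 < ε) {b : ℝ} (hb : 1 < b) (c : ℝ) :
    ({h : ℕ | ¬ b ^ h * ε < c}).Nonempty := by
  obtain ⟨h, hh⟩ := pow_unbounded_of_one_lt (c / ε) hb
  refine ⟨h, ?_⟩
  rw [div_lt_iff₀ hε] at hh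
  exact not_lt.2 hh.le

theorem wOf_spec (hε : 0 < ε) : 1 ≤ (2 : ℝ) ^ wOf ε * ε :=
  not_lt.1 (Nat.sInf_mem (exists_pow_mul_ge hε one_lt_two 1))

theorem lt_of_lt_wOf {i : ℕ} (h : i < wOf ε) : (2 : ℝ) ^ i * ε < 1 := by
  by_contra hc
  exact Nat.notMem_of_lt_sInf h hc

theorem wOf_pos (hε : 0 < ε) (hε2 : ε ≤ 1 / 2) : 1 ≤ wOf ε := by
  by_contra h
  have h0 : wOf ε = 0 := by omega
  have := wOf_spec hε
  rw [h0] at this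
  linarith

theorem pow_wOf_lt (hε : 0 < ε) (hε2 : ε ≤ 1 / 2) : (2 : ℝ) ^ wOf ε * ε < 2 := by
  have h1 := wOf_pos hε hε2
  have h2 := lt_of_lt_wOf (ε := ε) (i := wOf ε - 1) (by omega)
  obtain ⟨w, hw⟩ : ∃ w, wOf ε = w + 1 := ⟨wOf ε - 1, by omega⟩
  rw [hw] at h2 ⊢
  simp only [Nat.add_sub_cancel] at h2
  rw [pow_succ]
  linarith

theorem one_lt_pow_wOf (hε : 0 < ε) (hε2 : ε ≤ 1 / 2) : (1 : ℝ) < 2 ^ wOf ε :=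
  one_lt_pow₀ one_lt_two (by have := wOf_pos hε hε2; omega)

theorem mOf_spec (hε : 0 < ε) : 1 ≤ (mOf ε : ℝ) * ε := by
  refine not_lt.1 (Nat.sInf_mem (s := {m : ℕ | ¬ (m : ℝ) * ε < 1}) ?_)
  obtain ⟨m, hm⟩ := exists_nat_gt (1 / ε)
  refine ⟨m, ?_⟩
  rw [div_lt_iff₀ hε] at hm
  exact not_lt.2 hm.le

theorem lt_of_lt_mOf {i : ℕ} (h : i < mOf ε) : (i : ℝ) * ε < 1 := by
  by_contra hc
  exact Nat.notMem_of_lt_sInf h hc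

theorem mOf_pos (hε : 0 < ε) : 1 ≤ mOf ε := by
  by_contra h
  have h0 : mOf ε = 0 := by omega
  have := mOf_spec hε
  rw [h0] at this
  norm_num at this

theorem mOf_le (hε : 0 < ε) (hε2 : ε ≤ 1 / 2) : (mOf ε : ℝ) * ε ≤ 3 / 2 := by
  have h1 := mOf_pos hε
  have h2 := lt_of_lt_mOf (ε := ε) (i := mOf ε - 1) (by omega)
  rw [Nat.cast_sub h1] at h2
  push_cast at h2
  linarith

theorem JOf_spec (hε : 0 < ε) (hε2 : ε ≤ 1 / 2) (n : ℕ) : (n : ℝ) ≤ (2 ^ wOf ε) ^ JOf ε n * ε :=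
  not_lt.1 (Nat.sInf_mem (exists_pow_mul_ge hε (one_lt_pow_wOf hε hε2) n))

theorem lt_of_lt_JOf {n i : ℕ} (h : i < JOf ε n) : ((2 : ℝ) ^ wOf ε) ^ i * ε < n := by
  by_contra hc
  exact Nat.notMem_of_lt_sInf h hc

theorem hOf_spec (hε : 0 < ε) (k : ℕ) : (k : ℝ) ≤ 2 ^ hOf ε k * ε :=
  not_lt.1 (Nat.sInf_mem (exists_pow_mul_ge hε one_lt_two k))

theorem lt_of_lt_hOf {k i : ℕ} (h : i < hOf ε k) : (2 : ℝ) ^ i * ε < k := by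
  by_contra hc
  exact Nat.notMem_of_lt_sInf h hc

theorem hOf_pos (hε : 0 < ε) (hε2 : ε ≤ 1 / 2) {k : ℕ} (hk : 1 ≤ k) : 1 ≤ hOf ε k := by
  by_contra h
  have h0 : hOf ε k = 0 := by omega
  have := hOf_spec hε k
  rw [h0] at this
  have : (1 : ℝ) ≤ k := by exact_mod_cast hk
  linarith

theorem pow_hOf_lt (hε : 0 < ε) (hε2 : ε ≤ 1 / 2) {k : ℕ} (hk : 1 ≤ k) :
    (2 : ℝ) ^ hOf ε k * ε < 2 * k := by
  have h1 := hOf_pos hε hε2 hk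
  have h2 := lt_of_lt_hOf (ε := ε) (k := k) (i := hOf ε k - 1) (by omega)
  obtain ⟨w, hw⟩ : ∃ w, hOf ε k = w + 1 := ⟨hOf ε k - 1, by omega⟩
  rw [hw] at h2 ⊢
  simp only [Nat.add_sub_cancel] at h2
  rw [pow_succ]
  linarith

theorem log_inv_ge (hε : 0 < ε) (hε2 : ε ≤ 1 / 2) : Real.log 2 ≤ Real.log (1 / ε) := by
  refine Real.log_le_log two_pos ?_
  rw [le_div_iff₀ hε]
  linarith

theorem log_inv_le_log_div (hε : 0 < ε) {n : ℕ} (hn : 1 ≤ n) :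
    Real.log (1 / ε) ≤ Real.log (n / ε) := by
  refine Real.log_le_log (by positivity) ?_
  gcongr
  exact_mod_cast hn

/-- By minimality `w log 2 < log 2 + log (1/ε) ≤ 2 log (1/ε)`, and `2 / log 2 < 3`. -/
theorem wOf_le_log (hε : 0 < ε) (hε2 : ε ≤ 1 / 2) : (wOf ε : ℝ) ≤ 3 * Real.log (1 / ε) := by
  have h1 := Real.log_lt_log (by positivity) ((lt_div_iff₀ hε).2 (pow_wOf_lt hε hε2))
  rw [Real.log_pow, show (2 : ℝ) / ε = 2 * (1 / ε) by ring, Real.log_mul (by norm_num)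
    (by positivity)] at h1
  have h2 := log_inv_ge hε hε2
  have h3 := Real.log_two_gt_d9
  nlinarith

/-- Minimality gives `W ^ (J - 1) < n / ε`; take logarithms and use `W ≥ 1 / ε`. -/
theorem JOf_le_log (hε : 0 < ε) (hε2 : ε ≤ 1 / 2) {n : ℕ} (hn : 1 ≤ n) :
    (JOf ε n : ℝ) ≤ Real.log (n / ε) / Real.log (1 / ε) + 1 := by
  have hl : 0 < Real.log (1 / ε) := (Real.log_pos one_lt_two).trans_le (log_inv_ge hε hε2)
  have hX : 0 ≤ Real.log (n / ε) / Real.log (1 / ε) :=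
    div_nonneg (hl.le.trans (log_inv_le_log_div hε hn)) hl.le
  rcases Nat.eq_zero_or_pos (JOf ε n) with h | h
  · rw [h]; push_cast; linarith
  · have h2 := lt_of_lt_JOf (ε := ε) (n := n) (i := JOf ε n - 1) (by omega)
    have h3 := Real.log_lt_log (by positivity) ((lt_div_iff₀ hε).2 h2)
    rw [Real.log_pow, Nat.cast_sub h] at h3
    have h4 : Real.log (1 / ε) ≤ Real.log (2 ^ wOf ε) := by
      refine Real.log_le_log (by positivity) ?_
      rw [div_le_iff₀ hε]
      exact wOf_spec hε
    have h5 : (0 : ℝ) ≤ (JOf ε n : ℝ) - 1 := by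
      have : (1 : ℝ) ≤ JOf ε n := by exact_mod_cast h
      linarith
    have h6 := mul_le_mul_of_nonneg_left h4 h5
    push_cast at h3
    rw [← sub_le_iff_le_add, le_div_iff₀ hl]
    linarith

theorem hOf_le_log (hε : 0 < ε) (hε2 : ε ≤ 1 / 2) {k n : ℕ} (hk : 1 ≤ k) (hkn : k ≤ n) :
    (hOf ε k : ℝ) ≤ Real.log (n / ε) / Real.log 2 + 1 := by
  have h1 := Real.log_lt_log (by positivity) ((lt_div_iff₀ hε).2 (pow_hOf_lt hε hε2 hk))
  have hk' : (0 : ℝ) < k := by exact_mod_cast hk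
  have h2 : Real.log (k / ε) ≤ Real.log (n / ε) := by
    refine Real.log_le_log (by positivity) ?_
    gcongr
  rw [Real.log_pow, show (2 : ℝ) * k / ε = 2 * (k / ε) by ring, Real.log_mul (by norm_num)
    (by positivity)] at h1
  have h3 := Real.log_pos one_lt_two
  rw [← sub_le_iff_le_add, le_div_iff₀ h3]
  linarith

/-- The number of instances. -/
theorem numBlocks_le (hε : 0 < ε) (hε2 : ε ≤ 1 / 2) {n : ℕ} (hn : 1 ≤ n) :
    ((JOf ε n + mOf ε : ℕ) : ℝ) ≤ 50000 * (ε⁻¹ * Real.log (n / ε) / Real.log (1 / ε)) := by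
  have hl : 0 < Real.log (1 / ε) := (Real.log_pos one_lt_two).trans_le (log_inv_ge hε hε2)
  have h1 := JOf_le_log hε hε2 hn
  have hX : 1 ≤ Real.log (n / ε) / Real.log (1 / ε) := by
    rw [le_div_iff₀ hl, one_mul]; exact log_inv_le_log_div hε hn
  have h2 := mOf_le hε hε2
  rw [← le_div_iff₀ hε, div_eq_mul_inv] at h2
  have h3 : 2 ≤ ε⁻¹ := by rw [le_inv_comm₀ two_pos hε]; linarith
  rw [mul_div_assoc]
  push_cast
  nlinarith

theorem numLoc_le (hε : 0 < ε) (hε2 : ε ≤ 1 / 2) {k : ℕ} (hk : 1 ≤ k) {q : Params}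
    (hw : q.w = wOf ε) (hm : q.m = mOf ε) (hh : q.h = hOf ε k) :
    (q.numLoc : ℝ) ≤ 144 * ((k : ℝ) ^ 2 * (ε⁻¹) ^ 3 * Real.log (1 / ε)) := by
  have h1 := wOf_le_log hε hε2
  have h2 := mOf_le hε hε2
  rw [← le_div_iff₀ hε, div_eq_mul_inv] at h2
  have h3 := ((lt_div_iff₀ hε).2 (pow_hOf_lt hε hε2 hk)).le
  rw [div_eq_mul_inv] at h3
  have hi : 0 < ε⁻¹ := inv_pos.2 hε
  have hl : 0 < Real.log (1 / ε) := (Real.log_pos one_lt_two).trans_le (log_inv_ge hε hε2)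
  have e : (q.numLoc : ℝ) = mOf ε * wOf ε * (8 * (2 ^ hOf ε k) ^ 2) := by
    rw [Params.numLoc, hw, hm, hh]
    push_cast
    ring
  rw [e]
  calc (mOf ε : ℝ) * wOf ε * (8 * (2 ^ hOf ε k) ^ 2) ≤
      (3 / 2 * ε⁻¹) * (3 * Real.log (1 / ε)) * (8 * (2 * k * ε⁻¹) ^ 2) := by gcongr
    _ = _ := by ring

/-- As `numLoc ≥ 1`, the left side is at most `2 κ numLoc²`, and `2 · 144² = 41472`. Passing from
`κ` to `k` only increases the bound. -/
theorem length_bound (hε : 0 < ε) (hε2 : ε ≤ 1 / 2) {k κ : ℕ} (hκ : 1 ≤ κ) (hκk : κ ≤ k) {q : Params}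
    (hw : q.w = wOf ε) (hm : q.m = mOf ε) (hh : q.h = hOf ε κ) :
    ((q.numLoc * (κ * q.numLoc + κ) : ℕ) : ℝ) ≤
      50000 * ((k : ℝ) ^ 5 * (ε⁻¹) ^ 6 * Real.log (1 / ε) ^ 2) := by
  have h1 := numLoc_le hε hε2 hκ hw hm hh
  have hl : 0 < Real.log (1 / ε) := (Real.log_pos one_lt_two).trans_le (log_inv_ge hε hε2)
  have hL : 1 ≤ q.numLoc := by
    rw [Params.numLoc, hw, hm]
    exact Nat.mul_pos (Nat.mul_pos (mOf_pos hε) (wOf_pos hε hε2)) (by positivity)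
  have hi : 0 < ε⁻¹ := inv_pos.2 hε
  have hL' : (1 : ℝ) ≤ q.numLoc := by exact_mod_cast hL
  have hκ' : (0 : ℝ) ≤ κ := Nat.cast_nonneg κ
  push_cast
  calc (q.numLoc : ℝ) * (κ * q.numLoc + κ) ≤ 2 * κ * (q.numLoc : ℝ) ^ 2 := by
        nlinarith [mul_nonneg hκ' (mul_nonneg (zero_le_one.trans hL') (sub_nonneg.2 hL'))]
    _ ≤ 2 * κ * (144 * ((κ : ℝ) ^ 2 * (ε⁻¹) ^ 3 * Real.log (1 / ε))) ^ 2 := by gcongr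
    _ = 41472 * ((κ : ℝ) ^ 5 * (ε⁻¹) ^ 6 * Real.log (1 / ε) ^ 2) := by ring
    _ ≤ 50000 * ((k : ℝ) ^ 5 * (ε⁻¹) ^ 6 * Real.log (1 / ε) ^ 2) := by gcongr; norm_num

/-- Here `W < 2 / ε ≤ (1 / ε)²`, and `2 m ≤ 3 / ε`. -/
theorem spread_bound (hε : 0 < ε) (hε2 : ε ≤ 1 / 2) :
    ((2 : ℝ) ^ wOf ε) ^ mOf ε ≤ (1 / ε) ^ ((50000 : ℝ) / ε) := by
  have h1 : (1 : ℝ) ≤ 1 / ε := by rw [le_div_iff₀ hε]; linarith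
  have h2 : (2 : ℝ) ^ wOf ε ≤ (1 / ε) ^ 2 := by
    have := ((lt_div_iff₀ hε).2 (pow_wOf_lt hε hε2)).le
    refine this.trans ?_
    rw [div_pow, div_le_div_iff₀ hε (by positivity)]
    nlinarith
  calc ((2 : ℝ) ^ wOf ε) ^ mOf ε ≤ ((1 / ε) ^ 2) ^ mOf ε := by gcongr
    _ = (1 / ε) ^ ((2 * mOf ε : ℕ) : ℝ) := by rw [Real.rpow_natCast, pow_mul]
    _ ≤ _ := by
      refine Real.rpow_le_rpow_of_exponent_le h1 ?_
      rw [le_div_iff₀ hε]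
      push_cast
      linarith [mOf_le hε hε2]

/-- Factor in the running time that depends on `ε` only. -/
noncomputable def timeFactor (ε : ℝ) : ℝ :=
  (2 * (1 + Real.log (1 / ε) / Real.log 2) + 3 + mOf ε + wOf ε) / Real.log 2

theorem timeFactor_nonneg (hε : 0 < ε) (hε2 : ε ≤ 1 / 2) : 0 ≤ timeFactor ε := by
  have h0 := Real.log_pos one_lt_two
  have hl : 0 < Real.log (1 / ε) := h0.trans_le (log_inv_ge hε hε2)
  unfold timeFactor
  positivity

/-- The work per point, apart from output, is proportional to this sum. Use `log (n/ε) ≤ log (n + 1)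
+ log (1/ε)`; terms depending on `ε` only are absorbed by `log (n + 1) ≥ log 2`. -/
theorem sum_params_le (hε : 0 < ε) (hε2 : ε ≤ 1 / 2) {k n : ℕ} (hk : 1 ≤ k) (hkn : k ≤ n) :
    ((JOf ε n + mOf ε + wOf ε + hOf ε k + 1 : ℕ) : ℝ) ≤ timeFactor ε * Real.log (n + 1) := by
  have h0 := Real.log_pos one_lt_two
  have h1 := log_inv_ge hε hε2
  have hl : 0 < Real.log (1 / ε) := h0.trans_le h1
  have hn : 1 ≤ n := hk.trans hkn
  have hn' : (1 : ℝ) ≤ n := by exact_mod_cast hn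
  have hJ := JOf_le_log hε hε2 hn
  have hh := hOf_le_log hε hε2 hk hkn
  have h2 : Real.log 2 ≤ Real.log (n + 1) := Real.log_le_log two_pos (by linarith)
  have h3 : Real.log (n / ε) ≤ Real.log (n + 1) + Real.log (1 / ε) := by
    rw [← Real.log_mul (by positivity) (by positivity), mul_one_div]
    refine Real.log_le_log (by positivity) ?_
    gcongr
    linarith
  have h4 : Real.log (n / ε) / Real.log (1 / ε) ≤ Real.log (n / ε) / Real.log 2 :=
    div_le_div_of_nonneg_left (hl.le.trans (log_inv_le_log_div hε hn)) h0 h1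
  have h5 : Real.log (n / ε) / Real.log 2 ≤
      (1 + Real.log (1 / ε) / Real.log 2) * Real.log (n + 1) / Real.log 2 := by
    refine div_le_div_of_nonneg_right (h3.trans ?_) h0.le
    have : Real.log (1 / ε) ≤ Real.log (1 / ε) / Real.log 2 * Real.log (n + 1) := by
      rw [div_mul_eq_mul_div, le_div_iff₀ h0]
      exact mul_le_mul_of_nonneg_left h2 hl.le
    linarith
  have h6 : (3 + mOf ε + wOf ε : ℝ) ≤ (3 + mOf ε + wOf ε : ℝ) * Real.log (n + 1) / Real.log 2 := by
    rw [le_div_iff₀ h0]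
    exact mul_le_mul_of_nonneg_left h2 (by positivity)
  have h7 : timeFactor ε * Real.log (n + 1) =
      2 * ((1 + Real.log (1 / ε) / Real.log 2) * Real.log (n + 1) / Real.log 2) +
      (3 + mOf ε + wOf ε : ℝ) * Real.log (n + 1) / Real.log 2 := by
    unfold timeFactor; ring
  rw [h7]
  push_cast
  linarith

end

theorem valid_paramsOf {ε : ℝ} (hε : 0 < ε) (hε2 : ε ≤ 1 / 2) {k : ℕ} (hk : 1 ≤ k) {P : List Plane}
    (hP : P ≠ []) (h0 : ∀ p ∈ P, p ≠ 0) :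
    (paramsOf ε k P).Valid ε (min k P.length) P.length ∧ (∀ p ∈ P, ‖p‖ ≤ (paramsOf ε k P).R) ∧
      ∃ p ∈ P, ‖p‖ = (paramsOf ε k P).R := by
  have hn : 1 ≤ P.length := List.length_pos_iff.2 hP
  have hle : ∀ p ∈ P, ‖p‖ ≤ maxNorm P P.length := by
    intro p hp
    obtain ⟨i, hi, rfl⟩ := List.mem_iff_getElem.1 hp
    have := le_maxNorm P P.length i hi
    rwa [List.getD_eq_getElem _ _ hi] at this
  have hpos : 0 < maxNorm P P.length := by
    obtain ⟨p, hp⟩ := List.exists_mem_of_ne_nil P hP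
    exact (norm_pos_iff.2 (h0 p hp)).trans_le (hle p hp)
  have hκ : 1 ≤ min k P.length := le_min hk hn
  refine ⟨⟨hε, hε2, hκ, hn, hpos, wOf_pos hε hε2, wOf_spec hε, mOf_pos hε, mOf_spec hε,
    JOf_spec hε hε2 _, hOf_pos hε hε2 hκ, hOf_spec hε _⟩, hle, ?_⟩
  rcases exists_maxNorm P P.length with h | ⟨j, hj, e⟩
  · exact absurd h hpos.ne'
  · refine ⟨P.getD j 0, ?_, e⟩
    rw [List.getD_eq_getElem _ _ hj]; exact List.getElem_mem hj

end TourCover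


/-! ### Capping the capacity, and properties of the computed instances -/

namespace TourCover

/-- A capacity above the number of points is no restriction. -/
theorem isTourCover_min_iff {k n : ℕ} {P : List Plane} (hP : P.length ≤ n) {U : List (List ℕ)} :
    IsTourCover (min k n) P U ↔ IsTourCover k P U := by
  constructor
  · intro h
    exact ⟨h.index_lt, h.nodup, fun t ht => (h.length_le t ht).trans (min_le_left _ _), h.covers⟩
  · intro h
    refine ⟨h.index_lt, h.nodup, fun t ht => le_min (h.length_le t ht) ?_, h.covers⟩
    -- A tour visits no index twice, so it has at most as many vertices as there are points.
    rw [← List.toFinset_card_of_nodup (h.nodup t ht), ← Finset.card_range n]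
    refine Finset.card_le_card fun i hi => ?_
    exact Finset.mem_range.2 ((h.index_lt t ht i (List.mem_toFinset.1 hi)).trans_le hP)

theorem opt_min {k n : ℕ} {P : List Plane} (hP : P.length ≤ n) : opt (min k n) P = opt k P := by
  simp only [opt, isTourCover_min_iff hP]

theorem isApproxCover_min_iff {c : ℝ} {k n : ℕ} {P : List Plane} (hP : P.length ≤ n)
    {U : List (List ℕ)} : IsApproxCover c (min k n) P U ↔ IsApproxCover c k P U := by
  rw [IsApproxCover, IsApproxCover, isTourCover_min_iff hP, opt_min hP]

/-- The instances computed by the reduction. -/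
noncomputable def instances (ε : ℝ) (k : ℕ) (P : List Plane) : List (List Plane) :=
  (List.range (JOf ε P.length + mOf ε)).map ((paramsOf ε k P).inst (min k P.length) P)

/-- The tours obtained from covers of the blocks in the residue class `j`. -/
noncomputable def classTours (ε : ℝ) (k : ℕ) (P : List Plane) (Us : List (List (List ℕ))) (j : ℕ) :
    List (List ℕ) :=
  ((List.range (JOf ε P.length + mOf ε)).filter fun b => b % mOf ε = j).flatMap fun b =>
    (Us.getD b []).map (List.map fun p =>
      ((paramsOf ε k P).kept (min k P.length) P b).getD p 0)

theorem instances_spec {ε : ℝ} (hε : 0 < ε) (hε2 : ε ≤ 1 / 2) {k : ℕ} (hk : 1 ≤ k) {P : List Plane}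
    (hP : P ≠ []) (h0 : ∀ p ∈ P, p ≠ 0) :
    ((instances ε k P).length : ℝ) ≤
      50000 * (ε⁻¹ * Real.log (P.length / ε) / Real.log (1 / ε)) ∧
    (instances ε k P).Pairwise List.Disjoint ∧
    ∀ I ∈ instances ε k P, (∀ p ∈ I, p ≠ 0) ∧
      (I.length : ℝ) ≤ 50000 * ((k : ℝ) ^ 5 * (ε⁻¹) ^ 6 * Real.log (1 / ε) ^ 2) ∧
      ∀ p ∈ I, ∀ q ∈ I, ‖p‖ ≤ (1 / ε) ^ ((50000 : ℝ) / ε) * ‖q‖ := by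
  obtain ⟨hv, hR, -⟩ := valid_paramsOf hε hε2 hk hP h0
  have hn : 1 ≤ P.length := List.length_pos_iff.2 hP
  refine ⟨?_, ?_, ?_⟩
  · rw [instances, List.length_map, List.length_range]
    exact numBlocks_le hε hε2 hn
  · rw [instances, List.pairwise_map]
    exact List.nodup_range.imp fun hb => Params.inst_disjoint hv hR hb
  · intro I hI
    obtain ⟨b, -, rfl⟩ := List.mem_map.1 hI
    refine ⟨fun p hp => Params.inst_ne_zero hv h0 hR hp, ?_, ?_⟩
    · refine le_trans ?_ (length_bound hε hε2 hv.k_pos (min_le_left k P.length)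
        (q := paramsOf ε k P) rfl rfl rfl)
      exact_mod_cast Params.length_inst_le hv h0 hR b
    · intro p hp r hr
      refine (Params.inst_spread hv hR hp hr).trans ?_
      exact mul_le_mul_of_nonneg_right (spread_bound hε hε2) (norm_nonneg r)

theorem classTours_approx {ε : ℝ} (hε : 0 < ε) (hε2 : ε ≤ 1 / 2) {k : ℕ} (hk : 1 ≤ k)
    {P : List Plane} (hP : P ≠ []) (h0 : ∀ p ∈ P, p ≠ 0) {Us : List (List (List ℕ))}
    (hUs : List.Forall₂ (fun I U => IsApproxCover (1 + ε) k I U) (instances ε k P) Us) {j : ℕ}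
    (hj : j < mOf ε) (hmin : ∀ j' < mOf ε, coverLength P (classTours ε k P Us j) ≤
      coverLength P (classTours ε k P Us j')) :
    IsApproxCover (1 + 50000 * ε) k P
      ((paramsOf ε k P).fixedTours (min k P.length) P ++ classTours ε k P Us j) := by
  obtain ⟨hv, hR, hR'⟩ := valid_paramsOf hε hε2 hk hP h0
  have plan := Params.isPlan hv h0 hR hR'
  have hlen : Us.length = JOf ε P.length + mOf ε := by
    rw [← hUs.length_eq, instances, List.length_map, List.length_range]
  have h := plan.approx rfl (fun i _ => rfl) (Us := Us) (fun b hb => by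
    have hb' : b < Us.length := by rw [hlen]; exact hb
    have := hUs.get (i := b) (by rw [hUs.length_eq]; exact hb') hb'
    simp only [List.get_eq_getElem, instances, List.getElem_map, List.getElem_range] at this
    rw [List.getD_eq_getElem _ _ hb']
    refine (isApproxCover_min_iff ?_).2 this
    rw [List.length_map, keptList]
    exact (List.length_filter_le _ _).trans (by simp)) hj hmin
  rw [isApproxCover_min_iff le_rfl] at h
  refine ⟨h.1, h.2.trans (mul_le_mul_of_nonneg_right (by linarith) ?_)⟩
  obtain ⟨U, hU⟩ := exists_tourCover hk P
  refine le_csInf ⟨_, U, hU, rfl⟩ ?_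
  rintro _ ⟨V, -, rfl⟩
  exact lengthOf_nonneg _ _

end TourCover


namespace TourCover

/-! ## Total correctness of programs -/

/-- Started in `s`, the program `p` halts after a number of steps and in a memory related
by `Q`. -/
def WP (p : Prog) (s : Store) (Q : ℕ → Store → Prop) : Prop := ∃ t s', Exec p s t s' ∧ Q t s'

theorem WP.mono {p : Prog} {s : Store} {Q Q' : ℕ → Store → Prop} (h : WP p s Q)
    (hQ : ∀ t s', Q t s' → Q' t s') : WP p s Q' :=
  let ⟨t, s', h1, h2⟩ := h
  ⟨t, s', h1, hQ t s' h2⟩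

@[simp] theorem wp_skip {s : Store} {Q : ℕ → Store → Prop} : WP .skip s Q ↔ Q 1 s := by
  constructor
  · rintro ⟨t, s', h, hQ⟩; cases h; exact hQ
  · intro h; exact ⟨_, _, .skip s, h⟩

@[simp] theorem wp_setNReg {x : ℕ} {e : NExp} {s : Store} {Q : ℕ → Store → Prop} :
    WP (.setNReg x e) s Q ↔
      Q (e.cost + 1) { s with nreg := Function.update s.nreg x (e.eval s) } := by
  constructor
  · rintro ⟨t, s', h, hQ⟩; cases h; exact hQ
  · intro h; exact ⟨_, _, .setNReg x e s, h⟩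

@[simp] theorem wp_setRReg {x : ℕ} {e : RExp} {s : Store} {Q : ℕ → Store → Prop} :
    WP (.setRReg x e) s Q ↔
      Q (e.cost + 1) { s with rreg := Function.update s.rreg x (e.eval s) } := by
  constructor
  · rintro ⟨t, s', h, hQ⟩; cases h; exact hQ
  · intro h; exact ⟨_, _, .setRReg x e s, h⟩

@[simp] theorem wp_setNArr {a : ℕ} {i e : NExp} {s : Store} {Q : ℕ → Store → Prop} :
    WP (.setNArr a i e) s Q ↔ Q (i.cost + e.cost + 1)
      { s with
        narr := Function.update s.narr a (Function.update (s.narr a) (i.eval s) (e.eval s)) } := by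
  constructor
  · rintro ⟨t, s', h, hQ⟩; cases h; exact hQ
  · intro h; exact ⟨_, _, .setNArr a i e s, h⟩

@[simp] theorem wp_setRArr {a : ℕ} {i : NExp} {e : RExp} {s : Store} {Q : ℕ → Store → Prop} :
    WP (.setRArr a i e) s Q ↔ Q (i.cost + e.cost + 1)
      { s with
        rarr := Function.update s.rarr a (Function.update (s.rarr a) (i.eval s) (e.eval s)) } := by
  constructor
  · rintro ⟨t, s', h, hQ⟩; cases h; exact hQ
  · intro h; exact ⟨_, _, .setRArr a i e s, h⟩

theorem wp_seq {p q : Prog} {s : Store} {Q : ℕ → Store → Prop} :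
    WP (.seq p q) s Q ↔ WP p s fun t s' => WP q s' fun t' s'' => Q (t + t') s'' := by
  constructor
  · rintro ⟨t, s', h, hQ⟩; cases h with | seq h1 h2 => exact ⟨_, _, h1, _, _, h2, hQ⟩
  · rintro ⟨t, s', h1, t', s'', h2, hQ⟩; exact ⟨_, _, .seq h1 h2, hQ⟩

theorem wp_ite {b : BExp} {p q : Prog} {s : Store} {Q : ℕ → Store → Prop} :
    WP (.ite b p q) s Q ↔ (b.eval s → WP p s fun t s' => Q (b.cost + t) s') ∧
      (¬ b.eval s → WP q s fun t s' => Q (b.cost + t) s') := by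
  constructor
  · rintro ⟨t, s', h, hQ⟩
    cases h with
    | iteTrue hb h1 => exact ⟨fun _ => ⟨_, _, h1, hQ⟩, fun h => absurd hb h⟩
    | iteFalse hb h1 => exact ⟨fun h => absurd h hb, fun _ => ⟨_, _, h1, hQ⟩⟩
  · rintro ⟨h1, h2⟩
    by_cases hb : b.eval s
    · obtain ⟨t, s', h, hQ⟩ := h1 hb; exact ⟨_, _, .iteTrue hb h, hQ⟩
    · obtain ⟨t, s', h, hQ⟩ := h2 hb; exact ⟨_, _, .iteFalse hb h, hQ⟩

/-- A loop with `N` iterations and an invariant that includes the time spent. -/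
theorem wp_while {b : BExp} {p : Prog} (N : ℕ) (I : ℕ → ℕ → Store → Prop)
    (hstep : ∀ i t s, i < N → I i t s →
      b.eval s ∧ WP p s fun t' s' => I (i + 1) (t + (b.cost + t')) s')
    (hend : ∀ t s, I N t s → ¬ b.eval s) {s : Store} {Q : ℕ → Store → Prop} (h0 : I 0 0 s)
    (hQ : ∀ t s', I N t s' → Q (t + b.cost) s') : WP (.while b p) s Q := by
  suffices H : ∀ d i t s, i + d = N → I i t s →
      ∃ t' s', Exec (.while b p) s t' s' ∧ ∃ u, t + t' = u + b.cost ∧ I N u s' by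
    obtain ⟨t', s', he, u, hu, hI⟩ := H N 0 0 s (by omega) h0
    refine ⟨t', s', he, ?_⟩
    rw [zero_add] at hu
    rw [hu]
    exact hQ u s' hI
  intro d
  induction d with
  | zero =>
    intro i t s hi hI
    rw [add_zero] at hi
    subst hi
    exact ⟨_, s, .whileFalse (hend t s hI), t, rfl, hI⟩
  | succ d ih =>
    intro i t s hi hI
    obtain ⟨hb, t1, s1, h1, hI1⟩ := hstep i t s (by omega) hI
    obtain ⟨t2, s2, h2, u, hu, hI2⟩ := ih (i + 1) _ s1 (by omega) hI1
    exact ⟨_, s2, .whileTrue hb h1 h2, u, by omega, hI2⟩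

/-- Sequential composition of a list of programs. -/
def block : List Prog → Prog
  | [] => .skip
  | [p] => p
  | p :: l => .seq p (block l)

@[simp] theorem wp_block_singleton {p : Prog} {s : Store} {Q : ℕ → Store → Prop} :
    WP (block [p]) s Q ↔ WP p s Q := Iff.rfl

@[simp] theorem wp_block_cons {p q : Prog} {l : List Prog} {s : Store} {Q : ℕ → Store → Prop} :
    WP (block (p :: q :: l)) s Q ↔
      WP p s fun t s' => WP (block (q :: l)) s' fun t' s'' => Q (t + t') s'' := wp_seq

/-! ### Memory that a program does not change -/

def Prog.nregs : Prog → List ℕ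
  | .setNReg x _ => [x]
  | .seq p q => p.nregs ++ q.nregs
  | .ite _ p q => p.nregs ++ q.nregs
  | .while _ p => p.nregs
  | _ => []

def Prog.rregs : Prog → List ℕ
  | .setRReg x _ => [x]
  | .seq p q => p.rregs ++ q.rregs
  | .ite _ p q => p.rregs ++ q.rregs
  | .while _ p => p.rregs
  | _ => []

def Prog.narrs : Prog → List ℕ
  | .setNArr a _ _ => [a]
  | .seq p q => p.narrs ++ q.narrs
  | .ite _ p q => p.narrs ++ q.narrs
  | .while _ p => p.narrs
  | _ => []

def Prog.rarrs : Prog → List ℕ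
  | .setRArr a _ _ => [a]
  | .seq p q => p.rarrs ++ q.rarrs
  | .ite _ p q => p.rarrs ++ q.rarrs
  | .while _ p => p.rarrs
  | _ => []

/-- The memories `s` and `s'` agree outside the given registers and arrays. -/
structure AgreeOff (nr rr na ra : List ℕ) (s s' : Store) : Prop where
  nreg : ∀ x, x ∉ nr → s'.nreg x = s.nreg x
  rreg : ∀ x, x ∉ rr → s'.rreg x = s.rreg x
  narr : ∀ a, a ∉ na → s'.narr a = s.narr a
  rarr : ∀ a, a ∉ ra → s'.rarr a = s.rarr a

abbrev Frame (p : Prog) : Store → Store → Prop := AgreeOff p.nregs p.rregs p.narrs p.rarrs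

theorem AgreeOff.weaken {nr rr na ra nr' rr' na' ra' : List ℕ} {s s' : Store}
    (h : AgreeOff nr rr na ra s s') (h1 : nr ⊆ nr') (h2 : rr ⊆ rr') (h3 : na ⊆ na')
    (h4 : ra ⊆ ra') : AgreeOff nr' rr' na' ra' s s' :=
  ⟨fun x hx => h.nreg x fun h' => hx (h1 h'), fun x hx => h.rreg x fun h' => hx (h2 h'),
    fun x hx => h.narr x fun h' => hx (h3 h'), fun x hx => h.rarr x fun h' => hx (h4 h')⟩

theorem AgreeOff.trans {nr rr na ra : List ℕ} {s s' s'' : Store} (h : AgreeOff nr rr na ra s s')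
    (h' : AgreeOff nr rr na ra s' s'') : AgreeOff nr rr na ra s s'' :=
  ⟨fun x hx => (h'.nreg x hx).trans (h.nreg x hx), fun x hx => (h'.rreg x hx).trans (h.rreg x hx),
    fun x hx => (h'.narr x hx).trans (h.narr x hx), fun x hx => (h'.rarr x hx).trans (h.rarr x hx)⟩

theorem Exec.frame {p : Prog} {s s' : Store} {t : ℕ} (h : Exec p s t s') : Frame p s s' := by
  induction h with
  | skip s => exact ⟨fun _ _ => rfl, fun _ _ => rfl, fun _ _ => rfl, fun _ _ => rfl⟩
  | setNReg x e s =>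
    refine ⟨fun y hy => ?_, fun _ _ => rfl, fun _ _ => rfl, fun _ _ => rfl⟩
    exact Function.update_of_ne (by simpa [Prog.nregs] using hy) _ _
  | setRReg x e s =>
    refine ⟨fun _ _ => rfl, fun y hy => ?_, fun _ _ => rfl, fun _ _ => rfl⟩
    exact Function.update_of_ne (by simpa [Prog.rregs] using hy) _ _
  | setNArr a i e s =>
    refine ⟨fun _ _ => rfl, fun _ _ => rfl, fun y hy => ?_, fun _ _ => rfl⟩
    exact Function.update_of_ne (by simpa [Prog.narrs] using hy) _ _
  | setRArr a i e s =>
    refine ⟨fun _ _ => rfl, fun _ _ => rfl, fun _ _ => rfl, fun y hy => ?_⟩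
    exact Function.update_of_ne (by simpa [Prog.rarrs] using hy) _ _
  | seq _ _ ih1 ih2 =>
    refine (ih1.weaken ?_ ?_ ?_ ?_).trans (ih2.weaken ?_ ?_ ?_ ?_) <;> intro x hx <;>
      simp [Prog.nregs, Prog.rregs, Prog.narrs, Prog.rarrs, hx]
  | iteTrue _ _ ih =>
    refine ih.weaken ?_ ?_ ?_ ?_ <;> intro x hx <;>
      simp [Prog.nregs, Prog.rregs, Prog.narrs, Prog.rarrs, hx]
  | iteFalse _ _ ih =>
    refine ih.weaken ?_ ?_ ?_ ?_ <;> intro x hx <;>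
      simp [Prog.nregs, Prog.rregs, Prog.narrs, Prog.rarrs, hx]
  | whileFalse _ => exact ⟨fun _ _ => rfl, fun _ _ => rfl, fun _ _ => rfl, fun _ _ => rfl⟩
  | whileTrue _ _ _ ih1 ih2 => exact AgreeOff.trans ih1 ih2

theorem WP.frame {p : Prog} {s : Store} {Q : ℕ → Store → Prop} (h : WP p s Q) :
    WP p s fun t s' => Q t s' ∧ Frame p s s' :=
  let ⟨t, s', h1, h2⟩ := h
  ⟨t, s', h1, h2, h1.frame⟩

attribute [simp] NExp.eval RExp.eval BExp.eval NExp.cost RExp.cost BExp.cost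

end TourCover


namespace TourCover

/-! ## Computing the parameters -/

/-- Use of the working memory: natural register 10 runs over the points, 12 assembles octaves and
keys, 15 counts the vertices of output tours, 16 runs over the blocks and 23 over the given tours.
Natural arrays 6 to 10 hold rings, links, tops and heights of the stacks, and marks of fixed points;
array 11 holds original indices. Real arrays 4 to 7 hold norms, `alpha`, `beta` and the costs of the
classes. -/
def normLoop : Prog := block [
  .setNReg 10 (.const 0),
  .setRReg 1 (.ofNat (.const 0)),
  .while (.nlt (.reg 10) (.reg 0)) (block [
    .setRArr 4 (.reg 10) (.sqrt (.add (.mul (.arr 0 (.reg 10)) (.arr 0 (.reg 10)))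
      (.mul (.arr 1 (.reg 10)) (.arr 1 (.reg 10))))),
    .ite (.rlt (.reg 1) (.arr 4 (.reg 10))) (.setRReg 1 (.arr 4 (.reg 10))) .skip,
    .setNReg 10 (.add (.reg 10) (.const 1))])]

theorem wp_normLoop (P : List Plane) (s : Store) (h0 : s.nreg 0 = P.length)
    (hx : ∀ i, s.rarr 0 i = P.getD i 0 0) (hy : ∀ i, s.rarr 1 i = P.getD i 0 1) :
    WP normLoop s fun t s' => t ≤ 40 * (P.length + 1) ∧ s'.rreg 1 = maxNorm P P.length ∧
      ∀ i < P.length, s'.rarr 4 i = ‖P.getD i 0‖ := by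
  unfold normLoop
  simp only [wp_block_cons, wp_block_singleton, wp_setNReg, wp_setRReg, NExp.eval, RExp.eval]
  refine wp_while P.length (fun i t s' => t ≤ 40 * i ∧ s'.nreg 0 = P.length ∧ s'.nreg 10 = i ∧
    s'.rreg 1 = maxNorm P i ∧ (∀ j < i, s'.rarr 4 j = ‖P.getD j 0‖) ∧
    s'.rarr 0 = s.rarr 0 ∧ s'.rarr 1 = s.rarr 1) ?_ ?_ ?_ ?_
  · rintro i t s' hi ⟨ht, e0, e10, e1, e4, ex, ey⟩
    refine ⟨by simpa [e0, e10] using hi, ?_⟩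
    have hn : √(s.rarr 0 i * s.rarr 0 i + s.rarr 1 i * s.rarr 1 i) = ‖P.getD i 0‖ := by
      rw [hx, hy, norm_eq_sqrt]
    have key : ∀ j ≤ i, Function.update (s'.rarr 4) i ‖P.getD i 0‖ j = ‖P.getD j 0‖ := by
      intro j hj
      rcases hj.eq_or_lt with rfl | hj
      · simp
      · rw [Function.update_of_ne hj.ne, e4 j hj]
    simp only [wp_block_cons, wp_block_singleton, wp_setNReg, wp_setRReg, wp_setRArr, wp_ite,
      wp_skip]
    simp [e0, e10, e1, ex, ey, hn, maxNorm, -List.getD_eq_getElem?_getD]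
    exact ⟨fun h => ⟨by omega, fun h' => absurd h h'.not_gt, key⟩,
      fun h => ⟨by omega, fun h' => absurd h' h.not_gt, key⟩⟩
  · rintro t s' ⟨ht, e0, e10, -⟩
    simp [e0, e10]
  · simp [h0, maxNorm]
  · rintro t s' ⟨ht, e0, e10, e1, e4, -⟩
    exact ⟨by simp; omega, e1, e4⟩

def widthLoop : Prog := block [
  .setNReg 6 (.const 0),
  .setRReg 2 (.ofNat (.const 1)),
  .while (.rlt (.mul (.reg 2) (.reg 0)) (.ofNat (.const 1))) (block [
    .setRReg 2 (.add (.reg 2) (.reg 2)),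
    .setNReg 6 (.add (.reg 6) (.const 1))])]

theorem wp_widthLoop {ε : ℝ} (hε : 0 < ε) (s : Store) (h0 : s.rreg 0 = ε) :
    WP widthLoop s fun t s' => t ≤ 40 * (wOf ε + 1) ∧ s'.nreg 6 = wOf ε ∧
      s'.rreg 2 = 2 ^ wOf ε := by
  unfold widthLoop
  simp only [wp_block_cons, wp_block_singleton, wp_setNReg, wp_setRReg, NExp.eval, RExp.eval]
  refine wp_while (wOf ε) (fun i t s' => t ≤ 40 * i ∧ s'.rreg 0 = ε ∧ s'.nreg 6 = i ∧
    s'.rreg 2 = 2 ^ i) ?_ ?_ ?_ ?_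
  · rintro i t s' hi ⟨ht, e0, e6, e2⟩
    refine ⟨by simpa [e0, e2] using lt_of_lt_wOf hi, ?_⟩
    simp [e0, e6, e2, pow_succ]
    exact ⟨by omega, by ring⟩
  · rintro t s' ⟨ht, e0, e6, e2⟩
    simpa [e0, e2] using wOf_spec hε
  · simp [h0]
  · rintro t s' ⟨ht, e0, e6, e2⟩
    exact ⟨by simp; omega, e6, e2⟩

def blockLoop : Prog := block [
  .setNReg 7 (.const 0),
  .while (.rlt (.mul (.ofNat (.reg 7)) (.reg 0)) (.ofNat (.const 1)))
    (.setNReg 7 (.add (.reg 7) (.const 1)))]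

theorem wp_blockLoop {ε : ℝ} (hε : 0 < ε) (s : Store) (h0 : s.rreg 0 = ε) :
    WP blockLoop s fun t s' => t ≤ 40 * (mOf ε + 1) ∧ s'.nreg 7 = mOf ε := by
  unfold blockLoop
  simp only [wp_block_cons, wp_block_singleton, wp_setNReg, NExp.eval]
  refine wp_while (mOf ε) (fun i t s' => t ≤ 40 * i ∧ s'.rreg 0 = ε ∧ s'.nreg 7 = i) ?_ ?_ ?_ ?_
  · rintro i t s' hi ⟨ht, e0, e7⟩
    refine ⟨by simpa [e0, e7] using lt_of_lt_mOf hi, ?_⟩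
    simp [e0, e7]
    omega
  · rintro t s' ⟨ht, e0, e7⟩
    simpa [e0, e7] using mOf_spec hε
  · simp [h0]
  · rintro t s' ⟨ht, e0, e7⟩
    exact ⟨by simp; omega, e7⟩

def ringsLoop : Prog := block [
  .setNReg 8 (.const 0),
  .setRReg 7 (.ofNat (.const 1)),
  .while (.rlt (.mul (.reg 7) (.reg 0)) (.ofNat (.reg 0))) (block [
    .setRReg 7 (.mul (.reg 7) (.reg 2)),
    .setNReg 8 (.add (.reg 8) (.const 1))])]

theorem wp_ringsLoop {ε : ℝ} (hε : 0 < ε) (hε2 : ε ≤ 1 / 2) {n : ℕ} (s : Store) (h0 : s.rreg 0 = ε)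
    (hn : s.nreg 0 = n) (h2 : s.rreg 2 = 2 ^ wOf ε) :
    WP ringsLoop s fun t s' => t ≤ 40 * (JOf ε n + 1) ∧ s'.nreg 8 = JOf ε n := by
  unfold ringsLoop
  simp only [wp_block_cons, wp_block_singleton, wp_setNReg, wp_setRReg, NExp.eval, RExp.eval]
  refine wp_while (JOf ε n) (fun i t s' => t ≤ 40 * i ∧ s'.rreg 0 = ε ∧ s'.nreg 0 = n ∧
    s'.rreg 2 = 2 ^ wOf ε ∧ s'.nreg 8 = i ∧ s'.rreg 7 = (2 ^ wOf ε) ^ i) ?_ ?_ ?_ ?_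
  · rintro i t s' hi ⟨ht, e0, en, e2, e8, e7⟩
    refine ⟨by simpa [e0, en, e7] using lt_of_lt_JOf hi, ?_⟩
    simp [e0, en, e2, e7, e8, pow_succ]
    omega
  · rintro t s' ⟨ht, e0, en, e2, e8, e7⟩
    simpa [e0, en, e7] using JOf_spec hε hε2 n
  · simp [h0, hn, h2]
  · rintro t s' ⟨ht, e0, en, e2, e8, e7⟩
    exact ⟨by simp; omega, e8⟩

def digitsLoop : Prog := block [
  .setNReg 9 (.const 0),
  .setRReg 3 (.ofNat (.const 1)),
  .while (.rlt (.mul (.reg 3) (.reg 0)) (.ofNat (.reg 5))) (block [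
    .setRReg 3 (.add (.reg 3) (.reg 3)),
    .setNReg 9 (.add (.reg 9) (.const 1))])]

theorem wp_digitsLoop {ε : ℝ} (hε : 0 < ε) {k : ℕ} (s : Store) (h0 : s.rreg 0 = ε)
    (hk : s.nreg 5 = k) :
    WP digitsLoop s fun t s' => t ≤ 40 * (hOf ε k + 1) ∧ s'.nreg 9 = hOf ε k ∧
      s'.rreg 3 = 2 ^ hOf ε k := by
  unfold digitsLoop
  simp only [wp_block_cons, wp_block_singleton, wp_setNReg, wp_setRReg, NExp.eval, RExp.eval]
  refine wp_while (hOf ε k) (fun i t s' => t ≤ 40 * i ∧ s'.rreg 0 = ε ∧ s'.nreg 5 = k ∧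
    s'.nreg 9 = i ∧ s'.rreg 3 = 2 ^ i) ?_ ?_ ?_ ?_
  · rintro i t s' hi ⟨ht, e0, e5, e9, e3⟩
    refine ⟨by simpa [e0, e5, e3] using lt_of_lt_hOf hi, ?_⟩
    simp [e0, e5, e9, e3, pow_succ]
    exact ⟨by omega, by ring⟩
  · rintro t s' ⟨ht, e0, e5, e9, e3⟩
    simpa [e0, e5, e3] using hOf_spec hε k
  · simp [h0, hk]
  · rintro t s' ⟨ht, e0, e5, e9, e3⟩
    exact ⟨by simp; omega, e9, e3⟩

/-- The quantities that stay fixed after the parameters have been computed: the parameters `q`,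
the capacity `κ` and the points. -/
structure Ctx (q : Params) (κ : ℕ) (P : List Plane) (s : Store) : Prop where
  n : s.nreg 0 = P.length
  cap : s.nreg 5 = κ
  w : s.nreg 6 = q.w
  m : s.nreg 7 = q.m
  J : s.nreg 8 = q.J
  h : s.nreg 9 = q.h
  R : s.rreg 1 = q.R
  W : s.rreg 2 = q.W
  H : s.rreg 3 = q.H
  thr : s.rreg 4 = (κ * q.numLoc + κ : ℕ)
  x : ∀ i, s.rarr 0 i = P.getD i 0 0
  y : ∀ i, s.rarr 1 i = P.getD i 0 1
  norm : ∀ i < P.length, s.rarr 4 i = ‖P.getD i 0‖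

theorem Ctx.agree {q : Params} {κ : ℕ} {P : List Plane} {s s' : Store} (h : Ctx q κ P s)
    {nr rr na ra : List ℕ} (hs : AgreeOff nr rr na ra s s')
    (h1 : ∀ x ∈ [0, 5, 6, 7, 8, 9], x ∉ nr) (h2 : ∀ x ∈ [1, 2, 3, 4], x ∉ rr)
    (h3 : ∀ x ∈ [0, 1, 4], x ∉ ra) : Ctx q κ P s' where
  n := by rw [hs.nreg 0 (h1 0 (by simp)), h.n]
  cap := by rw [hs.nreg 5 (h1 5 (by simp)), h.cap]
  w := by rw [hs.nreg 6 (h1 6 (by simp)), h.w]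
  m := by rw [hs.nreg 7 (h1 7 (by simp)), h.m]
  J := by rw [hs.nreg 8 (h1 8 (by simp)), h.J]
  h := by rw [hs.nreg 9 (h1 9 (by simp)), h.h]
  R := by rw [hs.rreg 1 (h2 1 (by simp)), h.R]
  W := by rw [hs.rreg 2 (h2 2 (by simp)), h.W]
  H := by rw [hs.rreg 3 (h2 3 (by simp)), h.H]
  thr := by rw [hs.rreg 4 (h2 4 (by simp)), h.thr]
  x := by rw [hs.rarr 0 (h3 0 (by simp))]; exact h.x
  y := by rw [hs.rarr 1 (h3 1 (by simp))]; exact h.y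
  norm := by rw [hs.rarr 4 (h3 4 (by simp))]; exact h.norm

theorem AgreeOff.setNReg (s : Store) (x v : ℕ) :
    AgreeOff [x] [] [] [] s { s with nreg := Function.update s.nreg x v } :=
  ⟨fun _ hy => Function.update_of_ne (by simpa using hy) _ _, fun _ _ => rfl, fun _ _ => rfl,
    fun _ _ => rfl⟩

theorem AgreeOff.setRReg (s : Store) (x : ℕ) (v : ℝ) :
    AgreeOff [] [x] [] [] s { s with rreg := Function.update s.rreg x v } :=
  ⟨fun _ _ => rfl, fun _ hy => Function.update_of_ne (by simpa using hy) _ _, fun _ _ => rfl,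
    fun _ _ => rfl⟩

theorem AgreeOff.setNArr (s : Store) (a : ℕ) (v : ℕ → ℕ) :
    AgreeOff [] [] [a] [] s { s with narr := Function.update s.narr a v } :=
  ⟨fun _ _ => rfl, fun _ _ => rfl, fun _ hy => Function.update_of_ne (by simpa using hy) _ _,
    fun _ _ => rfl⟩

theorem AgreeOff.setRArr (s : Store) (a : ℕ) (v : ℕ → ℝ) :
    AgreeOff [] [] [] [a] s { s with rarr := Function.update s.rarr a v } :=
  ⟨fun _ _ => rfl, fun _ _ => rfl, fun _ _ => rfl,
    fun _ hy => Function.update_of_ne (by simpa using hy) _ _⟩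

/-- The threshold `κ * numLoc + κ` is computed as a real number, as natural numbers cannot be
multiplied in one step. -/
def setup : Prog := block [
  .ite (.nlt (.reg 1) (.reg 0)) (.setNReg 5 (.reg 1)) (.setNReg 5 (.reg 0)),
  normLoop, widthLoop, blockLoop, ringsLoop, digitsLoop,
  .setRReg 4 (.add (.mul (.ofNat (.reg 5)) (.mul (.mul (.ofNat (.reg 7)) (.ofNat (.reg 6)))
    (.mul (.mul (.reg 3) (.reg 3)) (.ofNat (.const 8))))) (.ofNat (.reg 5)))]

theorem wp_setup {ε : ℝ} (hε : 0 < ε) (hε2 : ε ≤ 1 / 2) {k : ℕ} {P : List Plane} (s : Store)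
    (h0 : s.nreg 0 = P.length) (h1 : s.nreg 1 = k) (he : s.rreg 0 = ε)
    (hx : ∀ i, s.rarr 0 i = P.getD i 0 0) (hy : ∀ i, s.rarr 1 i = P.getD i 0 1) :
    WP setup s fun t s' => Ctx (paramsOf ε k P) (min k P.length) P s' ∧
      t ≤ 300 * (P.length + (JOf ε P.length + mOf ε + wOf ε + hOf ε (min k P.length) + 1)) := by
  have hmin : WP (.ite (.nlt (.reg 1) (.reg 0)) (.setNReg 5 (.reg 1)) (.setNReg 5 (.reg 0))) s
      fun t s' => t ≤ 10 ∧ s'.nreg 5 = min k P.length := by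
    simp [wp_ite, h0, h1]
    omega
  unfold setup
  rw [wp_block_cons]
  refine hmin.frame.mono fun t1 s1 ⟨⟨ht1, e5⟩, f1⟩ => ?_
  rw [wp_block_cons]
  refine (wp_normLoop P s1 (by rw [f1.nreg 0 (by decide), h0])
    (by rw [f1.rarr 0 (by decide)]; exact hx) (by rw [f1.rarr 1 (by decide)]; exact hy)).frame.mono
    fun t2 s2 ⟨⟨ht2, eR, en⟩, f2⟩ => ?_
  have he2 : s2.rreg 0 = ε := by rw [f2.rreg 0 (by decide), f1.rreg 0 (by decide), he]
  rw [wp_block_cons]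
  refine (wp_widthLoop hε s2 he2).frame.mono fun t3 s3 ⟨⟨ht3, ew, eW⟩, f3⟩ => ?_
  have he3 : s3.rreg 0 = ε := by rw [f3.rreg 0 (by decide), he2]
  rw [wp_block_cons]
  refine (wp_blockLoop hε s3 he3).frame.mono fun t4 s4 ⟨⟨ht4, em⟩, f4⟩ => ?_
  have he4 : s4.rreg 0 = ε := by rw [f4.rreg 0 (by decide), he3]
  have hn4 : s4.nreg 0 = P.length := by
    rw [f4.nreg 0 (by decide), f3.nreg 0 (by decide), f2.nreg 0 (by decide), f1.nreg 0 (by decide),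
      h0]
  rw [wp_block_cons]
  refine (wp_ringsLoop hε hε2 s4 he4 hn4 (by rw [f4.rreg 2 (by decide), eW])).frame.mono
    fun t5 s5 ⟨⟨ht5, eJ⟩, f5⟩ => ?_
  have he5 : s5.rreg 0 = ε := by rw [f5.rreg 0 (by decide), he4]
  have hk5 : s5.nreg 5 = min k P.length := by
    rw [f5.nreg 5 (by decide), f4.nreg 5 (by decide), f3.nreg 5 (by decide), f2.nreg 5 (by decide),
      e5]
  rw [wp_block_cons]
  refine (wp_digitsLoop hε s5 he5 hk5).frame.mono fun t6 s6 ⟨⟨ht6, eh, eH⟩, f6⟩ => ?_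
  have g5 : s6.nreg 5 = min k P.length := by rw [f6.nreg 5 (by decide), hk5]
  have g6 : s6.nreg 6 = wOf ε := by
    rw [f6.nreg 6 (by decide), f5.nreg 6 (by decide), f4.nreg 6 (by decide), ew]
  have g7 : s6.nreg 7 = mOf ε := by rw [f6.nreg 7 (by decide), f5.nreg 7 (by decide), em]
  rw [wp_block_singleton, wp_setRReg]
  refine ⟨?_, ?_⟩
  · constructor
    · simpa using (f6.nreg 0 (by decide)).trans ((f5.nreg 0 (by decide)).trans hn4)
    · simpa [paramsOf] using g5
    · simpa [paramsOf] using g6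
    · simpa [paramsOf] using g7
    · simpa [paramsOf] using (f6.nreg 8 (by decide)).trans eJ
    · simpa [paramsOf] using eh
    · simpa [paramsOf] using (f6.rreg 1 (by decide)).trans ((f5.rreg 1 (by decide)).trans
        ((f4.rreg 1 (by decide)).trans ((f3.rreg 1 (by decide)).trans eR)))
    · simpa [paramsOf, Params.W] using (f6.rreg 2 (by decide)).trans ((f5.rreg 2 (by decide)).trans
        ((f4.rreg 2 (by decide)).trans eW))
    · simpa [paramsOf, Params.H] using eH
    · simp [g5, g6, g7, eH, Params.numLoc, paramsOf, pow_succ, pow_mul]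
      left
      rw [← mul_pow]
      norm_num [mul_assoc]
    · intro i
      simpa [f6.rarr 0 (by decide), f5.rarr 0 (by decide), f4.rarr 0 (by decide),
        f3.rarr 0 (by decide), f2.rarr 0 (by decide), f1.rarr 0 (by decide)] using hx i
    · intro i
      simpa [f6.rarr 1 (by decide), f5.rarr 1 (by decide), f4.rarr 1 (by decide),
        f3.rarr 1 (by decide), f2.rarr 1 (by decide), f1.rarr 1 (by decide)] using hy i
    · intro i
      simpa [f6.rarr 4 (by decide), f5.rarr 4 (by decide), f4.rarr 4 (by decide),
        f3.rarr 4 (by decide)] using en i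
  · simp only [RExp.cost, NExp.cost]
    omega

end TourCover


namespace TourCover

/-! ## Computing the position of a point -/

def digit : Prog :=
  .ite (.rlt (.add (.reg 5) (.reg 5)) (.ofNat (.const 1)))
    (block [.setRReg 5 (.add (.reg 5) (.reg 5)), .setNReg 12 (.add (.reg 12) (.reg 12))])
    (block [.setRReg 5 (.sub (.add (.reg 5) (.reg 5)) (.ofNat (.const 1))),
      .setNReg 12 (.add (.add (.reg 12) (.reg 12)) (.const 1))])

theorem wp_digit (s : Store) (x : ℝ × ℕ) (h5 : s.rreg 5 = x.1) (h12 : s.nreg 12 = x.2) :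
    WP digit s fun t s' => t ≤ 30 ∧ s'.rreg 5 = (digitStep x).1 ∧ s'.nreg 12 = (digitStep x).2 := by
  unfold digit digitStep
  simp only [wp_ite, wp_block_cons, wp_block_singleton]
  simp [h5, h12]
  exact ⟨fun h => by simp [h], fun h => by simp [h.not_gt]⟩

def digitIter : Prog := block [
  .setNReg 13 (.const 0),
  .while (.nlt (.reg 13) (.reg 9)) (block [digit, .setNReg 13 (.add (.reg 13) (.const 1))])]

theorem wp_digitIter (s : Store) (x : ℝ × ℕ) (h : ℕ) (h9 : s.nreg 9 = h) (h5 : s.rreg 5 = x.1)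
    (h12 : s.nreg 12 = x.2) :
    WP digitIter s fun t s' => t ≤ 50 * (h + 1) ∧ s'.rreg 5 = (digitStep^[h] x).1 ∧
      s'.nreg 12 = (digitStep^[h] x).2 := by
  unfold digitIter
  simp only [wp_block_cons, wp_block_singleton, wp_setNReg, NExp.eval]
  refine wp_while h (fun i t s' => t ≤ 50 * i ∧ s'.nreg 9 = h ∧ s'.nreg 13 = i ∧
    s'.rreg 5 = (digitStep^[i] x).1 ∧ s'.nreg 12 = (digitStep^[i] x).2) ?_ ?_ ?_ ?_
  · rintro i t s' hi ⟨ht, e9, e13, e5, e12⟩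
    refine ⟨by simpa [e9, e13] using hi, ?_⟩
    rw [wp_block_cons]
    refine (wp_digit s' _ e5 e12).frame.mono fun t1 s1 ⟨⟨ht1, g5, g12⟩, f⟩ => ?_
    rw [← Function.iterate_succ_apply' digitStep] at g5 g12
    simp [g5, g12, f.nreg 9 (by decide), f.nreg 13 (by decide), e9, e13]
    omega
  · rintro t s' ⟨ht, e9, e13, -⟩
    simp [e9, e13]
  · simp [h9, h5, h12]
  · rintro t s' ⟨ht, e9, e13, e5, e12⟩
    exact ⟨by simp; omega, e5, e12⟩

/-- The product of the ring and `w`, needed for the octave, is accumulated by additions in register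
12. -/
def ringIter : Prog := block [
  .setRReg 5 (.div (.arr 4 (.reg 10)) (.reg 1)),
  .setNReg 11 (.const 0),
  .setNReg 12 (.const 0),
  .while (.and (.nlt (.reg 11) (.reg 8)) (.not (.rlt (.ofNat (.const 1)) (.mul (.reg 5) (.reg 2)))))
    (block [
      .setRReg 5 (.mul (.reg 5) (.reg 2)),
      .setNReg 11 (.add (.reg 11) (.const 1)),
      .setNReg 12 (.add (.reg 12) (.reg 6))]),
  .setNArr 6 (.reg 10) (.reg 11)]

theorem Params.le_one_of_lt_ring {q : Params} {p : Plane} {i : ℕ} (hi : i < q.ring p) :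
    ‖p‖ / q.R * q.W ^ i * q.W ≤ 1 := by
  by_contra h
  exact Nat.notMem_of_lt_sInf hi (Or.inr (not_le.1 h))

theorem wp_ringIter {q : Params} {κ : ℕ} {P : List Plane} {s : Store} (h : Ctx q κ P s) {i : ℕ}
    (hi : i < P.length) (h10 : s.nreg 10 = i) :
    WP ringIter s fun t s' => t ≤ 50 * (q.J + 1) ∧ s'.nreg 11 = q.ring (P.getD i 0) ∧
      s'.rreg 5 = q.inRing (P.getD i 0) ∧ s'.nreg 12 = q.ring (P.getD i 0) * q.w ∧
      s'.narr 6 = Function.update (s.narr 6) i (q.ring (P.getD i 0)) := by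
  unfold ringIter
  simp only [wp_block_cons, wp_block_singleton, wp_setNReg, wp_setRReg, wp_setNArr, NExp.eval,
    RExp.eval, h10, h.norm i hi, h.R]
  set p := P.getD i 0 with hp
  refine wp_while (q.ring p) (fun r t s' => t ≤ 40 * r ∧ s'.nreg 8 = q.J ∧ s'.rreg 2 = q.W ∧
    s'.nreg 6 = q.w ∧ s'.nreg 10 = i ∧ s'.nreg 11 = r ∧ s'.rreg 5 = ‖p‖ / q.R * q.W ^ r ∧
    s'.nreg 12 = r * q.w ∧ s'.narr 6 = s.narr 6) ?_ ?_ ?_ ?_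
  · rintro r t s' hr ⟨ht, e8, e2, e6, e10, e11, e5, e12, a6⟩
    refine ⟨?_, ?_⟩
    · simpa [e8, e2, e11, e5] using ⟨hr.trans_le (q.ring_le p), Params.le_one_of_lt_ring hr⟩
    · simp [e8, e2, e6, e10, e11, e5, e12, a6, pow_succ, add_mul]
      exact ⟨by omega, by ring⟩
  · rintro t s' ⟨ht, e8, e2, e6, e10, e11, e5, e12, a6⟩
    simpa [e8, e2, e11, e5, Params.inRing] using Params.one_lt_of_ring_lt (q := q) (p := p)
  · simp [h.J, h.W, h.w, h10]
  · rintro t s' ⟨ht, e8, e2, e6, e10, e11, e5, e12, a6⟩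
    have := q.ring_le p
    simp [e10, e11, e5, e12, a6, Params.inRing]
    omega

def octIter : Prog :=
  .while (.not (.rlt (.ofNat (.const 1)) (.add (.reg 5) (.reg 5)))) (block [
    .setRReg 5 (.add (.reg 5) (.reg 5)),
    .setNReg 12 (.add (.reg 12) (.const 1))])

theorem le_one_of_lt_octOf {v : ℝ} {u : ℕ} (hu : u < octOf v) : v * 2 ^ u + v * 2 ^ u ≤ 1 := by
  by_contra h
  exact Nat.notMem_of_lt_sInf hu (not_le.1 h)

theorem wp_octIter {q : Params} {p : Plane} (hw : 1 ≤ q.w) (hr : q.ring p < q.J) {s : Store}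
    (h5 : s.rreg 5 = q.inRing p) (h12 : s.nreg 12 = q.ring p * q.w) :
    WP octIter s fun t s' => t ≤ 40 * (q.w + 1) ∧ s'.rreg 5 = q.inOct p ∧
      s'.nreg 12 = q.oct p := by
  unfold octIter
  have h1 := Params.one_lt_of_ring_lt hr
  refine wp_while (octOf (q.inRing p)) (fun u t s' => t ≤ 40 * u ∧
    s'.rreg 5 = q.inRing p * 2 ^ u ∧ s'.nreg 12 = q.ring p * q.w + u) ?_ ?_ ?_ ?_
  · rintro u t s' hu ⟨ht, e5, e12⟩
    refine ⟨by simpa [e5] using le_one_of_lt_octOf hu, ?_⟩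
    simp [e5, e12, pow_succ]
    exact ⟨by omega, by ring, by omega⟩
  · rintro t s' ⟨ht, e5, e12⟩
    simpa [e5] using Params.one_lt_octOf hw h1
  · simp [h5, h12]
  · rintro t s' ⟨ht, e5, e12⟩
    have := Params.oct_lt hw hr
    exact ⟨by simp; omega, e5, e12⟩

def sideSlope : Prog := block [
  .setNReg 12 (.add (.add (.reg 12) (.reg 12)) (.add (.reg 12) (.reg 12))),
  .ite (.rlt (.mul (.arr 0 (.reg 10)) (.arr 0 (.reg 10)))
      (.mul (.arr 1 (.reg 10)) (.arr 1 (.reg 10))))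
    (block [
      .setRReg 5 (.div (.add (.div (.arr 0 (.reg 10)) (.arr 4 (.reg 10))) (.ofNat (.const 1)))
        (.ofNat (.const 2))),
      .ite (.rlt (.arr 1 (.reg 10)) (.ofNat (.const 0))) (.setNReg 12 (.add (.reg 12) (.const 3)))
        (.setNReg 12 (.add (.reg 12) (.const 2)))])
    (block [
      .setRReg 5 (.div (.add (.div (.arr 1 (.reg 10)) (.arr 4 (.reg 10))) (.ofNat (.const 1)))
        (.ofNat (.const 2))),
      .ite (.rlt (.arr 0 (.reg 10)) (.ofNat (.const 0))) (.setNReg 12 (.add (.reg 12) (.const 1)))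
        .skip])]

theorem wp_sideSlope {q : Params} {κ : ℕ} {P : List Plane} {s : Store} (h : Ctx q κ P s) {i : ℕ}
    (hi : i < P.length) (h10 : s.nreg 10 = i) {c : ℕ} (h12 : s.nreg 12 = c) :
    WP sideSlope s fun t s' => t ≤ 60 ∧ s'.rreg 5 = slopeOf (P.getD i 0) ∧
      s'.nreg 12 = c + c + (c + c) + sideOf (P.getD i 0) := by
  unfold sideSlope
  simp only [wp_block_cons, wp_block_singleton, wp_ite, wp_setNReg, wp_setRReg, wp_skip]
  simp [h10, h12, h.x, h.y, h.norm i hi, slopeOf, sideOf, -List.getD_eq_getElem?_getD]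
  grind

/-- The final `digit` supplies the additional slope digit, as `digitIter` always runs `h` times. -/
def cell : Prog := block [
  octIter,
  .setRReg 6 (.reg 5),
  digitIter,
  .setRArr 5 (.reg 10) (.div (.sub (.reg 6) (.div (.reg 5) (.reg 3))) (.reg 6)),
  .setRArr 6 (.reg 10) (.div (.div (.ofNat (.const 1)) (.reg 3)) (.reg 6)),
  sideSlope,
  digit,
  digitIter]

theorem wp_cell {q : Params} {κ : ℕ} {P : List Plane} {s : Store} (h : Ctx q κ P s) {i : ℕ}
    (hi : i < P.length) (h10 : s.nreg 10 = i) (hw : 1 ≤ q.w) (hr : q.ring (P.getD i 0) < q.J)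
    (h5 : s.rreg 5 = q.inRing (P.getD i 0)) (h12 : s.nreg 12 = q.ring (P.getD i 0) * q.w) :
    WP cell s fun t s' => t ≤ 300 * (q.w + q.h + 1) ∧ s'.nreg 12 = q.key (P.getD i 0) ∧
      s'.rarr 5 = Function.update (s.rarr 5) i (q.alpha (P.getD i 0)) ∧
      s'.rarr 6 = Function.update (s.rarr 6) i (q.beta (P.getD i 0)) := by
  unfold cell
  rw [wp_block_cons]
  refine (wp_octIter hw hr h5 h12).frame.mono fun t1 s1 ⟨⟨ht1, e5, e12⟩, f1⟩ => ?_
  have c1 := h.agree f1 (by decide) (by decide) (by decide)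
  rw [wp_block_cons, wp_setRReg, wp_block_cons]
  have c2 := c1.agree (AgreeOff.setRReg s1 6 (RExp.eval s1 (.reg 5))) (by decide) (by decide)
    (by decide)
  refine (wp_digitIter _ (q.inOct (P.getD i 0), q.oct (P.getD i 0)) q.h c2.h
    (by simpa using e5) (by simpa using e12)).frame.mono fun t2 s2 ⟨⟨ht2, g5, g12⟩, f2⟩ => ?_
  have c3 := c2.agree f2 (by decide) (by decide) (by decide)
  have g6 : s2.rreg 6 = q.inOct (P.getD i 0) := by
    rw [f2.rreg 6 (by decide)]
    simpa using e5
  have g10 : s2.nreg 10 = i := by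
    rw [f2.nreg 10 (by decide)]
    exact (f1.nreg 10 (by decide)).trans h10
  have a5 : s2.rarr 5 = s.rarr 5 := (f2.rarr 5 (by decide)).trans (f1.rarr 5 (by decide))
  have a6 : s2.rarr 6 = s.rarr 6 := (f2.rarr 6 (by decide)).trans (f1.rarr 6 (by decide))
  rw [wp_block_cons, wp_setRArr, wp_block_cons, wp_setRArr, wp_block_cons]
  have c4 := c3.agree (AgreeOff.setRArr s2 5 (Function.update (s2.rarr 5) i (q.alpha (P.getD i 0))))
    (by decide) (by decide) (by decide)
  have c5 := c4.agree (AgreeOff.setRArr _ 6 (Function.update (s2.rarr 6) i (q.beta (P.getD i 0))))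
    (by decide) (by decide) (by decide)
  simp only [RExp.eval, NExp.eval, RExp.cost, NExp.cost, g6, g10, g5, c3.H, Nat.cast_one]
  rw [show (q.inOct (P.getD i 0) - (digitStep^[q.h] (q.inOct (P.getD i 0), q.oct (P.getD i 0))).1 /
    q.H) / q.inOct (P.getD i 0) = q.alpha (P.getD i 0) from rfl,
    show 1 / q.H / q.inOct (P.getD i 0) = q.beta (P.getD i 0) from rfl]
  refine (wp_sideSlope c5 hi g10 g12).frame.mono fun t3 s3 ⟨⟨ht3, k5, k12⟩, f3⟩ => ?_
  rw [wp_block_cons]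
  refine (wp_digit s3 (_, _) k5 k12).frame.mono fun t4 s4 ⟨⟨ht4, l5, l12⟩, f4⟩ => ?_
  rw [wp_block_singleton]
  refine (wp_digitIter s4 _ q.h (((f4.nreg 9 (by decide)).trans (f3.nreg 9 (by decide))).trans c5.h)
    l5 l12).frame.mono fun t5 s5 ⟨⟨ht5, m5, m12⟩, f5⟩ => ?_
  refine ⟨by omega, m12, ?_, ?_⟩
  · rw [f5.rarr 5 (by decide), f4.rarr 5 (by decide), f3.rarr 5 (by decide)]
    simp [a5]
  · rw [f5.rarr 6 (by decide), f4.rarr 6 (by decide), f3.rarr 6 (by decide)]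
    simp [a6]

end TourCover


namespace TourCover

/-! ## Running the stacks -/

theorem StartsWith.concat {α : Type*} {a : ℕ → α} {l : List α} (h : StartsWith a l) (x : α) :
    StartsWith (Function.update a l.length x) (l ++ [x]) := by
  intro i hi
  rw [List.length_append, List.length_singleton] at hi
  rcases (Nat.lt_succ_iff.1 hi).eq_or_lt with rfl | hi'
  · simp
  · rw [Function.update_of_ne hi'.ne, h i hi', List.getElem_append_left hi']

/-- Starting from `x`, the pointers `prev` run through the list; the entry `i` has the address
`i + 1`. -/
def Linked (prev : ℕ → ℕ) : ℕ → List ℕ → Prop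
  | _, [] => True
  | x, i :: l => x = i + 1 ∧ Linked prev (prev i) l

theorem Linked.congr {prev prev' : ℕ → ℕ} {l : List ℕ} : ∀ {x : ℕ}, Linked prev x l →
    (∀ i ∈ l, prev' i = prev i) → Linked prev' x l := by
  induction l with
  | nil => intro _ _ _; trivial
  | cons i l ih =>
    intro x h h'
    refine ⟨h.1, ?_⟩
    rw [h' i (by simp)]
    exact ih h.2 fun j hj => h' j (by simp [hj])

/-- The memory represents the stacks and the fixed tours of `S`. -/
structure PeelHolds (S : PeelState) (s : Store) : Prop where
  link : ∀ a, Linked (s.narr 7) (s.narr 8 a) (S.stack a)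
  size : ∀ a, s.narr 9 a = (S.stack a).length
  gone : ∀ x, s.narr 10 x = if x ∈ S.done.flatten then 1 else 0
  ptr : s.nreg 15 = S.done.flatten.length
  cover : HoldsCover s S.done

/-- All stacks share one array of links indexed by points, while tops and heights are indexed by
keys. Addresses are shifted by 1, so that the initial memory, all zero, represents empty stacks. -/
def push : Prog := block [
  .setNArr 7 (.reg 10) (.arr 8 (.reg 12)),
  .setNArr 8 (.reg 12) (.add (.reg 10) (.const 1)),
  .setNArr 9 (.reg 12) (.add (.arr 9 (.reg 12)) (.const 1))]

theorem wp_push {S : PeelState} {s : Store} (h : PeelHolds S s) {i a : ℕ} (h10 : s.nreg 10 = i)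
    (h12 : s.nreg 12 = a) (hi : ∀ b, i ∉ S.stack b) :
    WP push s fun t s' => t ≤ 30 ∧
      PeelHolds ⟨Function.update S.stack a (i :: S.stack a), S.done⟩ s' := by
  unfold push
  simp only [wp_block_cons, wp_block_singleton, wp_setNArr]
  simp only [NExp.eval, NExp.cost, h10, h12]
  refine ⟨by norm_num, ?_, ?_, ?_, ?_, ?_⟩
  · intro b
    have hc : ∀ j ∈ S.stack b, Function.update (s.narr 7) i (s.narr 8 a) j = s.narr 7 j :=
      fun j hj => Function.update_of_ne (by rintro rfl; exact hi b hj) _ _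
    by_cases hb : b = a
    · subst hb
      simpa [Linked] using (h.link b).congr hc
    · simpa [hb] using (h.link b).congr hc
  · intro b
    by_cases hb : b = a
    · subst hb; simp [h.size]
    · simp [hb, h.size]
  · simpa using h.gone
  · simpa using h.ptr
  · exact ⟨by simpa using h.cover.count, by simpa using h.cover.sizes,
      by simpa using h.cover.vertices⟩

def popIter : Prog := block [
  .setNReg 14 (.const 0),
  .while (.nlt (.reg 14) (.reg 5)) (block [
    .setNReg 13 (.sub (.arr 8 (.reg 12)) (.const 1)),
    .setNArr 5 (.reg 15) (.reg 13),
    .setNArr 10 (.reg 13) (.const 1),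
    .setNArr 8 (.reg 12) (.arr 7 (.reg 13)),
    .setNReg 15 (.add (.reg 15) (.const 1)),
    .setNReg 14 (.add (.reg 14) (.const 1))])]

theorem wp_popIter {s : Store} {a κ : ℕ} {F l : List ℕ} (h5 : s.nreg 5 = κ) (h12 : s.nreg 12 = a)
    (h15 : s.nreg 15 = F.length) (hl : Linked (s.narr 7) (s.narr 8 a) l) (hκ : κ ≤ l.length)
    (hF : StartsWith (s.narr 5) F) (hg : ∀ x, s.narr 10 x = if x ∈ F then 1 else 0) :
    WP popIter s fun t s' => t ≤ 50 * κ + 10 ∧ Linked (s.narr 7) (s'.narr 8 a) (l.drop κ) ∧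
      (∀ b, b ≠ a → s'.narr 8 b = s.narr 8 b) ∧ s'.nreg 15 = (F ++ l.take κ).length ∧
      StartsWith (s'.narr 5) (F ++ l.take κ) ∧
      ∀ x, s'.narr 10 x = if x ∈ F ++ l.take κ then 1 else 0 := by
  unfold popIter
  simp only [wp_block_cons, wp_block_singleton, wp_setNReg, NExp.eval]
  refine wp_while κ (fun j t s' => t ≤ 50 * j ∧ s'.nreg 5 = κ ∧ s'.nreg 12 = a ∧ s'.nreg 14 = j ∧
    s'.narr 7 = s.narr 7 ∧ Linked (s.narr 7) (s'.narr 8 a) (l.drop j) ∧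
      (∀ b, b ≠ a → s'.narr 8 b = s.narr 8 b) ∧ s'.nreg 15 = (F ++ l.take j).length ∧
      StartsWith (s'.narr 5) (F ++ l.take j) ∧
      ∀ x, s'.narr 10 x = if x ∈ F ++ l.take j then 1 else 0) ?_ ?_ ?_ ?_
  · rintro j t s' hj ⟨ht, e5, e12, e14, a7, hd, a8, e15, a5, a10⟩
    refine ⟨by simpa [e5, e14] using hj, ?_⟩
    have hjl : j < l.length := hj.trans_le hκ
    rw [List.drop_eq_getElem_cons hjl] at hd
    have htake : F ++ l.take (j + 1) = F ++ l.take j ++ [l[j]] := by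
      rw [List.append_assoc, List.take_concat_get' l j hjl]
    have htop : s'.narr 8 a - 1 = l[j] := by rw [hd.1]; rfl
    simp only [wp_block_cons, wp_block_singleton, wp_setNReg, wp_setNArr]
    simp only [NExp.eval, NExp.cost, BExp.cost, e12, e14, e15, e5, Function.update_self, ne_eq,
      Nat.reduceEqDiff, not_false_eq_true, Function.update_of_ne, htop, a7,
      true_and]
    refine ⟨by omega, hd.2, fun b hb => by rw [Function.update_of_ne hb, a8 b hb], ?_, ?_, ?_⟩
    · rw [htake, List.length_append (as := F ++ _), List.length_singleton]
    · rw [htake]; exact a5.concat _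
    · intro x
      rw [htake]
      by_cases hx : x = l[j]
      · simp only [hx, Function.update_self, List.mem_append, List.mem_singleton, or_true, if_true]
      · simp only [Function.update_of_ne hx, a10, List.mem_append, List.mem_singleton, hx, or_false]
  · rintro t s' ⟨ht, e5, e12, e14, -⟩
    simp [e5, e14]
  · simp only [List.drop_zero, List.take_zero, List.append_nil]
    exact ⟨by omega, by simpa, by simpa, by simp, trivial, hl, fun _ _ => trivial, by simpa, hF, hg⟩
  · rintro t s' ⟨ht, e5, e12, e14, a7, hd, a8, e15, a5, a10⟩
    exact ⟨by simp; omega, hd, a8, e15, a5, a10⟩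

def pop : Prog := block [
  popIter,
  .setNArr 4 (.reg 4) (.reg 5),
  .setNReg 4 (.add (.reg 4) (.const 1)),
  .setNArr 9 (.reg 12) (.sub (.arr 9 (.reg 12)) (.reg 5))]

theorem wp_pop {S : PeelState} {s : Store} (h : PeelHolds S s) {κ a : ℕ} (h5 : s.nreg 5 = κ)
    (h12 : s.nreg 12 = a) (hκ : κ ≤ (S.stack a).length) :
    WP pop s fun t s' => t ≤ 50 * κ + 40 ∧
      PeelHolds ⟨Function.update S.stack a ((S.stack a).drop κ),
        S.done ++ [(S.stack a).take κ]⟩ s' := by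
  unfold pop
  rw [wp_block_cons]
  refine (wp_popIter h5 h12 h.ptr (h.link a) hκ h.cover.vertices h.gone).frame.mono
    fun t1 s1 ⟨⟨ht, hd, a8, e15, a5, a10⟩, f⟩ => ?_
  have e5 : s1.nreg 5 = κ := (f.nreg 5 (by decide)).trans h5
  have e12 : s1.nreg 12 = a := (f.nreg 12 (by decide)).trans h12
  have e4 : s1.nreg 4 = S.done.length := (f.nreg 4 (by decide)).trans h.cover.count
  have a7 : s1.narr 7 = s.narr 7 := f.narr 7 (by decide)
  have a9 : s1.narr 9 = s.narr 9 := f.narr 9 (by decide)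
  have a4 : s1.narr 4 = s.narr 4 := f.narr 4 (by decide)
  have hfl : (S.done ++ [(S.stack a).take κ]).flatten = S.done.flatten ++ (S.stack a).take κ := by
    simp
  simp only [wp_block_cons, wp_block_singleton, wp_setNReg, wp_setNArr]
  simp only [NExp.eval, NExp.cost, e5, e12, e4, ne_eq,
      Nat.reduceEqDiff, not_false_eq_true, Function.update_of_ne]
  refine ⟨by omega, ?_, ?_, ?_, ?_, ?_, ?_, ?_⟩
  · intro b
    by_cases hb : b = a
    · subst hb; simpa [a7] using hd
    · simpa [hb, a7, a8 b hb] using h.link b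
  · intro b
    by_cases hb : b = a
    · subst hb; simp [a9, h.size]
    · simp [hb, a9, h.size]
  · rw [hfl]; simpa using a10
  · rw [hfl]; simpa using e15
  · simp
  · have := (h.cover.sizes).concat κ
    simpa [a4, min_eq_left hκ] using this
  · rw [hfl]; simpa using a5

def single : Prog := block [
  .setNArr 5 (.reg 15) (.reg 10),
  .setNArr 10 (.reg 10) (.const 1),
  .setNReg 15 (.add (.reg 15) (.const 1)),
  .setNArr 4 (.reg 4) (.const 1),
  .setNReg 4 (.add (.reg 4) (.const 1))]

theorem wp_single {S : PeelState} {s : Store} (h : PeelHolds S s) {i : ℕ} (h10 : s.nreg 10 = i) :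
    WP single s fun t s' => t ≤ 30 ∧ PeelHolds ⟨S.stack, S.done ++ [[i]]⟩ s' := by
  unfold single
  have hfl : (S.done ++ [[i]]).flatten = S.done.flatten ++ [i] := by simp
  have e4 := h.cover.count
  simp only [wp_block_cons, wp_block_singleton, wp_setNReg, wp_setNArr]
  simp only [NExp.eval, NExp.cost, h10, h.ptr, e4, ne_eq,
      Nat.reduceEqDiff, not_false_eq_true, Function.update_of_ne]
  refine ⟨by omega, ?_, ?_, ?_, ?_, ?_, ?_, ?_⟩
  · simpa using h.link
  · simpa using h.size
  · intro x
    rw [hfl]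
    by_cases hx : x = i
    · simp [hx]
    · simp only [Function.update_self, ne_eq, Nat.reduceEqDiff,
        not_false_eq_true, Function.update_of_ne, hx, h.gone]
      simp [hx]
  · rw [hfl]; simp
  · simp
  · have := (h.cover.sizes).concat 1
    simpa using this
  · have := (h.cover.vertices).concat i
    rw [hfl]
    simpa using this

end TourCover


/-! ### Processing all points in amortized time -/

namespace TourCover

def pointStep : Prog := block [
  ringIter,
  .ite (.nlt (.reg 11) (.reg 8))
    (block [cell, push, .ite (.rlt (.ofNat (.arr 9 (.reg 12))) (.reg 4)) .skip pop])
    single,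
  .setNReg 10 (.add (.reg 10) (.const 1))]

/-- The memory after processing the first `i` points. -/
structure PointsHold (q : Params) (κ : ℕ) (P : List Plane) (i : ℕ) (s : Store) : Prop where
  ctx : Ctx q κ P s
  ring : ∀ j < i, s.narr 6 j = q.ring (P.getD j 0)
  alpha : ∀ j < i, q.ring (P.getD j 0) < q.J → s.rarr 5 j = q.alpha (P.getD j 0)
  beta : ∀ j < i, q.ring (P.getD j 0) < q.J → s.rarr 6 j = q.beta (P.getD j 0)
  peel : PeelHolds (peel q.J κ (κ * q.numLoc + κ) (fun i => q.ring (P.getD i 0))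
    (fun i => q.key (P.getD i 0)) i) s

theorem PeelHolds.agree {S : PeelState} {s s' : Store} (h : PeelHolds S s) {nr rr na ra : List ℕ}
    (hs : AgreeOff nr rr na ra s s') (h1 : ∀ x ∈ [4, 15], x ∉ nr)
    (h2 : ∀ x ∈ [4, 5, 7, 8, 9, 10], x ∉ na) : PeelHolds S s' where
  link := by rw [hs.narr 7 (h2 7 (by simp)), hs.narr 8 (h2 8 (by simp))]; exact h.link
  size := by rw [hs.narr 9 (h2 9 (by simp))]; exact h.size
  gone := by rw [hs.narr 10 (h2 10 (by simp))]; exact h.gone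
  ptr := by rw [hs.nreg 15 (h1 15 (by simp))]; exact h.ptr
  cover := ⟨by rw [hs.nreg 4 (h1 4 (by simp))]; exact h.cover.count,
    by rw [hs.narr 4 (h2 4 (by simp))]; exact h.cover.sizes,
    by rw [hs.narr 5 (h2 5 (by simp))]; exact h.cover.vertices⟩

theorem forall_lt_succ_update {α : Type*} {a f : ℕ → α} {i : ℕ} (p : ℕ → Prop)
    (h : ∀ j < i, p j → a j = f j) : ∀ j < i + 1, p j → Function.update a i (f i) j = f j := by
  intro j hj hp
  rcases (Nat.lt_succ_iff.1 hj).eq_or_lt with rfl | hj'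
  · simp
  · rw [Function.update_of_ne hj'.ne, h j hj' hp]

/-- Fixing a tour takes time proportional to `κ`, so the bound is amortized: register 15, the number
of vertices written so far, serves as potential. -/
theorem wp_pointStep {q : Params} {κ : ℕ} {P : List Plane} {s : Store} {i : ℕ}
    (h : PointsHold q κ P i s) (hi : i < P.length) (h10 : s.nreg 10 = i) (hw : 1 ≤ q.w)
    (hκ : 1 ≤ κ) :
    WP pointStep s fun t s' => s'.nreg 10 = i + 1 ∧ PointsHold q κ P (i + 1) s' ∧
      t + 100 * s.nreg 15 ≤ 500 * (q.J + q.w + q.h + 1) + 100 * s'.nreg 15 := by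
  have hc := h.ctx
  have inv := peelInv (J := q.J) (L := q.numLoc) hκ (fun i => q.ring (P.getD i 0))
    (fun i => q.key (P.getD i 0)) i
  set ring := fun i => q.ring (P.getD i 0) with hring
  set key := fun i => q.key (P.getD i 0) with hkey
  set S := TourCover.peel q.J κ (κ * q.numLoc + κ) ring key i with hS
  have hS1 : TourCover.peel q.J κ (κ * q.numLoc + κ) ring key (i + 1) =
    peelStep q.J κ (κ * q.numLoc + κ) ring key S i := rfl
  unfold pointStep
  rw [wp_block_cons]
  refine (wp_ringIter hc hi h10).frame.mono fun t1 s1 ⟨⟨ht1, e11, e5, e12, a6⟩, f1⟩ => ?_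
  have c1 := hc.agree f1 (by decide) (by decide) (by decide)
  have p1 : PeelHolds S s1 := h.peel.agree f1 (by decide) (by decide)
  have g10 : s1.nreg 10 = i := (f1.nreg 10 (by decide)).trans h10
  have g15 : s1.nreg 15 = s.nreg 15 := f1.nreg 15 (by decide)
  have r1 : ∀ j < i + 1, s1.narr 6 j = ring j := fun j hj => by
    rw [a6]
    exact forall_lt_succ_update (f := ring) (fun _ => True) (fun j hj _ => h.ring j hj) j hj trivial
  rw [wp_block_cons, wp_ite]
  refine ⟨fun hb => ?_, fun hb => ?_⟩
  · have hr : ring i < q.J := by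
      simpa [e11, c1.J, hring, -List.getD_eq_getElem?_getD] using hb
    rw [wp_block_cons]
    refine (wp_cell c1 hi g10 hw hr e5 e12).frame.mono
      fun t2 s2 ⟨⟨ht2, k12, b5, b6⟩, f2⟩ => ?_
    have c2 := c1.agree f2 (by decide) (by decide) (by decide)
    have p2 := p1.agree f2 (by decide) (by decide)
    have k10 : s2.nreg 10 = i := (f2.nreg 10 (by decide)).trans g10
    rw [f1.rarr 5 (by decide)] at b5
    rw [f1.rarr 6 (by decide)] at b6
    rw [wp_block_cons]
    replace k12 : s2.nreg 12 = key i := k12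
    have hist : ∀ a, i ∉ S.stack a := fun a ha => by
      have := ((inv.mem_stack a i).1 ha).1
      omega
    refine (wp_push p2 k10 k12 hist).frame.mono fun t3 s3 ⟨⟨ht3, p3⟩, f3⟩ => ?_
    have c3 := c2.agree f3 (by decide) (by decide) (by decide)
    have l12 : s3.nreg 12 = key i := (f3.nreg 12 (by decide)).trans k12
    have l9 : s3.narr 9 (key i) = (i :: S.stack (key i)).length := by
      rw [p3.size]; simp
    have l15 : s3.nreg 15 = s.nreg 15 :=
      (f3.nreg 15 (by decide)).trans ((f2.nreg 15 (by decide)).trans g15)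
    have l10 : s3.nreg 10 = i := (f3.nreg 10 (by decide)).trans k10
    have m6 : ∀ j < i + 1, s3.narr 6 j = ring j := by
      rw [f3.narr 6 (by decide), f2.narr 6 (by decide)]; exact r1
    have m5 : ∀ j < i + 1, ring j < q.J → s3.rarr 5 j = q.alpha (P.getD j 0) := by
      rw [f3.rarr 5 (by decide), b5]
      exact forall_lt_succ_update (f := fun j => q.alpha (P.getD j 0)) _ h.alpha
    have m6' : ∀ j < i + 1, ring j < q.J → s3.rarr 6 j = q.beta (P.getD j 0) := by
      rw [f3.rarr 6 (by decide), b6]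
      exact forall_lt_succ_update (f := fun j => q.beta (P.getD j 0)) _ h.beta
    rw [wp_block_singleton, wp_ite]
    refine ⟨fun hb' => ?_, fun hb' => ?_⟩
    · have hlt : (i :: S.stack (key i)).length < κ * q.numLoc + κ := by
        simp only [BExp.eval, RExp.eval, NExp.eval, l12, l9, c3.thr] at hb'
        exact_mod_cast hb'
      rw [wp_skip, wp_block_singleton, wp_setNReg]
      have f4 := AgreeOff.setNReg s3 10 (s3.nreg 10 + 1)
      refine ⟨by simp [l10], ⟨c3.agree f4 (by decide) (by decide) (by decide), m6, m5, m6', ?_⟩, ?_⟩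
      · rw [hS1, peelStep, if_pos hr, if_pos hlt]
        exact p3.agree f4 (by decide) (by decide)
      · simp [l15]
        omega
    · have hlt : ¬ (i :: S.stack (key i)).length < κ * q.numLoc + κ := by
        intro hlt
        refine hb' ?_
        simp only [BExp.eval, RExp.eval, NExp.eval, l12, l9, c3.thr]
        exact_mod_cast hlt
      have hup : Function.update S.stack (key i) (i :: S.stack (key i)) (key i) =
          i :: S.stack (key i) := Function.update_self ..
      refine (wp_pop p3 c3.cap l12 (by
        have := Nat.le_add_left κ (κ * q.numLoc)
        simp only [hup]
        omega)).frame.mono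
        fun t4 s4 ⟨⟨ht4, p4⟩, f4⟩ => ?_
      have c4 := c3.agree f4 (by decide) (by decide) (by decide)
      have n15 : s4.nreg 15 = s.nreg 15 + κ := by
        rw [p4.ptr, ← l15, p3.ptr]
        simp only [hup, List.flatten_append, List.length_append, List.flatten_singleton,
          List.length_take]
        omega
      rw [wp_block_singleton, wp_setNReg]
      have f5 := AgreeOff.setNReg s4 10 (s4.nreg 10 + 1)
      refine ⟨by simp [(f4.nreg 10 (by decide)).trans l10],
        ⟨c4.agree f5 (by decide) (by decide) (by decide), ?_, ?_, ?_, ?_⟩, ?_⟩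
      · show ∀ j < i + 1, s4.narr 6 j = _
        rw [f4.narr 6 (by decide)]; exact m6
      · show ∀ j < i + 1, _ → s4.rarr 5 j = _
        rw [f4.rarr 5 (by decide)]; exact m5
      · show ∀ j < i + 1, _ → s4.rarr 6 j = _
        rw [f4.rarr 6 (by decide)]; exact m6'
      · rw [hS1, peelStep, if_pos hr, if_neg hlt]
        have := p4.agree f5 (by decide) (by decide)
        simp only [hup] at this
        rwa [Function.update_idem] at this
      · simp [n15]
        omega
  · have hr : ¬ ring i < q.J := by
      simpa [e11, c1.J, hring, -List.getD_eq_getElem?_getD] using hb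
    refine (wp_single p1 g10).frame.mono fun t2 s2 ⟨⟨ht2, p2⟩, f2⟩ => ?_
    have c2 := c1.agree f2 (by decide) (by decide) (by decide)
    have n15 : s2.nreg 15 = s.nreg 15 + 1 := by
      rw [p2.ptr, ← g15, p1.ptr]
      simp
    rw [wp_block_singleton, wp_setNReg]
    have f5 := AgreeOff.setNReg s2 10 (s2.nreg 10 + 1)
    refine ⟨by simp [(f2.nreg 10 (by decide)).trans g10],
      ⟨c2.agree f5 (by decide) (by decide) (by decide), ?_, ?_, ?_, ?_⟩, ?_⟩
    · show ∀ j < i + 1, s2.narr 6 j = _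
      rw [f2.narr 6 (by decide)]; exact r1
    · show ∀ j < i + 1, _ → s2.rarr 5 j = _
      rw [f2.rarr 5 (by decide), f1.rarr 5 (by decide)]
      intro j hj hjr
      exact h.alpha j (lt_of_le_of_ne (by omega) (by rintro rfl; exact hr hjr)) hjr
    · show ∀ j < i + 1, _ → s2.rarr 6 j = _
      rw [f2.rarr 6 (by decide), f1.rarr 6 (by decide)]
      intro j hj hjr
      exact h.beta j (lt_of_le_of_ne (by omega) (by rintro rfl; exact hr hjr)) hjr
    · rw [hS1, peelStep, if_neg hr]
      exact p2.agree f5 (by decide) (by decide)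
    · simp [n15]
      omega

def pointLoop : Prog := block [
  .setNReg 10 (.const 0),
  .while (.nlt (.reg 10) (.reg 0)) pointStep]

theorem wp_pointLoop {q : Params} {κ : ℕ} {P : List Plane} {s : Store} (h : Ctx q κ P s)
    (hw : 1 ≤ q.w) (hκ : 1 ≤ κ) (h4 : s.nreg 4 = 0) (h15 : s.nreg 15 = 0) (a9 : ∀ x, s.narr 9 x = 0)
    (a10 : ∀ x, s.narr 10 x = 0) :
    WP pointLoop s fun t s' => PointsHold q κ P P.length s' ∧
      t ≤ 700 * (P.length * (q.J + q.w + q.h + 1)) + 10 := by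
  unfold pointLoop
  rw [wp_block_cons, wp_setNReg, wp_block_singleton]
  refine wp_while P.length (fun i t s' => s'.nreg 10 = i ∧ PointsHold q κ P i s' ∧
    t ≤ 510 * (i * (q.J + q.w + q.h + 1)) + 100 * s'.nreg 15) ?_ ?_ ?_ ?_
  · rintro i t s' hi ⟨e10, hp, ht⟩
    refine ⟨by simpa [hp.ctx.n, e10] using hi, ?_⟩
    refine (wp_pointStep hp hi e10 hw hκ).mono fun t1 s1 ⟨g10, hp1, ht1⟩ => ⟨g10, hp1, ?_⟩
    simp only [BExp.cost, NExp.cost]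
    nlinarith
  · rintro t s' ⟨e10, hp, ht⟩
    simp [e10, hp.ctx.n]
  · refine ⟨by simp, ⟨h.agree (AgreeOff.setNReg s 10 0) (by decide) (by decide) (by decide),
      by simp, by simp, by simp, ?_⟩, by simp⟩
    exact ⟨fun _ => trivial, by simpa [peel] using a9, by simpa [peel] using a10,
      by simpa [peel] using h15, by simpa [peel] using h4, fun i hi => by simp [peel] at hi,
      fun i hi => by simp [peel] at hi⟩
  · rintro t s' ⟨e10, hp, ht⟩
    refine ⟨hp, ?_⟩
    have inv := peelInv (J := q.J) (L := q.numLoc) hκ (fun i => q.ring (P.getD i 0))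
      (fun i => q.key (P.getD i 0)) P.length
    -- Fixed tours are disjoint, so the total potential is at most `n`.
    have hlen : s'.nreg 15 ≤ P.length := by
      rw [hp.peel.ptr, ← List.toFinset_card_of_nodup inv.nodup]
      refine (Finset.card_le_card (t := Finset.range P.length) fun x hx => ?_).trans_eq (by simp)
      exact Finset.mem_range.2 (inv.lt x (List.mem_toFinset.1 hx))
    simp only [BExp.cost, NExp.cost]
    nlinarith

end TourCover


namespace TourCover

/-! ## Writing the instances -/

theorem PointsHold.agree {q : Params} {κ : ℕ} {P : List Plane} {i : ℕ} {s s' : Store}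
    (h : PointsHold q κ P i s) {nr rr na ra : List ℕ} (hs : AgreeOff nr rr na ra s s')
    (h1 : ∀ x ∈ [0, 4, 5, 6, 7, 8, 9, 15], x ∉ nr) (h2 : ∀ x ∈ [1, 2, 3, 4], x ∉ rr)
    (h3 : ∀ x ∈ [4, 5, 6, 7, 8, 9, 10], x ∉ na) (h4 : ∀ x ∈ [0, 1, 4, 5, 6], x ∉ ra) :
    PointsHold q κ P i s' where
  ctx := h.ctx.agree hs (fun x hx => h1 x (by simp at hx ⊢; omega)) h2
    (fun x hx => h4 x (by simp at hx ⊢; omega))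
  ring := by rw [hs.narr 6 (h3 6 (by simp))]; exact h.ring
  alpha := by rw [hs.rarr 5 (h4 5 (by simp))]; exact h.alpha
  beta := by rw [hs.rarr 6 (h4 6 (by simp))]; exact h.beta
  peel := h.peel.agree hs (fun x hx => h1 x (by simp at hx ⊢; omega))
    (fun x hx => h3 x (by simp at hx ⊢; omega))

/-- The memory holds the points with the pairs of blocks and indices `F`. -/
structure Emitted (q : Params) (P : List Plane) (F : List (ℕ × ℕ)) (s : Store) : Prop where
  count : s.nreg 17 = F.length
  x : StartsWith (s.rarr 2) (F.map fun e => q.place e.1 (P.getD e.2 0) 0)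
  y : StartsWith (s.rarr 3) (F.map fun e => q.place e.1 (P.getD e.2 0) 1)
  orig : StartsWith (s.narr 11) (F.map Prod.snd)

theorem Emitted.agree {q : Params} {P : List Plane} {F : List (ℕ × ℕ)} {s s' : Store}
    (h : Emitted q P F s) {nr rr na ra : List ℕ} (hs : AgreeOff nr rr na ra s s')
    (h1 : 17 ∉ nr) (h3 : 11 ∉ na) (h4 : ∀ x ∈ [2, 3], x ∉ ra) : Emitted q P F s' where
  count := by rw [hs.nreg 17 h1]; exact h.count
  x := by rw [hs.rarr 2 (h4 2 (by simp))]; exact h.x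
  y := by rw [hs.rarr 3 (h4 3 (by simp))]; exact h.y
  orig := by rw [hs.narr 11 h3]; exact h.orig

def emitPoint : Prog := block [
  .setRReg 5 (.add (.arr 5 (.reg 10)) (.div (.arr 6 (.reg 10))
    (.ofNat (.add (.reg 16) (.const 2))))),
  .setRArr 2 (.reg 17) (.mul (.reg 5) (.arr 0 (.reg 10))),
  .setRArr 3 (.reg 17) (.mul (.reg 5) (.arr 1 (.reg 10))),
  .setNArr 11 (.reg 17) (.reg 10),
  .setNReg 17 (.add (.reg 17) (.const 1)),
  .setNReg 18 (.add (.reg 18) (.const 1))]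

theorem wp_emitPoint {q : Params} {κ : ℕ} {P : List Plane} {s : Store}
    (h : PointsHold q κ P P.length s) {F : List (ℕ × ℕ)} (hF : Emitted q P F s) {b i c : ℕ}
    (hi : i < P.length) (hr : q.ring (P.getD i 0) < q.J) (h10 : s.nreg 10 = i) (h16 : s.nreg 16 = b)
    (h18 : s.nreg 18 = c) :
    WP emitPoint s fun t s' => t ≤ 60 ∧ s'.nreg 18 = c + 1 ∧ Emitted q P (F ++ [(b, i)]) s' := by
  unfold emitPoint
  simp only [wp_block_cons, wp_block_singleton, wp_setNReg, wp_setNArr, wp_setRReg, wp_setRArr]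
  simp only [NExp.eval, NExp.cost, RExp.eval, RExp.cost, h10, h16, h18, hF.count, h.alpha i hi hr,
    h.beta i hi hr, h.ctx.x, h.ctx.y, Function.update_self, ne_eq, Nat.reduceEqDiff,
    not_false_eq_true, Function.update_of_ne, OfNat.one_ne_ofNat]
  refine ⟨by norm_num, trivial, ?_, ?_, ?_, ?_⟩
  · simp
  · simpa [Params.place] using hF.x.concat (q.place b (P.getD i 0) 0)
  · simpa [Params.place] using hF.y.concat (q.place b (P.getD i 0) 1)
  · simpa using hF.orig.concat i

/-- Every block scans all points. This is affordable because there are only `J + m` blocks, O(log n)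
for fixed ε. -/
def emitBlock : Prog := block [
  .setNReg 18 (.const 0),
  .setNReg 10 (.const 0),
  .while (.nlt (.reg 10) (.reg 0)) (block [
    .ite (.and (.nlt (.arr 10 (.reg 10)) (.const 1)) (.and
        (.not (.nlt (.reg 16) (.arr 6 (.reg 10))))
        (.nlt (.reg 16) (.add (.arr 6 (.reg 10)) (.reg 7)))))
      emitPoint .skip,
    .setNReg 10 (.add (.reg 10) (.const 1))])]

theorem wp_emitBlock {q : Params} {κ : ℕ} {P : List Plane} {s : Store} (hκ : 1 ≤ κ)
    (h : PointsHold q κ P P.length s) {F : List (ℕ × ℕ)} (hF : Emitted q P F s) {b : ℕ}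
    (h16 : s.nreg 16 = b) :
    WP emitBlock s fun t s' => t ≤ 100 * (P.length + 1) ∧ s'.nreg 18 = (q.kept κ P b).length ∧
      PointsHold q κ P P.length s' ∧
      Emitted q P (F ++ (q.kept κ P b).map (Prod.mk b)) s' := by
  have inv := peelInv (J := q.J) (L := q.numLoc) hκ (fun i => q.ring (P.getD i 0))
    (fun i => q.key (P.getD i 0)) P.length
  let l : ℕ → List ℕ := fun i => (List.range i).filter fun i => i ∉ (q.fixedTours κ P).flatten ∧
    q.ring (P.getD i 0) ≤ b ∧ b < q.ring (P.getD i 0) + q.m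
  unfold emitBlock
  simp only [wp_block_cons, wp_block_singleton, wp_setNReg, NExp.eval]
  refine wp_while P.length (fun i t s' => t ≤ 100 * i ∧ s'.nreg 10 = i ∧ s'.nreg 16 = b ∧
    PointsHold q κ P P.length s' ∧ s'.nreg 18 = (l i).length ∧
    Emitted q P (F ++ (l i).map (Prod.mk b)) s') ?_ ?_ ?_ ?_
  · rintro i t s' hi ⟨ht, e10, e16, hp, e18, hE⟩
    refine ⟨by simpa [hp.ctx.n, e10] using hi, ?_⟩
    have hl : l (i + 1) = if i ∉ (q.fixedTours κ P).flatten ∧ q.ring (P.getD i 0) ≤ b ∧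
        b < q.ring (P.getD i 0) + q.m then l i ++ [i] else l i := by
      simp only [l, List.range_succ, List.filter_append, List.filter_cons, List.filter_nil,
        decide_eq_true_eq]
      split_ifs
      · rfl
      · exact List.append_nil _
    have hg : s'.narr 10 i < 1 ↔ i ∉ (q.fixedTours κ P).flatten := by
      rw [hp.peel.gone i]
      change (if i ∈ (q.fixedTours κ P).flatten then 1 else 0) < 1 ↔ _
      split_ifs with h' <;> simp [h']
    have hcond : (BExp.and (.nlt (.arr 10 (.reg 10)) (.const 1)) (.and
        (.not (.nlt (.reg 16) (.arr 6 (.reg 10))))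
        (.nlt (.reg 16) (.add (.arr 6 (.reg 10)) (.reg 7))))).eval s' ↔
        i ∉ (q.fixedTours κ P).flatten ∧ q.ring (P.getD i 0) ≤ b ∧
        b < q.ring (P.getD i 0) + q.m := by
      simp only [BExp.eval, NExp.eval, e10, e16, hp.ring i hi, hp.ctx.m, hg, not_lt]
    rw [wp_block_cons, wp_ite, hcond]
    refine ⟨fun hc => ?_, fun hc => ?_⟩
    · rw [if_pos hc] at hl
      have hr : q.ring (P.getD i 0) < q.J := by
        by_contra hr
        exact hc.1 (inv.tiny i hi hr)
      refine (wp_emitPoint hp hE hi hr e10 e16 e18).frame.mono fun t1 s1 ⟨⟨ht1, g18, hE1⟩, f⟩ => ?_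
      have hp1 := hp.agree f (by decide) (by decide) (by decide) (by decide)
      have f2 := AgreeOff.setNReg s1 10 (i + 1)
      simp only [wp_block_singleton, wp_setNReg, NExp.eval, NExp.cost, BExp.cost,
        f.nreg 10 (by decide), e10]
      refine ⟨by omega, by simp, by simpa using (f.nreg 16 (by decide)).trans e16,
        hp1.agree f2 (by decide) (by decide) (by decide) (by decide), ?_, ?_⟩
      · simpa [hl] using g18
      · rw [hl, List.map_append, ← List.append_assoc]
        exact hE1.agree f2 (by decide) (by decide) (by decide)
    · rw [if_neg hc] at hl
      have f2 := AgreeOff.setNReg s' 10 (i + 1)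
      simp only [wp_skip, wp_block_singleton, wp_setNReg, NExp.eval, NExp.cost, BExp.cost, e10]
      refine ⟨by omega, by simp, by simpa using e16,
        hp.agree f2 (by decide) (by decide) (by decide) (by decide), ?_, ?_⟩
      · simpa [hl] using e18
      · rw [hl]
        exact hE.agree f2 (by decide) (by decide) (by decide)
  · rintro t s' ⟨ht, e10, e16, hp, -⟩
    simp [e10, hp.ctx.n]
  · have f1 := AgreeOff.setNReg s 18 0
    have f2 := AgreeOff.setNReg { s with nreg := Function.update s.nreg 18 0 } 10 0
    refine ⟨by omega, by simp, by simpa using h16, ?_, by simp [l], ?_⟩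
    · exact (h.agree f1 (by decide) (by decide) (by decide) (by decide)).agree f2 (by decide)
        (by decide) (by decide) (by decide)
    · simpa [l] using (hF.agree f1 (by decide) (by decide) (by decide)).agree f2 (by decide)
        (by decide) (by decide)
  · rintro t s' ⟨ht, e10, e16, hp, e18, hE⟩
    exact ⟨by simp; omega, e18, hp, hE⟩

def emit : Prog := block [
  .setNReg 2 (.add (.reg 8) (.reg 7)),
  .setNReg 16 (.const 0),
  .setNReg 17 (.const 0),
  .while (.nlt (.reg 16) (.reg 2)) (block [
    emitBlock,
    .setNArr 0 (.reg 16) (.reg 18),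
    .setNReg 16 (.add (.reg 16) (.const 1))])]

/-- The emitted pairs of blocks and indices. -/
noncomputable def emitList (q : Params) (κ : ℕ) (P : List Plane) (B : ℕ) : List (ℕ × ℕ) :=
  (List.range B).flatMap fun b => (q.kept κ P b).map (Prod.mk b)

theorem wp_emit {q : Params} {κ : ℕ} {P : List Plane} {s : Store} (hκ : 1 ≤ κ)
    (h : PointsHold q κ P P.length s) :
    WP emit s fun t s' => t ≤ 200 * ((P.length + 1) * (q.J + q.m + 1)) ∧
      PointsHold q κ P P.length s' ∧ s'.nreg 2 = q.J + q.m ∧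
      StartsWith (s'.narr 0) ((List.range (q.J + q.m)).map fun b => (q.kept κ P b).length) ∧
      Emitted q P (emitList q κ P (q.J + q.m)) s' := by
  unfold emit
  simp only [wp_block_cons, wp_block_singleton, wp_setNReg]
  refine wp_while (q.J + q.m) (fun b t s' => t ≤ 120 * ((P.length + 1) * b) ∧ s'.nreg 16 = b ∧
    PointsHold q κ P P.length s' ∧ s'.nreg 2 = q.J + q.m ∧
    StartsWith (s'.narr 0) ((List.range b).map fun b => (q.kept κ P b).length) ∧
    Emitted q P (emitList q κ P b) s') ?_ ?_ ?_ ?_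
  · rintro b t s' hb ⟨ht, e16, hp, e2, a0, hE⟩
    refine ⟨by simpa [e2, e16] using hb, ?_⟩
    rw [wp_block_cons]
    refine (wp_emitBlock hκ hp hE e16).frame.mono fun t1 s1 ⟨⟨ht1, g18, hp1, hE1⟩, f⟩ => ?_
    have g16 := (f.nreg 16 (by decide)).trans e16
    simp only [wp_block_cons, wp_block_singleton, wp_setNArr, wp_setNReg, NExp.eval, g16, g18,
      NExp.cost, BExp.cost]
    have f2 := AgreeOff.setNArr s1 0 (Function.update (s1.narr 0) b (q.kept κ P b).length)
    have f3 := AgreeOff.setNReg { s1 with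
      narr := Function.update s1.narr 0 (Function.update (s1.narr 0) b (q.kept κ P b).length) }
      16 (b + 1)
    refine ⟨by nlinarith, by simp, (hp1.agree f2 (by decide) (by decide) (by decide)
      (by decide)).agree f3 (by decide) (by decide) (by decide) (by decide),
      by simpa using (f.nreg 2 (by decide)).trans e2, ?_, ?_⟩
    · have := a0.concat (q.kept κ P b).length
      simpa [List.range_succ, f.narr 0 (by decide)] using this
    · rw [emitList, List.range_succ, List.flatMap_append, List.flatMap_singleton]
      exact (hE1.agree f2 (by decide) (by decide) (by decide)).agree f3 (by decide) (by decide)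
        (by decide)
  · rintro t s' ⟨ht, e16, hp, e2, -⟩
    simp [e16, e2]
  · have f1 := AgreeOff.setNReg s 2 (q.J + q.m)
    have f2 := AgreeOff.setNReg { s with nreg := Function.update s.nreg 2 (q.J + q.m) } 16 0
    have f3 := AgreeOff.setNReg { s with
      nreg := Function.update (Function.update s.nreg 2 (q.J + q.m)) 16 0 } 17 0
    simp only [NExp.eval, h.ctx.J, h.ctx.m]
    refine ⟨by simp, by simp, ((h.agree f1 (by decide) (by decide) (by decide) (by decide)).agree f2
      (by decide) (by decide) (by decide) (by decide)).agree f3 (by decide) (by decide) (by decide)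
      (by decide), by simp, fun i hi => by simp at hi, ?_⟩
    exact ⟨by simp [emitList], fun i hi => by simp [emitList] at hi,
      fun i hi => by simp [emitList] at hi, fun i hi => by simp [emitList] at hi⟩
  · rintro t s' ⟨ht, e16, hp, e2, a0, hE⟩
    refine ⟨?_, hp, e2, a0, hE⟩
    simp only [NExp.cost, BExp.cost]
    nlinarith

theorem holdsInstances_of_emitted {ε : ℝ} {k : ℕ} {P : List Plane} {s : Store}
    (h2 : s.nreg 2 = JOf ε P.length + mOf ε)
    (h0 : StartsWith (s.narr 0) ((List.range (JOf ε P.length + mOf ε)).map fun b =>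
      ((paramsOf ε k P).kept (min k P.length) P b).length))
    (hE : Emitted (paramsOf ε k P) P (emitList (paramsOf ε k P) (min k P.length) P
      (JOf ε P.length + mOf ε)) s) : HoldsInstances s (instances ε k P) := by
  refine ⟨by simpa [instances] using h2, ?_, ?_, ?_⟩
  · simpa [instances, Function.comp_def, Params.inst] using h0
  · convert hE.x using 1
    simp [instances, emitList, Params.inst, List.flatMap, List.map_flatten, Function.comp_def]
  · convert hE.y using 1
    simp [instances, emitList, Params.inst, List.flatMap, List.map_flatten, Function.comp_def]

/-! ## The reduction -/

def reduceProg : Prog := block [setup, pointLoop, emit]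

theorem wp_reduceProg {ε : ℝ} (hε : 0 < ε) (hε2 : ε ≤ 1 / 2) {k : ℕ} (hk : 1 ≤ k) {P : List Plane}
    (hP : P ≠ []) (s : Store)
    (h0 : s.nreg 0 = P.length) (h1 : s.nreg 1 = k) (he : s.rreg 0 = ε)
    (hx : ∀ i, s.rarr 0 i = P.getD i 0 0) (hy : ∀ i, s.rarr 1 i = P.getD i 0 1)
    (h4 : s.nreg 4 = 0) (h15 : s.nreg 15 = 0) (a9 : ∀ x, s.narr 9 x = 0)
    (a10 : ∀ x, s.narr 10 x = 0) :
    WP reduceProg s fun t s' =>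
      t ≤ 3000 * (P.length *
        (JOf ε P.length + mOf ε + wOf ε + hOf ε (min k P.length) + 1)) ∧
      PointsHold (paramsOf ε k P) (min k P.length) P P.length s' ∧
      s'.nreg 2 = JOf ε P.length + mOf ε ∧
      StartsWith (s'.narr 0) ((List.range (JOf ε P.length + mOf ε)).map fun b =>
        ((paramsOf ε k P).kept (min k P.length) P b).length) ∧
      Emitted (paramsOf ε k P) P (emitList (paramsOf ε k P) (min k P.length) P
        (JOf ε P.length + mOf ε)) s' := by
  have hn : 1 ≤ P.length := List.length_pos_iff.2 hP
  have hκ : 1 ≤ min k P.length := le_min hk hn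
  unfold reduceProg
  rw [wp_block_cons]
  refine (wp_setup hε hε2 s h0 h1 he hx hy).frame.mono fun t1 s1 ⟨⟨c1, ht1⟩, f1⟩ => ?_
  rw [wp_block_cons]
  refine (wp_pointLoop c1 (wOf_pos hε hε2) hκ ((f1.nreg 4 (by decide)).trans h4)
    ((f1.nreg 15 (by decide)).trans h15) (by rw [f1.narr 9 (by decide)]; exact a9)
    (by rw [f1.narr 10 (by decide)]; exact a10)).mono fun t2 s2 ⟨hp, ht2⟩ => ?_
  rw [wp_block_singleton]
  refine (wp_emit hκ hp).mono fun t3 s3 ⟨ht3, hp3, e2, a0, hE⟩ => ⟨?_, hp3, e2, a0, hE⟩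
  replace ht2 : t2 ≤ 700 * (P.length * (JOf ε P.length + wOf ε + hOf ε (min k P.length) + 1)) + 10 :=
    ht2
  replace ht3 : t3 ≤ 200 * ((P.length + 1) * (JOf ε P.length + mOf ε + 1)) := ht3
  generalize P.length = n at *
  set X := JOf ε n + mOf ε + wOf ε + hOf ε (min k n) + 1 with hX
  have m1 : n * (JOf ε n + wOf ε + hOf ε (min k n) + 1) ≤ n * X :=
    Nat.mul_le_mul_left _ (by omega)
  have m2 : (n + 1) * (JOf ε n + mOf ε + 1) ≤ (n + 1) * X := Nat.mul_le_mul_left _ (by omega)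
  have m3 : X ≤ n * X := Nat.le_mul_of_pos_left _ hn
  have m4 : n ≤ n * X := Nat.le_mul_of_pos_right _ (by omega)
  have m5 : (n + 1) * X = n * X + X := by ring
  omega

end TourCover


namespace TourCover

/-! ## Labelling the tours of the instances -/

theorem StartsWith.of_append {α : Type*} {a : ℕ → α} {l l' : List α} (h : StartsWith a (l ++ l')) :
    StartsWith a l := fun i hi => by
  rw [h i (by simp; omega), List.getElem_append_left hi]

theorem StartsWith.flatten_apply {α : Type*} {a : ℕ → α} {l : List (List α)}
    (h : StartsWith a l.flatten) {i : ℕ} (hi : i < l.length) {v : ℕ} (hv : v < l[i].length) :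
    a ((l.take i).flatten.length + v) = l[i][v] := by
  have e : l.flatten = ((l.take i).flatten ++ l[i]) ++ (l.drop (i + 1)).flatten := by
    conv_lhs => rw [← List.take_append_drop i l, List.drop_eq_getElem_cons hi]
    rw [List.flatten_append, List.flatten_cons, List.append_assoc]
  rw [e] at h
  rw [h.of_append _ (by simp only [List.length_append]; omega),
    List.getElem_append_right (by omega)]
  simp

theorem emitList_succ (q : Params) (κ : ℕ) (P : List Plane) (b : ℕ) :
    emitList q κ P (b + 1) = emitList q κ P b ++ (q.kept κ P b).map (Prod.mk b) := by
  simp [emitList, List.range_succ]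

/-- The original indices of the points of block `b` start at the total size of the preceding
instances. This offset is attached to each tour, so that its vertices can be translated by one array
access. -/
theorem orig_apply {q : Params} {κ : ℕ} {P : List Plane} {a : ℕ → ℕ} {B : ℕ}
    (h : StartsWith a ((emitList q κ P B).map Prod.snd)) {b : ℕ} (hb : b < B) {p : ℕ}
    (hp : p < (q.kept κ P b).length) :
    a ((emitList q κ P b).length + p) = (q.kept κ P b).getD p 0 := by
  have key : StartsWith a ((emitList q κ P (b + 1)).map Prod.snd) := by
    obtain ⟨d, rfl⟩ : ∃ d, B = b + 1 + d := ⟨B - (b + 1), by omega⟩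
    clear hb
    induction d with
    | zero => exact h
    | succ d ih =>
      refine ih ?_
      rw [← add_assoc, emitList_succ, List.map_append] at h
      exact h.of_append
  rw [key _ (by simp [emitList_succ]; omega), List.getElem_map, List.getD_eq_getElem _ _ hp]
  simp only [emitList_succ]
  rw [List.getElem_append_right (by omega)]
  simp

/-- The tours of the instances with the offset of their instance and its residue class. -/
noncomputable def labelled (q : Params) (κ : ℕ) (P : List Plane) (Us : List (List (List ℕ)))
    (B : ℕ) : List (ℕ × ℕ × List ℕ) :=
  (List.range B).flatMap fun b =>
    (Us.getD b []).map fun t => ((emitList q κ P b).length, b % q.m, t)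

theorem labelled_succ (q : Params) (κ : ℕ) (P : List Plane) (Us : List (List (List ℕ))) (b : ℕ) :
    labelled q κ P Us (b + 1) = labelled q κ P Us b ++
      (Us.getD b []).map fun t => ((emitList q κ P b).length, b % q.m, t) := by
  simp [labelled, List.range_succ]

theorem labelled_tours (q : Params) (κ : ℕ) (P : List Plane) (Us : List (List (List ℕ))) :
    (labelled q κ P Us Us.length).map (fun e => e.2.2) = Us.flatten := by
  have e : (List.range Us.length).map (fun b => Us.getD b []) = Us := by
    refine List.ext_getElem (by simp) fun i h1 h2 => ?_
    rw [List.getElem_map, List.getElem_range, List.getD_eq_getElem _ _ h2]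
  simp only [labelled, List.map_flatMap, List.map_map, Function.comp_def, List.map_id']
  rw [List.flatMap_def, e]

/-- The tour in terms of the original indices. -/
def transTour (g : ℕ → ℕ) (e : ℕ × ℕ × List ℕ) : List ℕ := e.2.2.map fun v => g (e.1 + v)

/-- Selecting tours by residue label and translating them by offsets agrees with going through the
blocks of the class. -/
theorem labelled_class {q : Params} {κ : ℕ} {P : List Plane} {Us : List (List (List ℕ))} {B : ℕ}
    {g : ℕ → ℕ} (hg : StartsWith g ((emitList q κ P B).map Prod.snd))
    (hU : ∀ b < B, ∀ t ∈ Us.getD b [], ∀ p ∈ t, p < (q.kept κ P b).length) (j : ℕ) :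
    ((labelled q κ P Us B).filter fun e => e.2.1 = j).map (transTour g) =
      ((List.range B).filter fun b => b % q.m = j).flatMap fun b =>
        (Us.getD b []).map (List.map fun p => (q.kept κ P b).getD p 0) := by
  have key : ∀ b < B, ((Us.getD b []).map fun t =>
      ((emitList q κ P b).length, b % q.m, t)).map (transTour g) =
      (Us.getD b []).map (List.map fun p => (q.kept κ P b).getD p 0) := by
    intro b hb
    rw [List.map_map]
    refine List.map_congr_left fun t ht => List.map_congr_left fun p hp => ?_
    exact orig_apply hg hb (hU b hb t ht p hp)
  suffices H : ∀ b ≤ B, ((labelled q κ P Us b).filter fun e => e.2.1 = j).map (transTour g) =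
      ((List.range b).filter fun b => b % q.m = j).flatMap fun b =>
        (Us.getD b []).map (List.map fun p => (q.kept κ P b).getD p 0) from H B le_rfl
  intro b
  induction b with
  | zero => intro _; rfl
  | succ b ih =>
    intro hb
    rw [labelled_succ, List.filter_append, List.map_append, ih (by omega), List.range_succ,
      List.filter_append, List.flatMap_append]
    congr 1
    by_cases hj : b % q.m = j
    · rw [List.filter_eq_self.2 (by simp [hj]), key b (by omega)]
      simp [hj]
    · rw [List.filter_eq_nil_iff.2 (by simp [hj])]
      simp [hj]

def labelBlock : Prog := block [
  .setNReg 22 (.const 0),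
  .while (.nlt (.reg 22) (.arr 1 (.reg 16))) (block [
    .setNArr 12 (.reg 19) (.reg 20),
    .setNArr 13 (.reg 19) (.reg 21),
    .setNReg 19 (.add (.reg 19) (.const 1)),
    .setNReg 22 (.add (.reg 22) (.const 1))])]

theorem wp_labelBlock {s : Store} {A A' : List ℕ} (hl : A'.length = A.length)
    (h19 : s.nreg 19 = A.length) (h12 : StartsWith (s.narr 12) A)
    (h13 : StartsWith (s.narr 13) A') {c : ℕ} (hc : s.narr 1 (s.nreg 16) = c) :
    WP labelBlock s fun t s' => t ≤ 40 * (c + 1) ∧ s'.nreg 19 = A.length + c ∧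
      StartsWith (s'.narr 12) (A ++ List.replicate c (s.nreg 20)) ∧
      StartsWith (s'.narr 13) (A' ++ List.replicate c (s.nreg 21)) := by
  unfold labelBlock
  simp only [wp_block_cons, wp_block_singleton, wp_setNReg, NExp.eval]
  refine wp_while c (fun i t s' => t ≤ 40 * i ∧ s'.nreg 22 = i ∧ s'.narr 1 = s.narr 1 ∧
    s'.nreg 16 = s.nreg 16 ∧ s'.nreg 20 = s.nreg 20 ∧ s'.nreg 21 = s.nreg 21 ∧
    s'.nreg 19 = A.length + i ∧
    StartsWith (s'.narr 12) (A ++ List.replicate i (s.nreg 20)) ∧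
    StartsWith (s'.narr 13) (A' ++ List.replicate i (s.nreg 21))) ?_ ?_ ?_ ?_
  · rintro i t s' hi ⟨ht, e22, a1, e16, e20, e21, e19, a12, a13⟩
    refine ⟨by simpa [e22, a1, e16, hc] using hi, ?_⟩
    have h1 := a12.concat (s.nreg 20)
    have h2 := a13.concat (s.nreg 21)
    rw [List.length_append, List.length_replicate, List.append_assoc, ← List.replicate_succ'] at h1 h2
    rw [hl] at h2
    simp [e22, a1, e16, e20, e21, e19, h1, h2]
    omega
  · rintro t s' ⟨ht, e22, a1, e16, -⟩
    simp [e22, a1, e16, hc]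
  · simp [h19, h12, h13]
  · rintro t s' ⟨ht, e22, a1, e16, e20, e21, e19, a12, a13⟩
    exact ⟨by simp; omega, e19, a12, a13⟩

def labels : Prog := block [
  .setNReg 16 (.const 0),
  .setNReg 19 (.const 0),
  .setNReg 20 (.const 0),
  .setNReg 21 (.const 0),
  .while (.nlt (.reg 16) (.reg 2)) (block [
    labelBlock,
    .setNReg 20 (.add (.reg 20) (.arr 0 (.reg 16))),
    .ite (.nlt (.add (.reg 21) (.const 1)) (.reg 7)) (.setNReg 21 (.add (.reg 21) (.const 1)))
      (.setNReg 21 (.const 0)),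
    .setNReg 16 (.add (.reg 16) (.const 1))])]

/-- The residue of the block number is kept by a counter that wraps around, as the machine has no
division of natural numbers. -/
theorem succ_mod_eq {b m : ℕ} (hm : 1 ≤ m) :
    (b + 1) % m = if b % m + 1 < m then b % m + 1 else 0 := by
  have h1 : (b + 1) % m = (b % m + 1) % m := by simp
  have h2 := Nat.mod_lt b hm
  rw [h1]
  split_ifs with h
  · exact Nat.mod_eq_of_lt h
  · rw [show b % m + 1 = m by omega, Nat.mod_self]

theorem wp_labels {q : Params} {κ : ℕ} {P : List Plane} {Us : List (List (List ℕ))} {s : Store}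
    (hm : 1 ≤ q.m) (h2 : s.nreg 2 = Us.length) (h7 : s.nreg 7 = q.m)
    (a0 : StartsWith (s.narr 0) ((List.range Us.length).map fun b => (q.kept κ P b).length))
    (a1 : ∀ b < Us.length, s.narr 1 b = (Us.getD b []).length) :
    WP labels s fun t s' => t ≤ 80 * (Us.length + Us.flatten.length + 1) ∧
      s'.nreg 19 = (labelled q κ P Us Us.length).length ∧
      StartsWith (s'.narr 12) ((labelled q κ P Us Us.length).map fun e => e.1) ∧
      StartsWith (s'.narr 13) ((labelled q κ P Us Us.length).map fun e => e.2.1) := by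
  unfold labels
  simp only [wp_block_cons, wp_block_singleton, wp_setNReg, NExp.eval]
  refine wp_while Us.length (fun b t s' =>
    t ≤ 80 * (b + (labelled q κ P Us b).length) ∧ s'.nreg 2 = Us.length ∧
    s'.nreg 7 = q.m ∧ s'.narr 0 = s.narr 0 ∧ s'.narr 1 = s.narr 1 ∧ s'.nreg 16 = b ∧
    s'.nreg 20 = (emitList q κ P b).length ∧ s'.nreg 21 = b % q.m ∧
    s'.nreg 19 = (labelled q κ P Us b).length ∧
    StartsWith (s'.narr 12) ((labelled q κ P Us b).map fun e => e.1) ∧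
    StartsWith (s'.narr 13) ((labelled q κ P Us b).map fun e => e.2.1)) ?_ ?_ ?_ ?_
  · rintro b t s' hb ⟨ht, e2, e7, b0, b1, e16, e20, e21, e19, b12, b13⟩
    refine ⟨by simpa [e2, e16] using hb, ?_⟩
    rw [wp_block_cons]
    refine (wp_labelBlock (by simp) (by simpa using e19) b12 b13
      (c := (Us.getD b []).length) (by rw [e16, b1, a1 b hb])).frame.mono fun t1 s1 ⟨⟨ht1, g19, g12, g13⟩, f⟩ => ?_
    have k0 : s1.narr 0 b = (q.kept κ P b).length := by
      rw [f.narr 0 (by decide), b0, a0 b (by simpa using hb)]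
      simp
    have hlen : (labelled q κ P Us (b + 1)).length =
        (labelled q κ P Us b).length + (Us.getD b []).length := by simp [labelled_succ]
    rw [e20] at g12
    rw [e21] at g13
    have l12 : StartsWith (s1.narr 12) ((labelled q κ P Us (b + 1)).map fun e => e.1) := by
      simpa [labelled_succ, Function.comp_def] using g12
    have l13 : StartsWith (s1.narr 13) ((labelled q κ P Us (b + 1)).map fun e => e.2.1) := by
      simpa [labelled_succ, Function.comp_def] using g13
    rw [List.length_map] at g19
    simp only [wp_block_cons, wp_block_singleton, wp_setNReg, wp_ite]
    have hsucc := succ_mod_eq (b := b) hm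
    have d0 : s1.narr 0 = s.narr 0 := (f.narr 0 (by decide)).trans b0
    have d1 : s1.narr 1 = s.narr 1 := (f.narr 1 (by decide)).trans b1
    have d2 := (f.nreg 2 (by decide)).trans e2
    have d7 := (f.nreg 7 (by decide)).trans e7
    have d16 := (f.nreg 16 (by decide)).trans e16
    have d20 := (f.nreg 20 (by decide)).trans e20
    have d21 := (f.nreg 21 (by decide)).trans e21
    rw [d0] at k0
    refine ⟨fun hlt => ?_, fun hlt => ?_⟩
    · simp only [BExp.eval, NExp.eval] at hlt
      simp [d7, d21] at hlt
      simp [d0, d1, d2, d7, d16, d20, d21, k0, l12, l13, hsucc, hlt, hlen, g19, emitList_succ,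
        -List.getD_eq_getElem?_getD]
      omega
    · simp only [BExp.eval, NExp.eval] at hlt
      simp [d7, d21] at hlt
      simp [d0, d1, d2, d7, d16, d20, k0, l12, l13, hsucc, hlt.not_gt, hlen, g19,
        emitList_succ, -List.getD_eq_getElem?_getD]
      omega
  · rintro t s' ⟨ht, e2, e7, b0, b1, e16, -⟩
    simp [e2, e16]
  · refine ⟨by simp, by simpa using h2, by simpa using h7, rfl, rfl, by simp, by simp [emitList],
      by simp, by simp [labelled], ?_, ?_⟩
    · intro i hi; simp [labelled] at hi
    · intro i hi; simp [labelled] at hi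
  · rintro t s' ⟨ht, e2, e7, b0, b1, e16, e20, e21, e19, b12, b13⟩
    refine ⟨?_, e19, b12, b13⟩
    have := congrArg List.length (labelled_tours q κ P Us)
    rw [List.length_map] at this
    simp only [BExp.cost, NExp.cost]
    omega

end TourCover


namespace TourCover

/-! ## Choosing the best residue class -/

/-- The memory holds the labelled tours `L` and the original indices `g`. -/
structure HoldsTours (P : List Plane) (g : ℕ → ℕ) (L : List (ℕ × ℕ × List ℕ)) (s : Store) :
    Prop where
  count : s.nreg 19 = L.length
  off : StartsWith (s.narr 12) (L.map fun e => e.1)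
  cls : StartsWith (s.narr 13) (L.map fun e => e.2.1)
  len : StartsWith (s.narr 2) (L.map fun e => e.2.2.length)
  vert : StartsWith (s.narr 3) (L.map fun e => e.2.2).flatten
  orig : s.narr 11 = g
  x : ∀ i, s.rarr 0 i = P.getD i 0 0
  y : ∀ i, s.rarr 1 i = P.getD i 0 1

variable {P : List Plane} {g : ℕ → ℕ} {L : List (ℕ × ℕ × List ℕ)} {s : Store}

theorem HoldsTours.agree (h : HoldsTours P g L s) {s' : Store} {nr rr na ra : List ℕ}
    (hs : AgreeOff nr rr na ra s s') (h1 : 19 ∉ nr) (h2 : ∀ a ∈ [2, 3, 11, 12, 13], a ∉ na)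
    (h3 : ∀ a ∈ [0, 1], a ∉ ra) : HoldsTours P g L s' where
  count := by rw [hs.nreg 19 h1]; exact h.count
  off := by rw [hs.narr 12 (h2 12 (by simp))]; exact h.off
  cls := by rw [hs.narr 13 (h2 13 (by simp))]; exact h.cls
  len := by rw [hs.narr 2 (h2 2 (by simp))]; exact h.len
  vert := by rw [hs.narr 3 (h2 3 (by simp))]; exact h.vert
  orig := by rw [hs.narr 11 (h2 11 (by simp))]; exact h.orig
  x := by rw [hs.rarr 0 (h3 0 (by simp))]; exact h.x
  y := by rw [hs.rarr 1 (h3 1 (by simp))]; exact h.y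

/-- The number of vertices of the first `i` tours. -/
def vertPos (L : List (ℕ × ℕ × List ℕ)) (i : ℕ) : ℕ :=
  ((L.map fun e => e.2.2).take i).flatten.length

theorem vertPos_succ {i : ℕ} (hi : i < L.length) : vertPos L (i + 1) =
    vertPos L i + L[i].2.2.length := by
  rw [vertPos, vertPos, ← List.take_concat_get' _ _ (by simpa using hi)]
  simp

theorem vertPos_length (L : List (ℕ × ℕ × List ℕ)) :
    vertPos L L.length = (L.map fun e => e.2.2).flatten.length := by
  rw [vertPos, List.take_of_length_le (by simp)]

theorem HoldsTours.off_apply (h : HoldsTours P g L s) {i : ℕ} (hi : i < L.length) :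
    s.narr 12 i = L[i].1 := by rw [h.off i (by simpa using hi), List.getElem_map]

theorem HoldsTours.cls_apply (h : HoldsTours P g L s) {i : ℕ} (hi : i < L.length) :
    s.narr 13 i = L[i].2.1 := by rw [h.cls i (by simpa using hi), List.getElem_map]

theorem HoldsTours.len_apply (h : HoldsTours P g L s) {i : ℕ} (hi : i < L.length) :
    s.narr 2 i = L[i].2.2.length := by rw [h.len i (by simpa using hi), List.getElem_map]

theorem HoldsTours.vert_apply (h : HoldsTours P g L s) {i : ℕ} (hi : i < L.length) {v : ℕ}
    (hv : v < L[i].2.2.length) : s.narr 3 (vertPos L i + v) = L[i].2.2[v] := by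
  have := h.vert.flatten_apply (i := i) (v := v) (by simpa using hi) (by simpa using hv)
  simpa only [vertPos, List.getElem_map] using this

theorem dist_eq_sqrt (p q : Plane) : dist p q =
    √((q 0 - p 0) * (q 0 - p 0) + (q 1 - p 1) * (q 1 - p 1)) := by
  rw [dist_comm, dist_eq_norm, norm_eq_sqrt]
  simp

/-- The index of the current vertex. -/
def vertexExp : NExp := .arr 11 (.add (.arr 12 (.reg 23)) (.arr 3 (.reg 24)))

def tourCost : Prog := block [
  .setNReg 25 (.const 0),
  .setRReg 8 (.ofNat (.const 0)),
  .setRReg 9 (.ofNat (.const 0)),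
  .setRReg 10 (.ofNat (.const 0)),
  .while (.nlt (.reg 25) (.arr 2 (.reg 23))) (block [
    .setNReg 26 vertexExp,
    .setRReg 8 (.add (.reg 8) (.sqrt (.add
      (.mul (.sub (.arr 0 (.reg 26)) (.reg 9)) (.sub (.arr 0 (.reg 26)) (.reg 9)))
      (.mul (.sub (.arr 1 (.reg 26)) (.reg 10)) (.sub (.arr 1 (.reg 26)) (.reg 10)))))),
    .setRReg 9 (.arr 0 (.reg 26)),
    .setRReg 10 (.arr 1 (.reg 26)),
    .setNReg 24 (.add (.reg 24) (.const 1)),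
    .setNReg 25 (.add (.reg 25) (.const 1))]),
  .setRReg 8 (.add (.reg 8) (.sqrt (.add (.mul (.reg 9) (.reg 9)) (.mul (.reg 10) (.reg 10)))))]

theorem wp_tourCost (h : HoldsTours P g L s) {i : ℕ} (hi : i < L.length) (h23 : s.nreg 23 = i)
    (h24 : s.nreg 24 = vertPos L i) :
    WP tourCost s fun t s' => t ≤ 80 * L[i].2.2.length + 50 ∧ s'.nreg 24 = vertPos L (i + 1) ∧
      s'.rreg 8 = tourLength P (transTour g L[i]) := by
  unfold tourCost
  simp only [wp_block_cons, wp_block_singleton, wp_setNReg, wp_setRReg, NExp.eval, RExp.eval]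
  set l := (transTour g L[i]).map fun i => P.getD i 0 with hl
  have hll : l.length = L[i].2.2.length := by simp [hl, transTour]
  -- Invariant: the length so far plus that of the remaining path from the current position `p` is
  -- the length of the tour. Initially `p` is the origin.
  refine wp_while L[i].2.2.length (fun v t s' => t ≤ 80 * v ∧ HoldsTours P g L s' ∧
    s'.nreg 23 = i ∧ s'.nreg 24 = vertPos L i + v ∧ s'.nreg 25 = v ∧
    ∃ p : Plane, s'.rreg 9 = p 0 ∧ s'.rreg 10 = p 1 ∧
      s'.rreg 8 + pathLength (p :: (l.drop v ++ [0])) = closedLength l) ?_ ?_ ?_ ?_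
  · rintro v t s' hv ⟨ht, hs, e23, e24, e25, p, e9, e10, e8⟩
    refine ⟨by simpa [e23, e25, hs.len_apply hi] using hv, ?_⟩
    have hvl : v < l.length := by omega
    rw [List.drop_eq_getElem_cons hvl, List.cons_append, pathLength_cons_cons, dist_eq_sqrt] at e8
    have hlv : P.getD (g (L[i].1 + L[i].2.2[v])) 0 = l[v] := by simp [hl, transTour]
    have h26 : vertexExp.eval s' = g (L[i].1 + L[i].2.2[v]) := by
      simp only [vertexExp, NExp.eval, e23, e24, hs.orig, hs.off_apply hi, hs.vert_apply hi hv]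
    have hx := hs.x (g (L[i].1 + L[i].2.2[v]))
    have hy := hs.y (g (L[i].1 + L[i].2.2[v]))
    rw [hlv] at hx hy
    have hc : vertexExp.cost = 6 := rfl
    simp only [wp_block_cons, wp_block_singleton, wp_setNReg, wp_setRReg]
    refine ⟨?_, ?_, ?_⟩
    · simp [hc]; omega
    · exact ⟨by simpa using hs.count, hs.off, hs.cls, hs.len, hs.vert, hs.orig, hs.x, hs.y⟩
    · simp [e23, e24, e25, h26, hx, hy, e9, e10]
      refine ⟨by omega, l[v], rfl, rfl, ?_⟩
      linarith
  · rintro t s' ⟨ht, hs, e23, e24, e25, -⟩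
    simp [e23, e25, hs.len_apply hi]
  · refine ⟨by simp, ⟨by simpa using h.count, h.off, h.cls, h.len, h.vert, h.orig, h.x, h.y⟩,
      by simpa using h23, by simpa using h24, by simp, 0, by simp, by simp, ?_⟩
    simp [closedLength]
  · rintro t s' ⟨ht, hs, e23, e24, e25, p, e9, e10, e8⟩
    rw [← hll, List.drop_length, List.nil_append, pathLength_cons_cons, dist_zero_right,
      norm_eq_sqrt] at e8
    refine ⟨by simp; omega, by simpa [vertPos_succ hi] using e24, ?_⟩
    rw [tourLength_eq, ← hl, ← e8]
    simp [e9, e10, pathLength]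

/-- One pass computes the costs of all classes, adding each tour to the cell of its class. The
lengths are measured at the original points, not at their positions in the instances. -/
def costLoop : Prog := block [
  .setNReg 23 (.const 0),
  .setNReg 24 (.const 0),
  .while (.nlt (.reg 23) (.reg 19)) (block [
    tourCost,
    .setRArr 7 (.arr 13 (.reg 23)) (.add (.arr 7 (.arr 13 (.reg 23))) (.reg 8)),
    .setNReg 23 (.add (.reg 23) (.const 1))])]

/-- The tours of the class `j` among `L` in terms of the original indices. -/
def classOf (g : ℕ → ℕ) (L : List (ℕ × ℕ × List ℕ)) (j : ℕ) : List (List ℕ) :=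
  (L.filter fun e => e.2.1 = j).map (transTour g)

theorem classOf_take_succ {i : ℕ} (hi : i < L.length) (j : ℕ) : classOf g (L.take (i + 1)) j =
    if L[i].2.1 = j then classOf g (L.take i) j ++ [transTour g L[i]]
    else classOf g (L.take i) j := by
  rw [← List.take_concat_get' _ _ hi]
  simp only [classOf, List.filter_append, List.filter_cons, List.filter_nil, decide_eq_true_eq]
  split_ifs
  · rw [List.map_append]; rfl
  · rw [List.append_nil]

theorem wp_costLoop (h : HoldsTours P g L s) (h7 : ∀ j, s.rarr 7 j = 0) :
    WP costLoop s fun t s' => t ≤ 100 * (L.length + vertPos L L.length + 1) ∧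
      ∀ j, s'.rarr 7 j = coverLength P (classOf g L j) := by
  unfold costLoop
  simp only [wp_block_cons, wp_block_singleton, wp_setNReg, NExp.eval]
  refine wp_while L.length (fun i t s' => t ≤ 100 * (i + vertPos L i) ∧ HoldsTours P g L s' ∧
    s'.nreg 23 = i ∧ s'.nreg 24 = vertPos L i ∧
    ∀ j, s'.rarr 7 j = coverLength P (classOf g (L.take i) j)) ?_ ?_ ?_ ?_
  · rintro i t s' hi ⟨ht, hs, e23, e24, a7⟩
    refine ⟨by simpa [e23, hs.count] using hi, ?_⟩
    rw [wp_block_cons]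
    refine (wp_tourCost hs hi e23 e24).frame.mono fun t1 s1 ⟨⟨ht1, g24, g8⟩, f⟩ => ?_
    have hs1 := hs.agree f (by decide) (by decide) (by decide)
    have g23 := (f.nreg 23 (by decide)).trans e23
    simp only [wp_block_cons, wp_block_singleton, wp_setNReg, wp_setRArr]
    simp only [NExp.eval, RExp.eval, NExp.cost, RExp.cost, BExp.cost, g23, hs1.cls_apply hi, g8]
    refine ⟨?_, ?_, ?_, ?_, ?_⟩
    · rw [vertPos_succ hi]; omega
    · exact ⟨by simpa using hs1.count, hs1.off, hs1.cls, hs1.len, hs1.vert, hs1.orig,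
        by simpa using hs1.x, by simpa using hs1.y⟩
    · simp
    · simpa using g24
    · intro j
      rw [classOf_take_succ hi, f.rarr 7 (by decide)]
      by_cases hj : L[i].2.1 = j
      · subst hj
        simp [a7, coverLength]
      · simp [hj, Ne.symm hj, a7]
  · rintro t s' ⟨ht, hs, e23, -⟩
    simp [e23, hs.count]
  · refine ⟨by simp [vertPos], ⟨by simpa using h.count, h.off, h.cls, h.len, h.vert, h.orig, h.x,
      h.y⟩, by simp, by simp [vertPos], fun j => ?_⟩
    simpa [classOf, coverLength] using h7 j
  · rintro t s' ⟨ht, hs, e23, e24, a7⟩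
    rw [List.take_length] at a7
    exact ⟨by simp; omega, a7⟩

def argmin : Prog := block [
  .setNReg 27 (.const 0),
  .setNReg 28 (.const 1),
  .while (.nlt (.reg 28) (.reg 7)) (block [
    .ite (.rlt (.arr 7 (.reg 28)) (.arr 7 (.reg 27))) (.setNReg 27 (.reg 28)) .skip,
    .setNReg 28 (.add (.reg 28) (.const 1))])]

theorem wp_argmin {m : ℕ} (hm : 1 ≤ m) (h7 : s.nreg 7 = m) :
    WP argmin s fun t s' => t ≤ 40 * m ∧ s'.nreg 27 < m ∧
      ∀ j < m, s.rarr 7 (s'.nreg 27) ≤ s.rarr 7 j := by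
  unfold argmin
  simp only [wp_block_cons, wp_block_singleton, wp_setNReg, NExp.eval]
  -- Class 0 is the first candidate, so `m - 1` comparisons suffice and register 28 is one ahead of
  -- the iteration count.
  refine wp_while (m - 1) (fun i t s' => t ≤ 30 * i ∧ s'.nreg 7 = m ∧ s'.nreg 28 = i + 1 ∧
    s'.rarr 7 = s.rarr 7 ∧ s'.nreg 27 < i + 1 ∧ ∀ j < i + 1, s.rarr 7 (s'.nreg 27) ≤ s.rarr 7 j)
    ?_ ?_ ?_ ?_
  · rintro i t s' hi ⟨ht, e7, e28, a7, e27, hmin⟩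
    refine ⟨by simp [e7, e28]; omega, ?_⟩
    simp only [wp_block_cons, wp_block_singleton, wp_setNReg, wp_ite, wp_skip]
    refine ⟨fun hlt => ?_, fun hlt => ?_⟩
    · simp only [BExp.eval, RExp.eval, NExp.eval, e28, a7] at hlt
      simp only [NExp.eval, NExp.cost, BExp.cost, RExp.cost, e28, Function.update_self, ne_eq,
        Nat.reduceEqDiff, not_false_eq_true, Function.update_of_ne, e7, a7, true_and]
      refine ⟨by omega, by omega, fun j hj => ?_⟩
      rcases (Nat.lt_succ_iff.1 hj).eq_or_lt with rfl | hj'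
      · exact le_rfl
      · exact hlt.le.trans (hmin j hj')
    · simp only [BExp.eval, RExp.eval, NExp.eval, e28, a7, not_lt] at hlt
      simp only [NExp.eval, NExp.cost, BExp.cost, RExp.cost, e28, Function.update_self, ne_eq,
        Nat.reduceEqDiff, not_false_eq_true, Function.update_of_ne, e7, a7, true_and]
      refine ⟨by omega, by omega, fun j hj => ?_⟩
      rcases (Nat.lt_succ_iff.1 hj).eq_or_lt with rfl | hj'
      · exact hlt
      · exact hmin j hj'
  · rintro t s' ⟨ht, e7, e28, -⟩
    simp [e7, e28]
    omega
  · simp [h7]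
  · rintro t s' ⟨ht, e7, e28, a7, e27, hmin⟩
    rw [show m - 1 + 1 = m by omega] at e27 hmin
    exact ⟨by simp; omega, e27, hmin⟩

/-! ## Writing the chosen tours -/

def copyTour : Prog := block [
  .setNReg 25 (.const 0),
  .while (.nlt (.reg 25) (.arr 2 (.reg 23))) (block [
    .setNArr 5 (.reg 15) vertexExp,
    .setNReg 15 (.add (.reg 15) (.const 1)),
    .setNReg 24 (.add (.reg 24) (.const 1)),
    .setNReg 25 (.add (.reg 25) (.const 1))]),
  .setNArr 4 (.reg 4) (.arr 2 (.reg 23)),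
  .setNReg 4 (.add (.reg 4) (.const 1))]

theorem wp_copyTour (h : HoldsTours P g L s) {U : List (List ℕ)} (hU : HoldsCover s U)
    (h15 : s.nreg 15 = U.flatten.length) {i : ℕ} (hi : i < L.length) (h23 : s.nreg 23 = i)
    (h24 : s.nreg 24 = vertPos L i) :
    WP copyTour s fun t s' => t ≤ 60 * L[i].2.2.length + 50 ∧ s'.nreg 24 = vertPos L (i + 1) ∧
      HoldsCover s' (U ++ [transTour g L[i]]) ∧
      s'.nreg 15 = (U ++ [transTour g L[i]]).flatten.length := by
  unfold copyTour
  simp only [wp_block_cons, wp_block_singleton, wp_setNReg, wp_setNArr, NExp.eval]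
  set l := transTour g L[i] with hl
  have hll : l.length = L[i].2.2.length := by simp [hl, transTour]
  refine wp_while L[i].2.2.length (fun v t s' => t ≤ 60 * v ∧ HoldsTours P g L s' ∧
    s'.nreg 23 = i ∧ s'.nreg 24 = vertPos L i + v ∧ s'.nreg 25 = v ∧
    s'.nreg 15 = (U.flatten ++ l.take v).length ∧ StartsWith (s'.narr 5) (U.flatten ++ l.take v) ∧
    s'.nreg 4 = s.nreg 4 ∧ s'.narr 4 = s.narr 4) ?_ ?_ ?_ ?_
  · rintro v t s' hv ⟨ht, hs, e23, e24, e25, e15, a5, e4, a4⟩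
    refine ⟨by simpa [e23, e25, hs.len_apply hi] using hv, ?_⟩
    have hvl : v < l.length := by omega
    have htake : U.flatten ++ l.take (v + 1) = U.flatten ++ l.take v ++ [l[v]] := by
      rw [List.append_assoc, List.take_concat_get' l v hvl]
    have hvert : vertexExp.eval s' = l[v] := by
      simp only [vertexExp, NExp.eval, e23, e24, hs.orig, hs.off_apply hi, hs.vert_apply hi hv]
      simp [hl, transTour]
    have hc : vertexExp.cost = 6 := rfl
    simp only [wp_block_cons, wp_block_singleton, wp_setNReg, wp_setNArr]
    simp only [NExp.eval, NExp.cost, BExp.cost, e23, e24, e25, e15, e4, a4, hvert, hc, htake,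
      Function.update_self, ne_eq, Nat.reduceEqDiff, not_false_eq_true, Function.update_of_ne,
      true_and, and_true]
    refine ⟨by omega, ⟨by simpa using hs.count, by simpa using hs.off, by simpa using hs.cls,
      by simpa using hs.len, by simpa using hs.vert, by simpa using hs.orig, hs.x, hs.y⟩,
      by omega, by rw [List.length_append (as := _ ++ _), List.length_singleton], a5.concat _⟩
  · rintro t s' ⟨ht, hs, e23, e24, e25, -⟩
    simp [e23, e25, hs.len_apply hi]
  · refine ⟨by simp, ⟨by simpa using h.count, h.off, h.cls, h.len, h.vert, h.orig, h.x, h.y⟩,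
      by simpa using h23, by simpa using h24, by simp, by simpa using h15, ?_, by simp, rfl⟩
    simpa using hU.vertices
  · rintro t s' ⟨ht, hs, e23, e24, e25, e15, a5, e4, a4⟩
    rw [← hll, List.take_length] at e15 a5
    have hfl : (U ++ [l]).flatten = U.flatten ++ l := by simp
    rw [hU.count] at e4
    rw [hfl]
    have a4' := hU.sizes.concat l.length
    simp only [e4, e23, hs.len_apply hi, ← hll, a4, NExp.cost, BExp.cost]
    rw [List.length_map] at a4'
    refine ⟨by omega, by simpa [vertPos_succ hi, hll] using e24, ⟨by simp, ?_, ?_⟩,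
      by simpa using e15⟩
    · simpa using a4'
    · rw [hfl]; simpa using a5

def output : Prog := block [
  .setNReg 23 (.const 0),
  .setNReg 24 (.const 0),
  .while (.nlt (.reg 23) (.reg 19)) (block [
    .ite (.and (.not (.nlt (.arr 13 (.reg 23)) (.reg 27))) (.not (.nlt (.reg 27) (.arr 13 (.reg 23)))))
      copyTour
      (.setNReg 24 (.add (.reg 24) (.arr 2 (.reg 23)))),
    .setNReg 23 (.add (.reg 23) (.const 1))])]

theorem wp_output (h : HoldsTours P g L s) {D : List (List ℕ)} (hD : HoldsCover s D)
    (h15 : s.nreg 15 = D.flatten.length) {j : ℕ} (h27 : s.nreg 27 = j) :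
    WP output s fun t s' => t ≤ 100 * (L.length + vertPos L L.length + 1) ∧
      HoldsCover s' (D ++ classOf g L j) := by
  unfold output
  simp only [wp_block_cons, wp_block_singleton, wp_setNReg, NExp.eval]
  refine wp_while L.length (fun i t s' => t ≤ 100 * (i + vertPos L i) ∧ HoldsTours P g L s' ∧
    s'.nreg 23 = i ∧ s'.nreg 24 = vertPos L i ∧ s'.nreg 27 = j ∧
    HoldsCover s' (D ++ classOf g (L.take i) j) ∧
    s'.nreg 15 = (D ++ classOf g (L.take i) j).flatten.length) ?_ ?_ ?_ ?_
  · rintro i t s' hi ⟨ht, hs, e23, e24, e27, hU, e15⟩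
    refine ⟨by simpa [e23, hs.count] using hi, ?_⟩
    rw [wp_block_cons, wp_ite]
    refine ⟨fun hb => ?_, fun hb => ?_⟩
    · have hj : L[i].2.1 = j := by
        simp [e23, e27, hs.cls_apply hi] at hb
        omega
      refine (wp_copyTour hs hU e15 hi e23 e24).frame.mono fun t1 s1 ⟨⟨ht1, g24, hU1, g15⟩, f⟩ => ?_
      have hs1 := hs.agree f (by decide) (by decide) (by decide)
      rw [classOf_take_succ hi, if_pos hj, ← List.append_assoc]
      simp only [wp_block_singleton, wp_setNReg, NExp.eval, NExp.cost, BExp.cost,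
        f.nreg 23 (by decide), e23]
      refine ⟨by rw [vertPos_succ hi]; omega, hs1.agree (AgreeOff.setNReg s1 23 (i + 1)) (by decide)
        (by decide) (by decide), by simp, by simpa using g24,
        by simpa using (f.nreg 27 (by decide)).trans e27,
        ⟨by simpa using hU1.count, hU1.sizes, hU1.vertices⟩, by simpa using g15⟩
    · have hj : ¬ L[i].2.1 = j := by
        intro hj
        simp [e23, e27, hs.cls_apply hi, hj] at hb
      rw [classOf_take_succ hi, if_neg hj]
      simp only [wp_block_singleton, wp_setNReg, NExp.eval, NExp.cost, BExp.cost, e23, e24,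
        hs.len_apply hi]
      refine ⟨by rw [vertPos_succ hi]; omega, ⟨by simpa using hs.count, hs.off, hs.cls, hs.len,
        hs.vert, hs.orig, hs.x, hs.y⟩, by simp [e23], by simp [vertPos_succ hi], by simpa using e27,
        ⟨by simpa using hU.count, hU.sizes, hU.vertices⟩, by simpa using e15⟩
  · rintro t s' ⟨ht, hs, e23, -⟩
    simp [e23, hs.count]
  · have hnil : D ++ classOf g (L.take 0) j = D := by simp [classOf]
    rw [hnil]
    exact ⟨by simp [vertPos], ⟨by simpa using h.count, h.off, h.cls, h.len, h.vert, h.orig, h.x,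
      h.y⟩, by simp, by simp [vertPos], by simpa using h27,
      ⟨by simpa using hD.count, hD.sizes, hD.vertices⟩, by simpa using h15⟩
  · rintro t s' ⟨ht, hs, e23, e24, e27, hU, e15⟩
    rw [List.take_length] at hU
    exact ⟨by simp; omega, hU⟩

end TourCover

namespace TourCover

/-! ## The combination step -/

/-- The intermediate data of the reduction are not part of the input, so the reduction is repeated.
It leaves the fixed tours in the output arrays, where `output` appends the tours of the best class.
-/
def combineProg : Prog := block [reduceProg, labels, costLoop, argmin, output]

theorem wp_reduceProg_input {ε : ℝ} (hε : 0 < ε) (hε2 : ε ≤ 1 / 2) {k : ℕ} (hk : 1 ≤ k)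
    {P : List Plane} (hP : P ≠ []) :
    WP reduceProg (reduceInput ε k P) fun t s' => HoldsInstances s' (instances ε k P) ∧
      t ≤ 3000 * (P.length * (JOf ε P.length + mOf ε + wOf ε + hOf ε (min k P.length) + 1)) := by
  refine (wp_reduceProg hε hε2 hk hP (reduceInput ε k P) rfl rfl rfl (fun _ => rfl) (fun _ => rfl)
    rfl rfl (fun _ => rfl) (fun _ => rfl)).mono fun t s' ⟨ht, _, e2, a0, hE⟩ => ⟨?_, ht⟩
  exact holdsInstances_of_emitted e2 a0 hE

theorem wp_combineProg_input {ε : ℝ} (hε : 0 < ε) (hε2 : ε ≤ 1 / 2) {k : ℕ} (hk : 1 ≤ k)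
    {P : List Plane} (hP : P ≠ []) {Us : List (List (List ℕ))}
    (hUs : List.Forall₂ (fun I U => IsTourCover k I U) (instances ε k P) Us) :
    WP combineProg (combineInput ε k P Us) fun t s' => ∃ j < mOf ε,
      (∀ j' < mOf ε, coverLength P (classTours ε k P Us j) ≤
        coverLength P (classTours ε k P Us j')) ∧
      HoldsCover s' ((paramsOf ε k P).fixedTours (min k P.length) P ++ classTours ε k P Us j) ∧
      t ≤ 4000 * ((P.length + coversSize Us) *
        (JOf ε P.length + mOf ε + wOf ε + hOf ε (min k P.length) + 1)) := by
  have hn : 1 ≤ P.length := List.length_pos_iff.2 hP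
  have hlen : Us.length = JOf ε P.length + mOf ε := by
    rw [← hUs.length_eq, instances, List.length_map, List.length_range]
  unfold combineProg
  rw [wp_block_cons]
  refine (wp_reduceProg hε hε2 hk hP (combineInput ε k P Us) rfl rfl rfl (fun _ => rfl)
    (fun _ => rfl) rfl rfl (fun _ => rfl) (fun _ => rfl)).frame.mono
    fun t1 s1 ⟨⟨ht1, hp1, e2, a0, hE⟩, f1⟩ => ?_
  rw [← hlen] at e2 a0 hE
  set q := paramsOf ε k P with hq
  set κ := min k P.length with hκ
  have hm : 1 ≤ q.m := mOf_pos hε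
  have hU : ∀ b < Us.length, ∀ t ∈ Us.getD b [], ∀ p ∈ t, p < (q.kept κ P b).length := by
    intro b hb t ht p hp
    have := hUs.get (i := b) (by rw [hUs.length_eq]; exact hb) hb
    simp only [List.get_eq_getElem, instances, List.getElem_map, List.getElem_range] at this
    rw [List.getD_eq_getElem _ _ hb] at ht
    simpa [Params.inst] using this.index_lt t ht p hp
  set L := labelled q κ P Us Us.length with hL
  have hclass : ∀ j, classOf (s1.narr 11) L j = classTours ε k P Us j := by
    intro j
    rw [classOf, hL, labelled_class hE.orig hU j, classTours, hlen]
    rfl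
  have hLlen : L.length = Us.flatten.length := by
    rw [← labelled_tours q κ P Us, List.length_map]
  have hLv : vertPos L L.length = Us.flatten.flatten.length := by
    rw [vertPos_length, hL, labelled_tours]
  rw [wp_block_cons]
  refine (wp_labels (κ := κ) (P := P) hm e2 hp1.ctx.m a0 fun b hb => ?_).frame.mono
    fun t2 s2 ⟨⟨ht2, g19, b12, b13⟩, f2⟩ => ?_
  · rw [f1.narr 1 (by decide)]
    simp [combineInput, hb]
  have hT : HoldsTours P (s1.narr 11) L s2 := by
    refine ⟨g19, b12, b13, ?_, ?_, f2.narr 11 (by decide), ?_, ?_⟩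
    · rw [f2.narr 2 (by decide), f1.narr 2 (by decide)]
      have : (L.map fun e => e.2.2.length) = Us.flatten.map List.length := by
        rw [← labelled_tours q κ P Us, List.map_map]; rfl
      rw [this]
      intro i hi
      simp only [combineInput]
      simp only [OfNat.ofNat_ne_one, if_false, if_true]
      exact List.getD_eq_getElem _ _ hi
    · rw [f2.narr 3 (by decide), f1.narr 3 (by decide), hL, labelled_tours]
      intro i hi
      simp only [combineInput]
      simp only [OfNat.ofNat_ne_one, Nat.reduceEqDiff, if_false, if_true]
      exact List.getD_eq_getElem _ _ hi
    · rw [f2.rarr 0 (by decide)]; exact hp1.ctx.x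
    · rw [f2.rarr 1 (by decide)]; exact hp1.ctx.y
  rw [wp_block_cons]
  refine (wp_costLoop hT fun j => ?_).frame.mono fun t3 s3 ⟨⟨ht3, a7⟩, f3⟩ => ?_
  · rw [f2.rarr 7 (by decide), f1.rarr 7 (by decide)]
    rfl
  rw [wp_block_cons]
  refine (wp_argmin hm (((f3.nreg 7 (by decide)).trans (f2.nreg 7 (by decide))).trans
    hp1.ctx.m)).frame.mono fun t4 s4 ⟨⟨ht4, hj, hmin⟩, f4⟩ => ?_
  have hT4 := (hT.agree f3 (by decide) (by decide) (by decide)).agree f4 (by decide) (by decide)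
    (by decide)
  have hp4 := ((hp1.peel.agree f2 (by decide) (by decide)).agree f3 (by decide) (by decide)).agree f4
    (by decide) (by decide)
  rw [wp_block_singleton]
  refine (wp_output hT4 hp4.cover hp4.ptr rfl).mono fun t5 s5 ⟨ht5, hU5⟩ => ?_
  refine ⟨s4.nreg 27, hj, fun j' hj' => ?_, ?_, ?_⟩
  · have := hmin j' hj'
    rwa [a7, a7, hclass, hclass] at this
  · rwa [hclass] at hU5
  · rw [hLv, hLlen] at ht3 ht5
    replace ht4 : t4 ≤ 40 * mOf ε := ht4
    rw [hlen] at ht2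
    simp only [coversSize]
    generalize P.length = n at *
    generalize Us.flatten.length = u at *
    generalize Us.flatten.flatten.length = v at *
    set X := JOf ε n + mOf ε + wOf ε + hOf ε κ + 1 with hX
    have m1 : (n + (u + v)) * X = n * X + u * X + v * X := by ring
    have m2 : u ≤ u * X := Nat.le_mul_of_pos_right _ (by omega)
    have m3 : v ≤ v * X := Nat.le_mul_of_pos_right _ (by omega)
    have m4 : X ≤ n * X := Nat.le_mul_of_pos_left _ hn
    omega

theorem time_le {ε : ℝ} (hε : 0 < ε) (hε2 : ε ≤ 1 / 2) {k n N t : ℕ} (hk : 1 ≤ k) (hn : 1 ≤ n)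
    (hnN : n ≤ N)
    (ht : t ≤ 4000 * (N * (JOf ε n + mOf ε + wOf ε + hOf ε (min k n) + 1))) :
    (t : ℝ) ≤ 4000 * timeFactor ε * (N * Real.log ((N : ℝ) + 1)) := by
  have h1 := sum_params_le hε hε2 (le_min hk hn) (min_le_right k n)
  have h2 : Real.log ((n : ℝ) + 1) ≤ Real.log ((N : ℝ) + 1) := by
    refine Real.log_le_log (by positivity) ?_
    have : (n : ℝ) ≤ N := by exact_mod_cast hnN
    linarith
  have h3 := h1.trans (mul_le_mul_of_nonneg_left h2 (timeFactor_nonneg hε hε2))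
  have h4 : (t : ℝ) ≤ 4000 * (N * ((JOf ε n + mOf ε + wOf ε + hOf ε (min k n) + 1 : ℕ) : ℝ)) := by
    exact_mod_cast ht
  have h5 := mul_le_mul_of_nonneg_left h3 (Nat.cast_nonneg (α := ℝ) N)
  linarith

end TourCover

/-! ### The main theorem -/

theorem theorem3 :
    ∃ (reduce combine : Prog) (C : ℝ) (T : ℝ → ℝ),
      ∀ (ε : ℝ), 0 < ε → ε ≤ 1 / 2 →
      ∀ (k : ℕ), 1 ≤ k →
      ∀ (P : List Plane), P ≠ [] → (∀ p ∈ P, p ≠ 0) →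
      ∃ (Is : List (List Plane)) (t : ℕ) (s : Store),
        -- the reduction computes the instances `Is` in time `O(n log n)` for fixed `ε`
        Exec reduce (reduceInput ε k P) t s ∧ HoldsInstances s Is ∧
        (t : ℝ) ≤ T ε * (P.length * Real.log (P.length + 1)) ∧
        -- number, disjointness, size and spread of the instances
        (Is.length : ℝ) ≤ C * (ε⁻¹ * Real.log (P.length / ε) / Real.log (1 / ε)) ∧
        Is.Pairwise List.Disjoint ∧
        (∀ I ∈ Is,
          (∀ p ∈ I, p ≠ 0) ∧
          (I.length : ℝ) ≤ C * ((k : ℝ) ^ 5 * (ε⁻¹) ^ 6 * Real.log (1 / ε) ^ 2) ∧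
          ∀ p ∈ I, ∀ q ∈ I, ‖p‖ ≤ (1 / ε) ^ (C / ε) * ‖q‖) ∧
        -- approximate solutions of the instances are combined into one of the original problem
        ∀ Us : List (List (List ℕ)),
          List.Forall₂ (fun I U => IsApproxCover (1 + ε) k I U) Is Us →
          ∃ (U : List (List ℕ)) (t' : ℕ) (s' : Store),
            Exec combine (combineInput ε k P Us) t' s' ∧ HoldsCover s' U ∧
            (t' : ℝ) ≤ T ε * ((P.length + coversSize Us : ℕ) *
              Real.log ((P.length + coversSize Us : ℕ) + 1)) ∧
            IsApproxCover (1 + C * ε) k P U := by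
  -- The single constant 50000 dominates those in the number, size, spread and approximation bounds.
  refine ⟨reduceProg, combineProg, 50000, fun ε => 4000 * timeFactor ε, ?_⟩
  intro ε hε hε2 k hk P hP h0
  have hn : 1 ≤ P.length := List.length_pos_iff.2 hP
  obtain ⟨h1, h2, h3⟩ := instances_spec hε hε2 hk hP h0
  obtain ⟨t, s, he, hI, ht⟩ := wp_reduceProg_input hε hε2 hk hP
  refine ⟨instances ε k P, t, s, he, hI, time_le hε hε2 hk hn le_rfl (by omega), h1, h2, h3, ?_⟩
  intro Us hUs
  obtain ⟨t', s', he', j, hj, hmin, hU, ht'⟩ :=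
    wp_combineProg_input hε hε2 hk hP (hUs.imp fun _ _ h => h.1)
  exact ⟨_, t', s', he', hU, time_le hε hε2 hk hn (Nat.le_add_right _ _) ht',
    classTours_approx hε hε2 hk hP h0 hUs hj hmin⟩
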